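/- **Definitions.** Let $Q=\mathrm{Sp}(1)$ be the group of unit quaternions and let $Q^n$ act on $\mathbb H^n$ by the regular representation $(q\cdot h)_i=q_ih_i$. Let $\mathrm{Aut}(Q^n)$ be the group of topological automorphisms of $Q^n$, with the discrete topology; each of its elements permutes the $n$ factors. Let $\Lambda\cong\mathbb Z^n$ be the integral lattice, with one basis vector $\varepsilon_i$ (the integral generator of the $i$-th factor) for each factor $\mathrm{Sp}(1)$ of $Q^n$; $\mathrm{Aut}(Q^n)$ acts on $\Lambda$ by permuting the $\varepsilon_i$ as it permutes the factors. *Local actions.* Let $M$ be a compact Hausdorff space. A *local $Q^n$-action* on $M$ is given by charts $\varphi_\alpha:U_\alpha\to\varphi_\alpha(U_\alpha)$, where the $U_\alpha$ form an open cover of $M$ and each $\varphi_\alpha$ is a homeomorphism onto an open $Q^n$-invariant subset of $\mathbb H^n$, such that for all $\alpha,\beta$ the set $\varphi_\alpha(U_\alpha\cap U_\beta)$ is $Q^n$-invariant and $\varphi_\beta\circ\varphi_\alpha^{-1}(q\cdot h)=\rho_{\alpha\beta}(q)\cdot\varphi_\beta\circ\varphi_\alpha^{-1}(h)$ on it for some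 $\rho_{\alpha\beta}\in\mathrm{Aut}(Q^n)$. In particular $M$ is a compact topological $4n$-manifold. A homeomorphism between two such manifolds is *equivariant* if in all pairs of charts it is defined on a $Q^n$-invariant set, has $Q^n$-invariant image, and is locally $\rho$-equivariant for some $\rho\in\mathrm{Aut}(Q^n)$. The orbit space $B_M$ is, through the maps $h\mapsto(|h_1|,\dots,|h_n|)$ in the charts, a topological $n$-manifold with corners: it has an atlas with values in open subsets of $[0,\infty)^n$ whose transition maps preserve the number of vanishing coordinates. The *codimension-$k$ stratum* of a manifold with corners consists of the points at which $k$ coordinates vanish. *Characteristic pairs.* Let $B$ be a topological $n$-manifold with corners. A *characteristic pair* $(P,\mathcal L)$ on $B$ consists of a principal $\mathrm{Aut}(Q^n)$-bundle $P\to B$ and a bundle $\mathcal L$ over the codimension-$1$ stratum of subgroups of the fibres of $\Lambda_P=P\times_{\mathrm{Aut}(Q^n)}\Lambda$, such that 1. near each point of that stratum there is a local trivialization of $P$ in which $\mathcal L$ is constant, spanned by one of the $\varepsilon_i$; 2. (unimodularity) for each point $b$ of the codimension-$k$ stratum and each sufficiently small open neighbourhood of $b$, the fibres of $\mathcal L$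 over that neighbourhood generate, in a local trivialization of $P$ near $b$, a direct summand of rank $k$ of $\Lambda$. An *isomorphism* $(P_1,\mathcal L_1)\to(P_2,\mathcal L_2)$ is an isomorphism $f_P:P_1\to P_2$ of principal bundles that covers a strata-preserving homeomorphism $f_B:B_1\to B_2$ and whose induced map $\Lambda_{P_1}\to\Lambda_{P_2}$ takes $\mathcal L_1$ onto $\mathcal L_2$. The characteristic pair $(P_M,\mathcal L_M)$ of a manifold $M$ with a local $Q^n$-action, on $B_M$, has $P_M$ glued from the products $U^B_\alpha\times\mathrm{Aut}(Q^n)$ (with $U_\alpha^B$ the image of $U_\alpha$ in $B_M$) by $(b,g)_\alpha\sim(b,\rho_{\alpha\beta}\circ g)_\beta$; the fibre of $\mathcal L_M$ over a point $b$ of codimension $1$ is spanned, in the $\alpha$-trivialization, by the $\varepsilon_i$ of the factor that stabilizes the points of $\varphi_\alpha(U_\alpha)$ lying over $b$. *Canonical model and Euler class.* Given $(P,\mathcal L)$, let $Q_P=P\times_{\mathrm{Aut}(Q^n)}Q^n$, a bundle of groups over $B$. The *canonical model* $M_{(P,\mathcal L)}$ is the quotient space of $Q_P$ obtained by dividing each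 fibre over $b\in B$ by the (normal) subgroup generated by those factors $\mathrm{Sp}(1)$ whose generators span the fibres of $\mathcal L$ arbitrarily close to $b$. Its fibres over $B$ are groups, and $\mathcal S$ denotes the sheaf on $B$ of (in general noncommutative) groups of continuous local sections of $M_{(P,\mathcal L)}\to B$. $H^1(B,\mathcal S)$ is the first (nonabelian) Čech cohomology set: cocycles $\theta_{\alpha\beta}\in\mathcal S(U_\alpha\cap U_\beta)$ on open covers with $\theta_{\alpha\beta}\theta_{\beta\gamma}=\theta_{\alpha\gamma}$, modulo $\theta'_{\alpha\beta}=g_\alpha^{-1}\theta_{\alpha\beta}g_\beta$ and refinement. An isomorphism $f_P:(P_1,\mathcal L_1)\to(P_2,\mathcal L_2)$ induces a pullback $f_P^*:H^1(B_2,\mathcal S_2)\to H^1(B_1,\mathcal S_1)$. For a manifold $M$ with a local $Q^n$-action, each chart induces an identification $h_\alpha$, over $U_\alpha^B$, of $U_\alpha$ with the canonical model of $(P_M,\mathcal L_M)$: the point $q\cdot r\in\varphi_\alpha(U_\alpha)$, $r\in[0,\infty)^n$, $q\in Q^n$, corresponds to the class of $q$ in the $\alpha$-trivialization. On overlaps $h_\beta\circ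 h_\alpha^{-1}(x)=x\cdot\theta_{\alpha\beta}$ with a cocycle $(\theta_{\alpha\beta})$ in $\mathcal S$, whose class $e(M)\in H^1(B_M,\mathcal S)$ is the *Euler class* of $M$. **Theorem.** Let $n\ge 0$. (1) Let $M_1,M_2$ be compact Hausdorff spaces with local $Q^n$-actions. There is an equivariant homeomorphism $M_1\to M_2$ if and only if there is an isomorphism $f_P:(P_{M_1},\mathcal L_{M_1})\to(P_{M_2},\mathcal L_{M_2})$ of characteristic pairs with $f_P^*e(M_2)=e(M_1)$. (2) Conversely, let $B$ be a compact (Hausdorff, second countable) topological $n$-manifold with corners, $(P,\mathcal L)$ a characteristic pair on $B$, and $e\in H^1(B,\mathcal S)$. Then there are a compact Hausdorff space $M$ with a local $Q^n$-action and an isomorphism $f_P:(P_M,\mathcal L_M)\to(P,\mathcal L)$ of characteristic pairs with $f_P^*e=e(M)$. -/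

import Mathlib

universe u

namespace LocalQ

open Set Topology Quaternion

/-! ### The quaternionic torus, its regular representation and its automorphisms -/

/-- `Q = Sp(1)`, the group of unit quaternions. -/
abbrev Q : Type := Metric.sphere (0 : ℍ[ℝ]) 1

/-- The quaternionic torus `Qⁿ`. -/
abbrev QTorus (n : ℕ) : Type := Fin n → Q

/-- The space `ℍⁿ`. -/
abbrev HSpace (n : ℕ) : Type := Fin n → ℍ[ℝ]

/-- The regular representation of `Qⁿ` on `ℍⁿ`. -/
noncomputable def reg {n : ℕ} (q : QTorus n) (h : HSpace n) : HSpace n := fun i => (q i : ℍ[ℝ]) * h i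

/-- Invariance of a subset of `ℍⁿ` under the regular representation. -/
def RegInvariant {n : ℕ} (S : Set (HSpace n)) : Prop := ∀ q : QTorus n, ∀ h ∈ S, reg q h ∈ S

/-- `Aut(Qⁿ)`, the group of automorphisms of the topological group `Qⁿ`. -/
noncomputable def autSubgroup (n : ℕ) : Subgroup (MulAut (QTorus n)) where
  carrier := {g | Continuous g ∧ Continuous (g⁻¹ : MulAut (QTorus n))}
  mul_mem' {a b} ha hb := ⟨ha.1.comp hb.1, by
    rw [mul_inv_rev]; exact hb.2.comp ha.2⟩
  one_mem' := ⟨continuous_id, continuous_id⟩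
  inv_mem' {a} ha := ⟨ha.2, by rw [inv_inv]; exact ha.1⟩

/-- `Aut(Qⁿ)`. -/
abbrev QAut (n : ℕ) : Type := autSubgroup n

/-- `Aut(Qⁿ)` is regarded as a discrete group. -/
instance (n : ℕ) : TopologicalSpace (QAut n) := ⊥

instance (n : ℕ) : DiscreteTopology (QAut n) := ⟨rfl⟩

/-- The automorphism `g` applied to an element of `Qⁿ`. -/
noncomputable def ev {n : ℕ} (g : QAut n) (q : QTorus n) : QTorus n := g.1 q

@[simp] lemma ev_one {n : ℕ} (q : QTorus n) : ev (1 : QAut n) q = q := rfl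

lemma ev_mul {n : ℕ} (g h : QAut n) (q : QTorus n) : ev (g * h) q = ev g (ev h q) := rfl

@[simp] lemma ev_map_one {n : ℕ} (g : QAut n) : ev g 1 = 1 := map_one g.1

@[simp] lemma ev_map_mul {n : ℕ} (g : QAut n) (q r : QTorus n) :
    ev g (q * r) = ev g q * ev g r := map_mul g.1 q r

@[simp] lemma ev_map_inv {n : ℕ} (g : QAut n) (q : QTorus n) :
    ev g q⁻¹ = (ev g q)⁻¹ := map_inv g.1 q

lemma ev_injective {n : ℕ} (g : QAut n) : Function.Injective (ev g) := g.1.injective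

/-! ### Automorphisms of `Qⁿ` permute the factors -/

lemma commute_of_commute {x a b : ℍ[ℝ]} (hx : x.im ≠ 0) (ha : a * x = x * a)
    (hb : b * x = x * b) : a * b = b * a := by
  rw [Quaternion.ext_iff] at ha hb
  simp only [Quaternion.re_mul, Quaternion.imI_mul, Quaternion.imJ_mul, Quaternion.imK_mul] at ha hb
  obtain ⟨-, a1, a2, a3⟩ := ha
  obtain ⟨-, b1, b2, b3⟩ := hb
  have e1 : a.imJ * x.imK = a.imK * x.imJ := by linarith
  have e2 : a.imK * x.imI = a.imI * x.imK := by linarith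
  have e3 : a.imI * x.imJ = a.imJ * x.imI := by linarith
  have f1 : b.imJ * x.imK = b.imK * x.imJ := by linarith
  have f2 : b.imK * x.imI = b.imI * x.imK := by linarith
  have f3 : b.imI * x.imJ = b.imJ * x.imI := by linarith
  have key : a.imJ * b.imK = a.imK * b.imJ ∧ a.imK * b.imI = a.imI * b.imK ∧
      a.imI * b.imJ = a.imJ * b.imI := by
    have hx' : x.imI ≠ 0 ∨ x.imJ ≠ 0 ∨ x.imK ≠ 0 := by
      by_contra hc
      push Not at hc
      exact hx (by ext <;> simp [hc])
    rcases hx' with h | h | h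
    · refine ⟨?_, ?_, ?_⟩ <;> apply mul_left_cancel₀ h <;> grind
    · refine ⟨?_, ?_, ?_⟩ <;> apply mul_left_cancel₀ h <;> grind
    · refine ⟨?_, ?_, ?_⟩ <;> apply mul_left_cancel₀ h <;> grind
  obtain ⟨k1, k2, k3⟩ := key
  ext
  · simp only [Quaternion.re_mul]; ring
  · simp only [Quaternion.imI_mul]; linarith
  · simp only [Quaternion.imJ_mul]; linarith
  · simp only [Quaternion.imK_mul]; linarith

lemma exists_perp (a b c : ℝ) :
    ∃ x y z : ℝ, x ^ 2 + y ^ 2 + z ^ 2 = 1 ∧ a * x + b * y + c * z = 0 := by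
  by_cases h : a = 0 ∧ b = 0
  · exact ⟨1, 0, 0, by norm_num, by simp [h.1]⟩
  · have hp : 0 < a ^ 2 + b ^ 2 := by
      rcases not_and_or.1 h with h | h <;> positivity
    have hs : √(a ^ 2 + b ^ 2) ^ 2 = a ^ 2 + b ^ 2 := Real.sq_sqrt hp.le
    have hne : √(a ^ 2 + b ^ 2) ≠ 0 := (Real.sqrt_pos.2 hp).ne'
    refine ⟨-b / √(a ^ 2 + b ^ 2), a / √(a ^ 2 + b ^ 2), 0, ?_, ?_⟩
    · rw [div_pow, div_pow, hs]; field_simp; ring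
    · field_simp; ring

lemma mem_Q_iff (q : ℍ[ℝ]) : q ∈ Metric.sphere (0 : ℍ[ℝ]) 1 ↔
    q.re ^ 2 + q.imI ^ 2 + q.imJ ^ 2 + q.imK ^ 2 = 1 := by
  rw [mem_sphere_zero_iff_norm, ← Quaternion.normSq_def', Quaternion.normSq_eq_norm_mul_self,
    ← sq]
  exact ⟨fun h => by rw [h]; norm_num, fun h => by nlinarith [norm_nonneg q]⟩

lemma conj_perp {w v : ℍ[ℝ]} (hw : w.re ^ 2 + w.imI ^ 2 + w.imJ ^ 2 + w.imK ^ 2 = 1)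
    (hv : v.re = 0) (hp : w.imI * v.imI + w.imJ * v.imJ + w.imK * v.imK = 0) :
    w * v * w = v := by
  ext
  · simp only [Quaternion.re_mul, Quaternion.imI_mul, Quaternion.imJ_mul, Quaternion.imK_mul, hv]
    linear_combination (-2 * w.re) * hp
  · simp only [Quaternion.re_mul, Quaternion.imI_mul, Quaternion.imJ_mul, Quaternion.imK_mul, hv]
    linear_combination v.imI * hw - 2 * w.imI * hp
  · simp only [Quaternion.re_mul, Quaternion.imI_mul, Quaternion.imJ_mul, Quaternion.imK_mul, hv]
    linear_combination v.imJ * hw - 2 * w.imJ * hp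
  · simp only [Quaternion.re_mul, Quaternion.imI_mul, Quaternion.imJ_mul, Quaternion.imK_mul, hv]
    linear_combination v.imK * hw - 2 * w.imK * hp

lemma mul_self_eq {w q : ℍ[ℝ]}
    (h0 : w.re ^ 2 - w.imI ^ 2 - w.imJ ^ 2 - w.imK ^ 2 = q.re) (h1 : 2 * w.re * w.imI = q.imI)
    (h2 : 2 * w.re * w.imJ = q.imJ) (h3 : 2 * w.re * w.imK = q.imK) : w * w = q := by
  ext
  · rw [Quaternion.re_mul, ← h0]; ring
  · rw [Quaternion.imI_mul, ← h1]; ring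
  · rw [Quaternion.imJ_mul, ← h2]; ring
  · rw [Quaternion.imK_mul, ← h3]; ring

lemma exists_sqrt (q : Q) : ∃ w : Q, w * w = q := by
  obtain ⟨q, hq⟩ := q
  have hq' := (mem_Q_iff q).1 hq
  by_cases h : q.re = -1
  · have hI : q.imI = 0 := by nlinarith [sq_nonneg q.imI, sq_nonneg q.imJ, sq_nonneg q.imK]
    have hJ : q.imJ = 0 := by nlinarith [sq_nonneg q.imI, sq_nonneg q.imJ, sq_nonneg q.imK]
    have hK : q.imK = 0 := by nlinarith [sq_nonneg q.imI, sq_nonneg q.imJ, sq_nonneg q.imK]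
    refine ⟨⟨⟨0, 1, 0, 0⟩, (mem_Q_iff _).2 (by norm_num)⟩, Subtype.ext ?_⟩
    exact mul_self_eq (by simp [h]) (by simp [hI]) (by simp [hJ]) (by simp [hK])
  · have hlt : 0 < (1 + q.re) / 2 := by
      have : -1 ≤ q.re := by nlinarith [sq_nonneg q.imI, sq_nonneg q.imJ, sq_nonneg q.imK]
      have := lt_of_le_of_ne this (Ne.symm h)
      linarith
    obtain ⟨s, hs0, hs⟩ : ∃ s : ℝ, 0 < s ∧ s ^ 2 = (1 + q.re) / 2 :=
      ⟨√((1 + q.re) / 2), Real.sqrt_pos.2 hlt, Real.sq_sqrt hlt.le⟩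
    have hre : q.re = 2 * s ^ 2 - 1 := by linarith
    have him : q.imI ^ 2 + q.imJ ^ 2 + q.imK ^ 2 = 4 * s ^ 2 * (1 - s ^ 2) := by
      rw [hre] at hq'; linear_combination hq'
    refine ⟨⟨⟨s, q.imI / (2 * s), q.imJ / (2 * s), q.imK / (2 * s)⟩, (mem_Q_iff _).2 ?_⟩,
      Subtype.ext ?_⟩
    · simp only
      field_simp
      linear_combination him
    · refine mul_self_eq ?_ ?_ ?_ ?_
      · simp only [hre]
        field_simp
        linear_combination -him
      all_goals simp only; field_simp

lemma exists_commutator (q : Q) : ∃ w v : Q, q * v * w = w * v := by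
  obtain ⟨w, rfl⟩ := exists_sqrt q
  obtain ⟨x, y, z, h1, h2⟩ := exists_perp (w : ℍ[ℝ]).imI (w : ℍ[ℝ]).imJ (w : ℍ[ℝ]).imK
  let v : Q := ⟨⟨0, x, y, z⟩, (mem_Q_iff _).2 (by linear_combination h1)⟩
  have h : w * v * w = v := Subtype.ext (conj_perp ((mem_Q_iff _).1 w.2) rfl h2)
  refine ⟨w, v, ?_⟩
  rw [mul_assoc w w v, mul_assoc w (w * v) w, h]

/-- A homomorphism on `Q` with commuting values is trivial. -/
lemma hom_trivial (f : Q → Q) (hf : ∀ a b, f (a * b) = f a * f b)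
    (hc : ∀ a b, f a * f b = f b * f a) (q : Q) : f q = 1 := by
  obtain ⟨w, v, h⟩ := exists_commutator q
  have h' := congrArg f h
  rw [hf, hf, hf, mul_assoc, hc v w] at h'
  exact mul_eq_right.1 h'

/-- `Aut(Qⁿ)` maps the factor `i` to the factor `j`. -/
def MapsFactor {n : ℕ} (g : QAut n) (i j : Fin n) : Prop :=
  ∃ q : Q, ev g (Pi.mulSingle i q) j ≠ 1

lemma mapsFactor_left_unique {n : ℕ} {g : QAut n} {i i' j : Fin n}
    (h : MapsFactor g i j) (h' : MapsFactor g i' j) : i = i' := by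
  by_contra hne
  let f : Fin n → Q → Q := fun k q => ev g (Pi.mulSingle k q) j
  have hf : ∀ k a b, f k (a * b) = f k a * f k b := by
    intro k a b
    simp only [f, Pi.mulSingle_mul, ev_map_mul, Pi.mul_apply]
  have hcomm : ∀ a b, f i a * f i' b = f i' b * f i a := by
    intro a b
    have h1 : (Pi.mulSingle i a * Pi.mulSingle i' b : QTorus n) =
        Pi.mulSingle i' b * Pi.mulSingle i a := by
      ext1 k
      by_cases hk : k = i
      · have hk' : k ≠ i' := hk ▸ hne
        rw [Pi.mul_apply, Pi.mul_apply, Pi.mulSingle_eq_of_ne hk', mul_one, one_mul]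
      · rw [Pi.mul_apply, Pi.mul_apply, Pi.mulSingle_eq_of_ne hk, mul_one, one_mul]
    have h2 := congrFun (congrArg (ev g) h1) j
    rw [ev_map_mul, ev_map_mul] at h2
    exact h2
  by_cases hx : ∃ a, ((f i a : Q) : ℍ[ℝ]).im ≠ 0
  · obtain ⟨a, ha⟩ := hx
    obtain ⟨q, hq⟩ := h'
    refine hq (hom_trivial (f i') (hf i') (fun b c => Subtype.ext ?_) q)
    refine commute_of_commute ha ?_ ?_
    · exact congrArg Subtype.val (hcomm a b).symm
    · exact congrArg Subtype.val (hcomm a c).symm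
  · push Not at hx
    obtain ⟨q, hq⟩ := h
    refine hq (hom_trivial (f i) (hf i) (fun b c => Subtype.ext ?_) q)
    have hb := hx b
    have hc := hx c
    rw [Quaternion.ext_iff] at hb hc
    simp only [Quaternion.imI_im, Quaternion.imJ_im, Quaternion.imK_im, Quaternion.imI_zero,
      Quaternion.imJ_zero, Quaternion.imK_zero] at hb hc
    ext <;> simp [hb, hc, mul_comm]

lemma exists_Q_ne_one : ∃ q : Q, q ≠ 1 :=
  ⟨⟨⟨-1, 0, 0, 0⟩, (mem_Q_iff _).2 (by norm_num)⟩, fun h => by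
    have := congrArg (fun x : Q => (x : ℍ[ℝ]).re) h
    norm_num at this⟩

lemma exists_mapsFactor_of_ne_one {n : ℕ} (g : QAut n) (i : Fin n) {q : Q} (hq : q ≠ 1) :
    ∃ j, ev g (Pi.mulSingle i q) j ≠ 1 := by
  by_contra hc
  push Not at hc
  have h1 : ev g (Pi.mulSingle i q) = ev g 1 := by rw [ev_map_one]; exact funext hc
  exact hq (Pi.mulSingle_eq_one_iff.1 (ev_injective g h1))

lemma existsUnique_mapsFactor {n : ℕ} (g : QAut n) (i : Fin n) : ∃! j, MapsFactor g i j := by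
  obtain ⟨q, hq⟩ := exists_Q_ne_one
  have hex : ∀ i, ∃ j, MapsFactor g i j := fun i =>
    (exists_mapsFactor_of_ne_one g i hq).imp fun j hj => ⟨q, hj⟩
  choose s hs using hex
  have hinj : Function.Injective s := fun a b hab =>
    mapsFactor_left_unique (hs a) (hab ▸ hs b)
  have hsurj := Finite.surjective_of_injective hinj
  refine ⟨s i, hs i, fun j hj => ?_⟩
  obtain ⟨k, rfl⟩ := hsurj j
  rw [mapsFactor_left_unique hj (hs k)]

/-- The index of the factor onto which `g` maps the factor `i`. -/
noncomputable def permFun {n : ℕ} (g : QAut n) (i : Fin n) : Fin n :=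
  (existsUnique_mapsFactor g i).choose

lemma mapsFactor_iff {n : ℕ} (g : QAut n) (i j : Fin n) :
    MapsFactor g i j ↔ permFun g i = j :=
  ⟨fun h => ((existsUnique_mapsFactor g i).choose_spec.2 j h).symm,
    fun h => h ▸ (existsUnique_mapsFactor g i).choose_spec.1⟩

lemma permFun_one {n : ℕ} (i : Fin n) : permFun (1 : QAut n) i = i := by
  obtain ⟨q, hq⟩ := exists_Q_ne_one
  exact (mapsFactor_iff _ _ _).1 ⟨q, by simpa using hq⟩

lemma ev_mulSingle {n : ℕ} (g : QAut n) (i : Fin n) (q : Q) :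
    ev g (Pi.mulSingle i q) =
      Pi.mulSingle (permFun g i) (ev g (Pi.mulSingle i q) (permFun g i)) := by
  ext1 j
  by_cases h : j = permFun g i
  · subst h; simp
  · rw [Pi.mulSingle_eq_of_ne h]
    by_contra hc
    exact h ((mapsFactor_iff g i j).1 ⟨q, hc⟩).symm

lemma permFun_mul {n : ℕ} (g h : QAut n) (i : Fin n) :
    permFun (g * h) i = permFun g (permFun h i) := by
  obtain ⟨q, hq⟩ := exists_Q_ne_one
  refine (mapsFactor_iff _ _ _).1 ⟨q, ?_⟩
  rw [ev_mul, ev_mulSingle h]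
  have h1 : ev h (Pi.mulSingle i q) (permFun h i) ≠ 1 := by
    intro hc
    have h2 := ev_mulSingle h i q
    rw [hc, Pi.mulSingle_one, ← ev_map_one h] at h2
    exact hq (Pi.mulSingle_eq_one_iff.1 (ev_injective h h2))
  obtain ⟨j, hj⟩ := exists_mapsFactor_of_ne_one g (permFun h i) h1
  have := (mapsFactor_iff _ _ _).1 ⟨_, hj⟩
  rwa [← this] at hj

/-- The homomorphism `Aut(Qⁿ) → Sₙ` recording how an automorphism permutes the factors;
its kernel consists of the inner automorphisms. -/
noncomputable def perm (n : ℕ) : QAut n →* Equiv.Perm (Fin n) where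
  toFun g :=
    { toFun := permFun g
      invFun := permFun g⁻¹
      left_inv := fun i => by rw [← permFun_mul, inv_mul_cancel, permFun_one]
      right_inv := fun i => by rw [← permFun_mul, mul_inv_cancel, permFun_one] }
  map_one' := Equiv.ext permFun_one
  map_mul' g h := Equiv.ext (permFun_mul g h)


/-- The integral lattice `Λ = (4πℤ)ⁿ` of `Qⁿ`, in the basis consisting of the integral elements
`4πT₃` of the `n` factors; the integral element `Pi.single i 1` generates the `i`-th factor. -/
abbrev Lattice (n : ℕ) : Type := Fin n → ℤ

/-- The action of `Aut(Qⁿ)` on the lattice `Λ`. Inner automorphisms act trivially, so that the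
action is through the permutation of the factors. -/
noncomputable def latticeEv {n : ℕ} (g : QAut n) (v : Lattice n) : Lattice n :=
  fun i => v ((perm n g)⁻¹ i)

lemma latticeEv_single {n : ℕ} (g : QAut n) (i : Fin n) (k : ℤ) :
    latticeEv g (Pi.single i k) = Pi.single (perm n g i) k := by
  ext1 j
  by_cases h : j = perm n g i
  · subst h; simp [latticeEv]
  · rw [Pi.single_eq_of_ne h, latticeEv, Pi.single_eq_of_ne]
    intro hc
    exact h (by rw [← hc]; simp)

lemma latticeEv_mul {n : ℕ} (g h : QAut n) (v : Lattice n) :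
    latticeEv (g * h) v = latticeEv g (latticeEv h v) := by
  ext1 i
  simp only [latticeEv, map_mul, mul_inv_rev, Equiv.Perm.mul_apply]

lemma latticeEv_one {n : ℕ} (v : Lattice n) : latticeEv 1 v = v := by
  ext1 i
  simp only [latticeEv, map_one, inv_one, Equiv.Perm.one_apply]

/-- The coordinate of `g(q)` in the factor to which `g` maps the factor `j` depends only on the
coordinate of `q` in the factor `j`. -/
lemma ev_apply_eq_one {n : ℕ} (g : QAut n) {q : QTorus n} {j : Fin n} (hq : q j = 1) :
    ev g q (permFun g j) = 1 := by
  let H : Subgroup (QTorus n) :=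
    { carrier := {x | ev g x (permFun g j) = 1}
      mul_mem' := fun {a b} ha hb => by
        change ev g (a * b) _ = 1
        rw [ev_map_mul, Pi.mul_apply, ha, hb, mul_one]
      one_mem' := by
        change ev g 1 _ = 1
        rw [ev_map_one]; rfl
      inv_mem' := fun {a} ha => by
        change ev g a⁻¹ _ = 1
        rw [ev_map_inv, Pi.inv_apply, ha, inv_one] }
  refine Subgroup.pi_mem_of_mulSingle_mem (H := H) q fun i => ?_
  change ev g (Pi.mulSingle i (q i)) (permFun g j) = 1
  by_cases h : i = j
  · subst h; rw [hq, Pi.mulSingle_one, ev_map_one]; rfl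
  · rw [ev_mulSingle, Pi.mulSingle_eq_of_ne]
    exact fun hc => h ((perm n g).injective hc.symm)

/-! ### Manifolds with corners -/

/-- The orthant `ℝⁿ_{≥ 0}`. -/
abbrev Orthant (n : ℕ) : Type := Fin n → NNReal

/-- The number of vanishing coordinates of a point of the orthant, that is, the codimension of its
stratum. -/
noncomputable def depth {n : ℕ} (r : Orthant n) : ℕ := {i | r i = 0}.ncard

/-- The structure of a (topological) `n`-dimensional manifold with corners on `B`: an atlas of
homeomorphisms from open subsets of `B` to open subsets of `ℝⁿ_{≥ 0}` whose overlap maps preserve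
the stratification of `ℝⁿ_{≥ 0}`. (Separation and countability are separate hypotheses.) -/
structure Corners (n : ℕ) (B : Type u) [TopologicalSpace B] where
  atlas : Set (OpenPartialHomeomorph B (Orthant n))
  cover : ∀ b, ∃ c ∈ atlas, b ∈ c.source
  strata : ∀ c ∈ atlas, ∀ c' ∈ atlas, ∀ b ∈ c.source ∩ c'.source, depth (c b) = depth (c' b)

/-- The codimension-`k` stratum of a manifold with corners. -/
def Corners.stratum {n : ℕ} {B : Type u} [TopologicalSpace B] (C : Corners n B) (k : ℕ) : Set B :=
  {b | ∃ c ∈ C.atlas, b ∈ c.source ∧ depth (c b) = k}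

noncomputable instance (n : ℕ) : Group (QTorus n) := Pi.group

noncomputable instance (n : ℕ) (α : Type*) : Group (α → QTorus n) := Pi.group

/-! ### Principal `Aut(Qⁿ)`-bundles and associated bundles -/

/-- A principal bundle over `B` with the discrete structure group `Aut(Qⁿ)`. -/
structure PrincipalBundle (n : ℕ) (B : Type u) [TopologicalSpace B] where
  Total : Type u
  [topology : TopologicalSpace Total]
  proj : Total → B
  act : Total → QAut n → Total
  act_one : ∀ p, act p 1 = p
  act_mul : ∀ p g h, act p (g * h) = act (act p g) h
  proj_act : ∀ p g, proj (act p g) = proj p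
  locallyTrivial : ∀ b, ∃ e : Bundle.Trivialization (QAut n) proj, b ∈ e.baseSet ∧
    ∀ p g, proj p ∈ e.baseSet → (e (act p g)).2 = (e p).2 * g

attribute [instance] PrincipalBundle.topology

namespace PrincipalBundle

variable {n : ℕ} {B : Type u} [TopologicalSpace B] (P : PrincipalBundle n B)

lemma existsUnique_act {p p' : P.Total} (h : P.proj p = P.proj p') : ∃! g, P.act p g = p' := by
  obtain ⟨e, he, hact⟩ := P.locallyTrivial (P.proj p)
  refine ⟨(e p).2⁻¹ * (e p').2, ?_, ?_⟩
  · apply e.injOn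
    · rw [e.mem_source, P.proj_act]; exact he
    · rw [e.mem_source, ← h]; exact he
    · refine Prod.ext ?_ ?_
      · exact (e.coe_fst' (by rw [P.proj_act]; exact he)).trans
          ((P.proj_act _ _).trans (h.trans (e.coe_fst' (by rw [← h]; exact he)).symm))
      · exact (hact _ _ he).trans (mul_inv_cancel_left _ _)
  · intro g hg
    rw [← hg, hact _ _ he, inv_mul_cancel_left]

/-- The element of `Aut(Qⁿ)` that moves the frame `p` to the frame `p'`. -/
noncomputable def diff {p p' : P.Total} (h : P.proj p = P.proj p') : QAut n :=
  (P.existsUnique_act h).choose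

lemma act_diff {p p' : P.Total} (h : P.proj p = P.proj p') : P.act p (P.diff h) = p' :=
  (P.existsUnique_act h).choose_spec.1

lemma eq_diff {p p' : P.Total} (h : P.proj p = P.proj p') {g : QAut n} (hg : P.act p g = p') :
    g = P.diff h :=
  (P.existsUnique_act h).choose_spec.2 g hg

/-- The fibre of `P` over `b`. -/
abbrev Fib (b : B) : Type u := {p : P.Total // P.proj p = b}

/-- The action of `Aut(Qⁿ)` on a fibre of `P`. -/
def fibAct {b : B} (p : P.Fib b) (g : QAut n) : P.Fib b :=
  ⟨P.act p.1 g, (P.proj_act p.1 g).trans p.2⟩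

/-- The fibre over `b` of the quaternionic torus bundle `Q_P = P ×_{Aut(Qⁿ)} Qⁿ`: the group of
equivariant maps `P_b → Qⁿ`. The element `[p, q]` corresponds to the map that sends `p` to `q`. -/
def torusFiber (b : B) : Subgroup (P.Fib b → QTorus n) where
  carrier := {f | ∀ p g, f (P.fibAct p g) = ev g⁻¹ (f p)}
  mul_mem' {f f'} hf hf' p g := by simp only [Pi.mul_apply, hf p g, hf' p g, ev_map_mul]
  one_mem' p g := by simp only [Pi.one_apply, ev_map_one]
  inv_mem' {f} hf p g := by simp only [Pi.inv_apply, hf p g, ev_map_inv]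

/-- The fibre over `b` of the lattice bundle `Λ_P = P ×_{Aut(Qⁿ)} Λ`: the group of equivariant
maps `P_b → Λ`. The element `[p, v]` corresponds to the map that sends `p` to `v`. -/
def latticeFiber (b : B) : AddSubgroup (P.Fib b → Lattice n) where
  carrier := {f | ∀ p g, f (P.fibAct p g) = latticeEv g⁻¹ (f p)}
  add_mem' {f f'} hf hf' p g := by
    ext1 i; simp only [Pi.add_apply, hf p g, hf' p g, latticeEv]
  zero_mem' p g := by ext1 i; simp only [Pi.zero_apply, latticeEv]
  neg_mem' {f} hf p g := by ext1 i; simp only [Pi.neg_apply, hf p g, latticeEv]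

/-- The element `[p, q]` of the quaternionic torus bundle `Q_P`. -/
noncomputable def torusMk (p : P.Total) (q : QTorus n) : P.torusFiber (P.proj p) :=
  ⟨fun p' => ev (P.diff p'.2.symm)⁻¹ q, fun p' g => by
    have : P.diff (P.fibAct p' g).2.symm = P.diff p'.2.symm * g := by
      refine (P.eq_diff _ ?_).symm
      rw [P.act_mul, P.act_diff p'.2.symm]; rfl
    change ev (P.diff (P.fibAct p' g).2.symm)⁻¹ q = ev g⁻¹ (ev (P.diff p'.2.symm)⁻¹ q)
    rw [this, mul_inv_rev, ev_mul]⟩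

lemma torusMk_self (p : P.Total) (q : QTorus n) : (P.torusMk p q).1 ⟨p, rfl⟩ = q := by
  have : P.diff (p := p) (p' := p) rfl = 1 := (P.eq_diff _ (P.act_one p)).symm
  change ev (P.diff (p := p) (p' := p) rfl)⁻¹ q = q
  rw [this, inv_one, ev_one]

lemma torusFiber_ext {b : B} {f f' : P.torusFiber b} (p : P.Fib b) (h : f.1 p = f'.1 p) :
    f = f' := by
  refine Subtype.ext (funext fun p' => ?_)
  obtain ⟨g, hg, -⟩ := P.existsUnique_act (p.2.trans p'.2.symm)
  have h1 : p' = P.fibAct p g := Subtype.ext hg.symm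
  rw [h1, f.2, f'.2, h]

/-- The element `[p, v]` of the lattice bundle `Λ_P`. -/
noncomputable def latticeMk (p : P.Total) (v : Lattice n) : P.latticeFiber (P.proj p) :=
  ⟨fun p' => latticeEv (P.diff p'.2.symm)⁻¹ v, fun p' g => by
    have : P.diff (P.fibAct p' g).2.symm = P.diff p'.2.symm * g := by
      refine (P.eq_diff _ ?_).symm
      rw [P.act_mul, P.act_diff p'.2.symm]; rfl
    change latticeEv (P.diff (P.fibAct p' g).2.symm)⁻¹ v =
      latticeEv g⁻¹ (latticeEv (P.diff p'.2.symm)⁻¹ v)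
    rw [this, mul_inv_rev, latticeEv_mul]⟩

lemma latticeMk_self (p : P.Total) (v : Lattice n) : (P.latticeMk p v).1 ⟨p, rfl⟩ = v := by
  have : P.diff (p := p) (p' := p) rfl = 1 := (P.eq_diff _ (P.act_one p)).symm
  change latticeEv (P.diff (p := p) (p' := p) rfl)⁻¹ v = v
  rw [this, inv_one, latticeEv_one]

lemma continuous_act (g : QAut n) : Continuous fun p => P.act p g := by
  refine continuous_iff_continuousAt.2 fun p => ?_
  obtain ⟨e, he, hact⟩ := P.locallyTrivial (P.proj p)
  have hp : p ∈ e.source := e.mem_source.2 he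
  have h1 : ContinuousAt (fun x : B × QAut n => (x.1, x.2 * g)) (e p) :=
    (continuous_fst.prodMk ((continuous_of_discreteTopology (f := fun h : QAut n => h * g)).comp
      continuous_snd)).continuousAt
  have h2 : ((e p).1, (e p).2 * g) ∈ e.target := by
    rw [e.mem_target, e.coe_fst hp]; exact he
  have h3 : ContinuousAt (fun p' => e.toOpenPartialHomeomorph.symm ((e p').1, (e p').2 * g)) p :=
    ContinuousAt.comp (f := fun p' => ((e p').1, (e p').2 * g))
      (e.toOpenPartialHomeomorph.symm.continuousAt h2)
      (ContinuousAt.comp (f := e) h1 (e.toOpenPartialHomeomorph.continuousAt hp))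
  refine h3.congr ?_
  filter_upwards [e.open_source.mem_nhds hp] with p' hp'
  have hb : P.proj p' ∈ e.baseSet := e.mem_source.1 hp'
  have ha : P.act p' g ∈ e.source := by rw [e.mem_source, P.proj_act]; exact hb
  have h4 : e (P.act p' g) = ((e p').1, (e p').2 * g) := by
    refine Prod.ext ?_ (hact p' g hb)
    rw [e.coe_fst ha, e.coe_fst hp', P.proj_act]
  rw [← h4]
  exact e.toOpenPartialHomeomorph.left_inv ha

/-- The homeomorphism of the total space given by an element of `Aut(Qⁿ)`. -/
noncomputable def actHomeo (g : QAut n) : P.Total ≃ₜ P.Total where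
  toFun p := P.act p g
  invFun p := P.act p g⁻¹
  left_inv p := (P.act_mul p g g⁻¹).symm.trans (by rw [mul_inv_cancel, P.act_one])
  right_inv p := (P.act_mul p g⁻¹ g).symm.trans (by rw [inv_mul_cancel, P.act_one])
  continuous_toFun := P.continuous_act g
  continuous_invFun := P.continuous_act g⁻¹

end PrincipalBundle

/-! ### Characteristic pairs -/

/-- For a family `L` of subgroups of the fibres of `Λ_P` over a subset `S` of `B`: the subgroup over
the base point of `p`, read in the frame `p`, that is, the set of those `v` with `[p, v] ∈ L`.
It is empty if the base point of `p` is not in `S`. -/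
def inFrame {n : ℕ} {B : Type u} [TopologicalSpace B] (P : PrincipalBundle n B) {S : Set B}
    (L : (b : S) → AddSubgroup (P.latticeFiber b)) (p : P.Total) : Set (Lattice n) :=
  {v | ∃ (h : P.proj p ∈ S) (ξ : P.latticeFiber (P.proj p)),
    ξ ∈ L ⟨P.proj p, h⟩ ∧ ξ.1 ⟨p, rfl⟩ = v}

lemma mem_inFrame_iff {n : ℕ} {B : Type u} [TopologicalSpace B] {P : PrincipalBundle n B}
    {S : Set B} {L : (b : S) → AddSubgroup (P.latticeFiber b)} {p : P.Total} {b : B}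
    (hp : P.proj p = b) {v : Lattice n} : v ∈ inFrame P L p ↔
      ∃ (h : b ∈ S) (ξ : P.latticeFiber b), ξ ∈ L ⟨b, h⟩ ∧ ξ.1 ⟨p, hp⟩ = v := by
  subst hp; rfl

lemma inFrame_act {n : ℕ} {B : Type u} [TopologicalSpace B] {P : PrincipalBundle n B}
    {S : Set B} {L : (b : S) → AddSubgroup (P.latticeFiber b)} {p : P.Total} {g : QAut n}
    {v : Lattice n} : v ∈ inFrame P L (P.act p g) ↔ latticeEv g v ∈ inFrame P L p := by
  rw [mem_inFrame_iff (P.proj_act p g), mem_inFrame_iff rfl]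
  have key : ∀ ξ : P.latticeFiber (P.proj p), ξ.1 ⟨P.act p g, P.proj_act p g⟩ = v ↔
      ξ.1 ⟨p, rfl⟩ = latticeEv g v := by
    intro ξ
    have h := ξ.2 ⟨p, rfl⟩ g
    change ξ.1 (P.fibAct ⟨p, rfl⟩ g) = v ↔ _
    rw [h]
    constructor
    · rintro rfl; rw [← latticeEv_mul, mul_inv_cancel, latticeEv_one]
    · intro h'; rw [h', ← latticeEv_mul, inv_mul_cancel, latticeEv_one]
  simp only [key]

/-- A characteristic pair `(P, 𝓛)` on a manifold with corners: a principal `Aut(Qⁿ)`-bundle `P` and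
a unimodular rank-one sublattice bundle `𝓛` of `Λ_P` over the codimension-one stratum. -/
structure CharPair (n : ℕ) {B : Type u} [TopologicalSpace B] (C : Corners n B) where
  P : PrincipalBundle n B
  /-- The fibres of the bundle `𝓛`. -/
  L : (b : C.stratum 1) → AddSubgroup (P.latticeFiber b)
  /-- In suitable local trivializations of `P`, given by local sections `σ`, the bundle `𝓛` is a
  trivial bundle whose fibre is spanned by the integral element that generates one of the
  3-spheres of `Qⁿ`. -/
  locallyTrivial : ∀ b ∈ C.stratum 1, ∃ U : Set B, IsOpen U ∧ b ∈ U ∧ ∃ σ : B → P.Total,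
    ContinuousOn σ U ∧ (∀ b' ∈ U, P.proj (σ b') = b') ∧ ∃ i : Fin n, ∀ b' ∈ U ∩ C.stratum 1,
      inFrame P L (σ b') = (AddSubgroup.zmultiples (Pi.single i 1 : Lattice n) : Set (Lattice n))
  /-- For `b` in the codimension-`k` stratum, the fibres of `𝓛` over every sufficiently small
  neighbourhood of `b` generate a direct summand of rank `k` of the lattice. -/
  unimodular : ∀ k, ∀ b ∈ C.stratum k, ∃ U : Set B, IsOpen U ∧ b ∈ U ∧ ∃ σ : B → P.Total,
    ContinuousOn σ U ∧ (∀ b' ∈ U, P.proj (σ b') = b') ∧ ∀ V ⊆ U, IsOpen V → b ∈ V →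
      (∃ D : Submodule ℤ (Lattice n),
        IsCompl (Submodule.span ℤ (⋃ b' ∈ V, inFrame P L (σ b'))) D) ∧
      Module.finrank ℤ (Submodule.span ℤ (⋃ b' ∈ V, inFrame P L (σ b'))) = k

namespace CharPair

variable {n : ℕ} {B : Type u} [TopologicalSpace B] {C : Corners n B} (X : CharPair n C)

/-! ### The canonical model -/

/-- The indices of those factors of `Qⁿ` that are, in the frame `p`, generated by the fibres of `𝓛`
over points arbitrarily close to the base point of `p`. (As `P` is a covering of `B`, nearby
points of `P` are the parallel frames at nearby points of `B`.) -/
def collapsed (p : X.P.Total) : Set (Fin n) :=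
  {i | p ∈ closure {p' : X.P.Total | (Pi.single i 1 : Lattice n) ∈ inFrame X.P X.L p'}}

/-- The subtorus of `Qⁿ` generated, in the frame `p`, by the fibres of `𝓛` near the base point
of `p`. -/
def isotropy (p : X.P.Total) : Subgroup (QTorus n) where
  carrier := {q | ∀ i ∉ X.collapsed p, q i = 1}
  mul_mem' {a b} ha hb i hi := by rw [Pi.mul_apply, ha i hi, hb i hi, mul_one]
  one_mem' i _ := rfl
  inv_mem' {a} ha i hi := by rw [Pi.inv_apply, ha i hi, inv_one]

lemma collapsed_act (p : X.P.Total) (g : QAut n) (i : Fin n) :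
    i ∈ X.collapsed (X.P.act p g) ↔ permFun g i ∈ X.collapsed p := by
  have h : {p' : X.P.Total | (Pi.single (permFun g i) 1 : Lattice n) ∈ inFrame X.P X.L p'} =
      X.P.actHomeo g ⁻¹' {p' : X.P.Total | (Pi.single i 1 : Lattice n) ∈ inFrame X.P X.L p'} := by
    ext p'
    change _ ↔ (Pi.single i 1 : Lattice n) ∈ inFrame X.P X.L (X.P.act p' g)
    rw [inFrame_act, latticeEv_single]; rfl
  change X.P.actHomeo g p ∈ closure _ ↔ p ∈ closure _
  rw [h, ← (X.P.actHomeo g).preimage_closure]; rfl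

/-- The fibre over `b` of the bundle of isotropy subtori of `Q_P`. -/
def isotropyFiber (b : B) : Subgroup (X.P.torusFiber b) where
  carrier := {f | ∀ p : X.P.Fib b, f.1 p ∈ X.isotropy p.1}
  mul_mem' ha hb p := (X.isotropy p.1).mul_mem (ha p) (hb p)
  one_mem' p := (X.isotropy p.1).one_mem
  inv_mem' ha p := (X.isotropy p.1).inv_mem (ha p)

instance isotropyFiber_normal (b : B) : (X.isotropyFiber b).Normal where
  conj_mem f hf g p i hi := by
    change g.1 p i * f.1 p i * (g.1 p i)⁻¹ = 1
    rw [hf p i hi, mul_one, mul_inv_cancel]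

/-- The fibre over `b` of the canonical model `M_(P,𝓛)`: the quotient of the fibre of `Q_P` by the
isotropy subtorus over `b`. -/
def ModelFiber (b : B) : Type u := X.P.torusFiber b ⧸ X.isotropyFiber b

noncomputable instance (b : B) : Group (X.ModelFiber b) :=
  inferInstanceAs (Group (X.P.torusFiber b ⧸ X.isotropyFiber b))

/-- The quotient homomorphism from the fibre of `Q_P` to the fibre of `M_(P,𝓛)`. -/
noncomputable def toModel (b : B) : X.P.torusFiber b →* X.ModelFiber b :=
  QuotientGroup.mk' (X.isotropyFiber b)

/-- The canonical model `M_(P,𝓛)`. -/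
structure Model where
  /-- The point of the base. -/
  base : B
  /-- The point of the fibre. -/
  val : X.ModelFiber base

/-- The quotient map `P × Qⁿ → M_(P,𝓛)`, the composition of `P × Qⁿ → Q_P` and
`Q_P → M_(P,𝓛)`. -/
noncomputable def modelMk (x : X.P.Total × QTorus n) : X.Model :=
  ⟨X.P.proj x.1, X.toModel _ (X.P.torusMk x.1 x.2)⟩

lemma toModel_eq {b : B} {f f' : X.P.torusFiber b} (p : X.P.Fib b)
    (h : ∀ i ∉ X.collapsed p.1, f.1 p i = f'.1 p i) : X.toModel b f = X.toModel b f' := by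
  refine QuotientGroup.eq.2 fun p' => ?_
  obtain ⟨g, hg, -⟩ := X.P.existsUnique_act (p.2.trans p'.2.symm)
  have h1 : p' = X.P.fibAct p g := Subtype.ext hg.symm
  subst h1
  intro i hi
  have h2 : permFun g i ∉ X.collapsed p.1 := fun hc => hi ((X.collapsed_act _ _ _).2 hc)
  have h3 := (f⁻¹ * f').2 p g
  have h4 : (f⁻¹ * f').1 p (permFun g i) = 1 := by
    change (f.1 p (permFun g i))⁻¹ * f'.1 p (permFun g i) = 1
    rw [h _ h2, inv_mul_cancel]
  rw [h3]
  have h5 := ev_apply_eq_one g⁻¹ h4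
  rwa [← permFun_mul, inv_mul_cancel, permFun_one] at h5

lemma modelMk_eq {p : X.P.Total} {q q' : QTorus n} (h : ∀ i ∉ X.collapsed p, q i = q' i) :
    X.modelMk (p, q) = X.modelMk (p, q') := by
  have := X.toModel_eq (f := X.P.torusMk p q) (f' := X.P.torusMk p q') ⟨p, rfl⟩ fun i hi => by
    rw [X.P.torusMk_self, X.P.torusMk_self, h i hi]
  exact congrArg (Model.mk (X.P.proj p)) this

/-- The canonical model carries the quotient topology. -/
noncomputable instance : TopologicalSpace X.Model := TopologicalSpace.coinduced X.modelMk inferInstance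

/-- `s` restricts to a continuous section of the canonical model over `U`, that is, to an element
of `𝒮(U)`. Values outside of `U` are irrelevant. -/
def IsSection (U : Set B) (s : (b : B) → X.ModelFiber b) : Prop :=
  ContinuousOn (fun b => (⟨b, s b⟩ : X.Model)) U

/-! ### The first Čech cohomology with values in the sheaf of sections of the canonical model -/

/-- A Čech 1-cocycle with values in the sheaf of groups `𝒮` of sections of the canonical model. -/
structure Cocycle where
  ι : Type u
  U : ι → Set B
  isOpen : ∀ α, IsOpen (U α)
  cover : ∀ b, ∃ α, b ∈ U α
  θ : ι → ι → (b : B) → X.ModelFiber b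
  isSection : ∀ α β, X.IsSection (U α ∩ U β) (θ α β)
  cocycle : ∀ α β γ, ∀ b ∈ U α ∩ U β ∩ U γ, θ α β b * θ β γ b = θ α γ b

/-- Two cocycles are cohomologous if they differ by a 0-cochain on a common refinement of their
covers. -/
def Cohomologous (c c' : X.Cocycle) : Prop :=
  ∃ (κ : Type u) (W : κ → Set B) (r : κ → c.ι) (r' : κ → c'.ι) (g : κ → (b : B) → X.ModelFiber b),
    (∀ k, IsOpen (W k)) ∧ (∀ b, ∃ k, b ∈ W k) ∧
    (∀ k, W k ⊆ c.U (r k)) ∧ (∀ k, W k ⊆ c'.U (r' k)) ∧ (∀ k, X.IsSection (W k) (g k)) ∧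
    ∀ k l, ∀ b ∈ W k ∩ W l, c'.θ (r' k) (r' l) b = (g k b)⁻¹ * c.θ (r k) (r l) b * g l b

/-- The Čech cohomology set `H¹(B, 𝒮)`. -/
def H1 : Type (u + 1) := Quot X.Cohomologous

end CharPair

/-! ### Isomorphisms of characteristic pairs -/

/-- An isomorphism of characteristic pairs: an isomorphism of principal bundles that covers a
stratification-preserving homeomorphism of the bases and whose induced isomorphism
`[p, v] ↦ [f_P p, v]` of lattice bundles maps `𝓛₁` onto `𝓛₂`. -/
structure CharPair.Iso {n : ℕ} {B₁ B₂ : Type u} [TopologicalSpace B₁] [TopologicalSpace B₂]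
    {C₁ : Corners n B₁} {C₂ : Corners n B₂} (X₁ : CharPair n C₁) (X₂ : CharPair n C₂) where
  fB : B₁ ≃ₜ B₂
  fP : X₁.P.Total ≃ₜ X₂.P.Total
  proj_fP : ∀ p, X₂.P.proj (fP p) = fB (X₁.P.proj p)
  fP_act : ∀ p g, fP (X₁.P.act p g) = X₂.P.act (fP p) g
  strata : ∀ k b, b ∈ C₁.stratum k ↔ fB b ∈ C₂.stratum k
  lattice : ∀ p, inFrame X₁.P X₁.L p = inFrame X₂.P X₂.L (fP p)

namespace CharPair.Iso

variable {n : ℕ} {B₁ B₂ : Type u} [TopologicalSpace B₁] [TopologicalSpace B₂]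
  {C₁ : Corners n B₁} {C₂ : Corners n B₂} {X₁ : CharPair n C₁} {X₂ : CharPair n C₂}
  (F : CharPair.Iso X₁ X₂)

/-- The map induced by `f_P` on the fibres over `b`. -/
def fib {b : B₁} (p : X₁.P.Fib b) : X₂.P.Fib (F.fB b) :=
  ⟨F.fP p.1, (F.proj_fP p.1).trans (congrArg F.fB p.2)⟩

lemma collapsed_fP (p : X₁.P.Total) : X₂.collapsed (F.fP p) = X₁.collapsed p := by
  ext i
  have : {p' : X₁.P.Total | (Pi.single i 1 : Lattice n) ∈ inFrame X₁.P X₁.L p'} =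
      F.fP ⁻¹' {p' : X₂.P.Total | (Pi.single i 1 : Lattice n) ∈ inFrame X₂.P X₂.L p'} := by
    ext p'
    simp only [Set.mem_ofPred_eq, Set.mem_preimage, F.lattice p']
  simp only [CharPair.collapsed, Set.mem_ofPred_eq]
  rw [this, ← F.fP.preimage_closure, Set.mem_preimage]

/-- The isomorphism of torus bundles induced by `f_P`, from right to left: in terms of equivariant
maps it is the composition with `f_P`, so that `[f_P p, q]` is sent to `[p, q]`. -/
noncomputable def torusPull (b : B₁) : X₂.P.torusFiber (F.fB b) →* X₁.P.torusFiber b where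
  toFun f := ⟨fun p => f.1 (F.fib p), fun p g => by
    have : F.fib (X₁.P.fibAct p g) = X₂.P.fibAct (F.fib p) g := Subtype.ext (F.fP_act p.1 g)
    exact (congrArg f.1 this).trans (f.2 _ _)⟩
  map_one' := rfl
  map_mul' _ _ := rfl

/-- The map of canonical models induced by `f_P`, from right to left, on the fibres over `b`. -/
noncomputable def modelPull (b : B₁) : X₂.ModelFiber (F.fB b) →* X₁.ModelFiber b :=
  QuotientGroup.map _ _ (F.torusPull b) fun f hf p i hi =>
    hf (F.fib p) i (by rwa [fib, F.collapsed_fP])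

/-- The map of canonical models induced by `f_P`, from right to left. -/
noncomputable def modelPullTotal (x : X₂.Model) : X₁.Model :=
  ⟨F.fB.symm x.base, F.modelPull (F.fB.symm x.base)
    (cast (congrArg X₂.ModelFiber (F.fB.apply_symm_apply x.base).symm) x.val)⟩

lemma modelPullTotal_mk (b : B₁) (x : X₂.ModelFiber (F.fB b)) :
    F.modelPullTotal ⟨F.fB b, x⟩ = ⟨b, F.modelPull b x⟩ := by
  have key : ∀ (b' : B₁) (h : b' = b) (h2 : X₂.ModelFiber (F.fB b) = X₂.ModelFiber (F.fB b')),
      (⟨b', F.modelPull b' (cast h2 x)⟩ : X₁.Model) = ⟨b, F.modelPull b x⟩ := by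
    rintro _ rfl h2; rfl
  exact key _ (F.fB.symm_apply_apply b) _

lemma modelPullTotal_modelMk (x : X₂.P.Total × QTorus n) :
    F.modelPullTotal (X₂.modelMk x) = X₁.modelMk (F.fP.symm x.1, x.2) := by
  obtain ⟨p₂, q⟩ := x
  obtain ⟨p, rfl⟩ := F.fP.surjective p₂
  have key : ∀ (b : B₂) (hb : X₂.P.proj (F.fP p) = b), ∃ f : X₂.P.torusFiber b,
      f.1 ⟨F.fP p, hb⟩ = q ∧ X₂.modelMk (F.fP p, q) = ⟨b, X₂.toModel b f⟩ := by
    rintro _ rfl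
    exact ⟨_, X₂.P.torusMk_self _ q, rfl⟩
  obtain ⟨f, hf, h⟩ := key _ (F.proj_fP p)
  have h1 : F.torusPull _ f = X₁.P.torusMk p q :=
    X₁.P.torusFiber_ext ⟨p, rfl⟩ (hf.trans (X₁.P.torusMk_self p q).symm)
  rw [h, modelPullTotal_mk, F.fP.symm_apply_apply]
  change (⟨_, X₁.toModel _ (F.torusPull _ f)⟩ : X₁.Model) = _
  rw [h1]; rfl

lemma continuous_modelPullTotal : Continuous F.modelPullTotal := by
  refine continuous_coinduced_dom.2 ?_
  have : F.modelPullTotal ∘ X₂.modelMk = X₁.modelMk ∘ fun x => (F.fP.symm x.1, x.2) :=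
    funext F.modelPullTotal_modelMk
  rw [this]
  exact continuous_coinduced_rng.comp (by fun_prop)

lemma isSection_modelPull {U : Set B₂} {s : (b : B₂) → X₂.ModelFiber b} (hs : X₂.IsSection U s) :
    X₁.IsSection (F.fB ⁻¹' U) (fun b => F.modelPull b (s (F.fB b))) := by
  have h : ContinuousOn (fun b => F.modelPullTotal ⟨F.fB b, s (F.fB b)⟩) (F.fB ⁻¹' U) :=
    F.continuous_modelPullTotal.comp_continuousOn
      (ContinuousOn.comp (t := U) hs F.fB.continuous.continuousOn fun _ h => h)
  exact h.congr fun b _ => (F.modelPullTotal_mk b _).symm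

/-- The pullback of a cocycle. -/
noncomputable def pullCocycle (c : X₂.Cocycle) : X₁.Cocycle where
  ι := c.ι
  U α := F.fB ⁻¹' c.U α
  isOpen α := (c.isOpen α).preimage F.fB.continuous
  cover b := c.cover (F.fB b)
  θ α β b := F.modelPull b (c.θ α β (F.fB b))
  isSection α β := F.isSection_modelPull (c.isSection α β)
  cocycle α β γ b hb := by rw [← map_mul, c.cocycle α β γ _ hb]

/-- The pullback `f_P^* : H¹(B₂, 𝒮₂) → H¹(B₁, 𝒮₁)`. -/
noncomputable def pull : X₂.H1 → X₁.H1 :=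
  Quot.map F.pullCocycle fun c c' => by
    rintro ⟨κ, W, r, r', g, hW, hcov, hr, hr', hg, h⟩
    refine ⟨κ, fun k => F.fB ⁻¹' W k, r, r', fun k b => F.modelPull b (g k (F.fB b)),
      fun k => (hW k).preimage F.fB.continuous, fun b => hcov (F.fB b),
      fun k _ hb => hr k hb, fun k _ hb => hr' k hb, fun k => F.isSection_modelPull (hg k),
      fun k l b hb => ?_⟩
    change F.modelPull b _ = (F.modelPull b _)⁻¹ * F.modelPull b _ * F.modelPull b _
    rw [h k l _ hb, map_mul, map_mul, map_inv]

end CharPair.Iso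

/-! ### Local `Qⁿ`-actions -/

/-- A local `Qⁿ`-action on `M`, given by a weakly regular atlas: charts onto open subsets of `ℍⁿ`
that are invariant under the regular representation, whose overlap maps are defined on invariant
sets and are `ρ`-equivariant for automorphisms `ρ` of `Qⁿ`. Two atlases define the same local
action if the identity of `M` is an equivariant homeomorphism, see `IsEquivariant`. -/
structure LocalAction (n : ℕ) (M : Type u) [TopologicalSpace M] where
  atlas : Set (OpenPartialHomeomorph M (HSpace n))
  cover : ∀ x, ∃ φ ∈ atlas, x ∈ φ.source
  invariant_target : ∀ φ ∈ atlas, RegInvariant φ.target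
  invariant_overlap : ∀ φ ∈ atlas, ∀ ψ ∈ atlas, RegInvariant (φ '' (φ.source ∩ ψ.source))
  equivariant : ∀ φ ∈ atlas, ∀ ψ ∈ atlas, ∃ ρ : QAut n, ∀ q : QTorus n,
    ∀ h ∈ φ '' (φ.source ∩ ψ.source), ψ (φ.symm (reg q h)) = reg (ev ρ q) (ψ (φ.symm h))

/-- A homeomorphism between spaces with local `Qⁿ`-actions is equivariant if, in all pairs of
charts, it is defined on invariant sets and is, near every point, `ρ`-equivariant for some
automorphism `ρ` of `Qⁿ`. -/
def IsEquivariant {n : ℕ} {M₁ M₂ : Type u} [TopologicalSpace M₁] [TopologicalSpace M₂]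
    (A₁ : LocalAction n M₁) (A₂ : LocalAction n M₂) (f : M₁ ≃ₜ M₂) : Prop :=
  ∀ φ ∈ A₁.atlas, ∀ ψ ∈ A₂.atlas,
    RegInvariant (φ '' (φ.source ∩ f ⁻¹' ψ.source)) ∧
    RegInvariant (ψ '' (f '' φ.source ∩ ψ.source)) ∧
    ∀ x ∈ φ.source ∩ f ⁻¹' ψ.source, ∃ ρ : QAut n, ∃ V : Set M₁, IsOpen V ∧ x ∈ V ∧
      ∀ q : QTorus n, ∀ h ∈ φ '' (V ∩ φ.source ∩ f ⁻¹' ψ.source),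
        ψ (f (φ.symm (reg q h))) = reg (ev ρ q) (ψ (f (φ.symm h)))

section Model

variable {n : ℕ}

lemma reg_one (h : HSpace n) : reg 1 h = h := by
  ext1 i; exact one_mul _

lemma reg_mul (q r : QTorus n) (h : HSpace n) : reg (q * r) h = reg q (reg r h) := by
  ext1 i; exact mul_assoc _ _ _

lemma continuous_reg : Continuous fun x : QTorus n × HSpace n => reg x.1 x.2 := by
  unfold reg; fun_prop

/-- The section `r ↦ r` of the orbit map `h ↦ (|h₁|, …, |hₙ|)` of `ℍⁿ`. -/
noncomputable def emb (r : Orthant n) : HSpace n := fun i => ((r i : ℝ) : ℍ[ℝ])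

/-- The orbit map `h ↦ (|h₁|, …, |hₙ|)` of `ℍⁿ`. -/
noncomputable def rad (h : HSpace n) : Orthant n := fun i => ‖h i‖₊

lemma continuous_emb : Continuous (emb : Orthant n → HSpace n) := by
  refine continuous_pi fun i => ?_
  exact Quaternion.continuous_coe.comp (NNReal.continuous_coe.comp (continuous_apply i))

lemma continuous_rad : Continuous (rad : HSpace n → Orthant n) := by
  unfold rad; fun_prop

lemma rad_emb (r : Orthant n) : rad (emb r) = r := by
  ext i; simp [rad, emb]

lemma rad_reg (q : QTorus n) (h : HSpace n) : rad (reg q h) = rad h := by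
  ext i
  have : ‖(q i : ℍ[ℝ])‖ = 1 := mem_sphere_zero_iff_norm.1 (q i).2
  simp [rad, reg, this]

lemma rad_eq_zero (h : HSpace n) (i : Fin n) : rad h i = 0 ↔ h i = 0 := by simp [rad]

open Classical in
/-- The phase `h / |h|` of a quaternion, with the convention that the phase of `0` is `1`. -/
noncomputable def phase (h : HSpace n) : QTorus n := fun i =>
  if hi : h i = 0 then 1 else ⟨(‖h i‖⁻¹ : ℝ) • h i, by
    rw [mem_sphere_zero_iff_norm, norm_smul, norm_inv, norm_norm]
    exact inv_mul_cancel₀ (norm_ne_zero_iff.2 hi)⟩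

lemma reg_phase (h : HSpace n) : reg (phase h) (emb (rad h)) = h := by
  ext1 i
  by_cases hi : h i = 0
  · simp [reg, emb, rad, hi]
  · have h0 : ‖h i‖ ≠ 0 := norm_ne_zero_iff.2 hi
    simp only [reg, phase, emb, rad, hi, dite_false, coe_nnnorm]
    rw [← Quaternion.coe_commutes, Quaternion.coe_mul_eq_smul]
    exact smul_inv_smul₀ h0 (h i)

lemma emb_rad (h : HSpace n) : emb (rad h) = reg (phase h)⁻¹ h := by
  conv_rhs => rw [← reg_phase h]
  rw [← reg_mul]
  have : phase (reg (phase h) (emb (rad h))) = phase h := by rw [reg_phase]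
  rw [this, inv_mul_cancel, reg_one]

lemma emb_ne_zero {r : Orthant n} {i : Fin n} (hi : r i ≠ 0) : emb r i ≠ 0 := by
  intro hc
  have h := (rad_eq_zero (emb r) i).2 hc
  rw [rad_emb] at h
  exact hi h

lemma reg_cancel {q q' : QTorus n} {h : HSpace n} {i : Fin n} (hi : h i ≠ 0)
    (heq : reg q h i = reg q' h i) : q i = q' i :=
  Subtype.ext (mul_right_cancel₀ hi heq)

end Model

namespace LocalAction

variable {n : ℕ} {M : Type u} [TopologicalSpace M] (A : LocalAction n M)

/-- The charts of the atlas. -/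
abbrev Chart : Type u := A.atlas

/-- The automorphism `ρ` for which the overlap map `ψ ∘ φ⁻¹` is `ρ`-equivariant. -/
noncomputable def rho (φ ψ : A.Chart) : QAut n := (A.equivariant φ φ.2 ψ ψ.2).choose

/-- The point with coordinate `q · φ(x)` in the chart `φ`. -/
noncomputable def move (φ : A.Chart) (q : QTorus n) (x : M) : M := φ.1.symm (reg q (φ.1 x))

variable {A}

lemma move_mem {φ : A.Chart} {x : M} (hx : x ∈ φ.1.source) (q : QTorus n) :
    A.move φ q x ∈ φ.1.source :=
  φ.1.map_target (A.invariant_target φ φ.2 q _ (φ.1.map_source hx))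

lemma chart_move {φ : A.Chart} {x : M} (hx : x ∈ φ.1.source) (q : QTorus n) :
    φ.1 (A.move φ q x) = reg q (φ.1 x) :=
  φ.1.right_inv (A.invariant_target φ φ.2 q _ (φ.1.map_source hx))

lemma move_mem' {φ ψ : A.Chart} {x : M} (hx : x ∈ φ.1.source) (hx' : x ∈ ψ.1.source)
    (q : QTorus n) : A.move φ q x ∈ ψ.1.source := by
  obtain ⟨y, ⟨hy, hy'⟩, h⟩ := A.invariant_overlap φ φ.2 ψ ψ.2 q _ ⟨x, ⟨hx, hx'⟩, rfl⟩
  have : A.move φ q x = y := by rw [move, ← h, φ.1.left_inv hy]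
  rwa [this]

lemma chart_move' {φ ψ : A.Chart} {x : M} (hx : x ∈ φ.1.source) (hx' : x ∈ ψ.1.source)
    (q : QTorus n) : ψ.1 (A.move φ q x) = reg (ev (A.rho φ ψ) q) (ψ.1 x) := by
  have := (A.equivariant φ φ.2 ψ ψ.2).choose_spec q _ ⟨x, ⟨hx, hx'⟩, rfl⟩
  rwa [φ.1.left_inv hx] at this

lemma move_eq {φ : A.Chart} {x y : M} (_hx : x ∈ φ.1.source) (hy : y ∈ φ.1.source) {q : QTorus n}
    (h : φ.1 y = reg q (φ.1 x)) : A.move φ q x = y := by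
  rw [move, ← h, φ.1.left_inv hy]

variable (A)

/-! ### The orbit space -/

/-- The relation of lying on the same orbit. -/
def orbitSetoid : Setoid M where
  r x y := ∃ φ : A.Chart, x ∈ φ.1.source ∧ y ∈ φ.1.source ∧ ∃ q, φ.1 y = reg q (φ.1 x)
  iseqv :=
    { refl := fun x => by
        obtain ⟨φ, hφ, hx⟩ := A.cover x
        exact ⟨⟨φ, hφ⟩, hx, hx, 1, (reg_one _).symm⟩
      symm := by
        rintro x y ⟨φ, hx, hy, q, h⟩
        exact ⟨φ, hy, hx, q⁻¹, by rw [h, ← reg_mul, inv_mul_cancel, reg_one]⟩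
      trans := by
        rintro x y z ⟨φ, hx, hy, q, h⟩ ⟨ψ, hy', hz, r, h'⟩
        have h1 : A.move φ q⁻¹ y = x := move_eq hy hx (by
          rw [h, ← reg_mul, inv_mul_cancel, reg_one])
        have hx' : x ∈ ψ.1.source := h1 ▸ move_mem' hy hy' _
        have h2 : ψ.1 x = reg (ev (A.rho φ ψ) q⁻¹) (ψ.1 y) := h1 ▸ chart_move' hy hy' _
        refine ⟨ψ, hx', hz, r * (ev (A.rho φ ψ) q⁻¹)⁻¹, ?_⟩
        rw [h2, ← reg_mul, inv_mul_cancel_right, h'] }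

/-- The orbit space `B_M`. -/
def OrbitSpace : Type u := Quotient A.orbitSetoid

/-- The orbit space carries the quotient topology. -/
instance : TopologicalSpace A.OrbitSpace := inferInstanceAs (TopologicalSpace (Quotient _))

/-- The orbit map `π_M`. -/
def π (x : M) : A.OrbitSpace := Quotient.mk A.orbitSetoid x

variable {A}

lemma π_surjective : Function.Surjective A.π := Quotient.exists_rep

lemma continuous_π : Continuous A.π := continuous_quotient_mk'

lemma isQuotientMap_π : IsQuotientMap A.π := isQuotientMap_quotient_mk'

lemma π_eq_iff {x y : M} : A.π x = A.π y ↔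
    ∃ φ : A.Chart, x ∈ φ.1.source ∧ y ∈ φ.1.source ∧ ∃ q, φ.1 y = reg q (φ.1 x) :=
  Quotient.eq (r := A.orbitSetoid)

lemma π_move {φ : A.Chart} {x : M} (hx : x ∈ φ.1.source) (q : QTorus n) :
    A.π (A.move φ q x) = A.π x :=
  (π_eq_iff.2 ⟨φ, hx, move_mem hx q, q, chart_move hx q⟩).symm

lemma mem_source_of_π_eq {φ : A.Chart} {x y : M} (h : A.π x = A.π y) (hx : x ∈ φ.1.source) :
    y ∈ φ.1.source := by
  obtain ⟨ψ, hx', hy', q, hq⟩ := π_eq_iff.1 h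
  rw [← move_eq hx' hy' hq]
  exact move_mem' hx' hx q

lemma exists_of_π_eq {φ : A.Chart} {x y : M} (h : A.π x = A.π y) (hx : x ∈ φ.1.source) :
    ∃ q, φ.1 y = reg q (φ.1 x) := by
  obtain ⟨ψ, hx', hy', q, hq⟩ := π_eq_iff.1 h
  exact ⟨_, by rw [← move_eq hx' hy' hq]; exact chart_move' hx' hx q⟩

lemma rad_of_π_eq {φ : A.Chart} {x y : M} (h : A.π x = A.π y) (hx : x ∈ φ.1.source) :
    rad (φ.1 y) = rad (φ.1 x) := by
  obtain ⟨q, hq⟩ := exists_of_π_eq h hx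
  rw [hq, rad_reg]

lemma isOpenMap_π : IsOpenMap A.π := by
  intro W hW
  rw [← isQuotientMap_π.isOpen_preimage]
  have : A.π ⁻¹' (A.π '' W) =
      ⋃ (φ : A.Chart), ⋃ (q : QTorus n), φ.1.source ∩ A.move φ q ⁻¹' W := by
    ext x
    simp only [Set.mem_preimage, Set.mem_image, Set.mem_iUnion, Set.mem_inter_iff]
    constructor
    · rintro ⟨y, hy, hxy⟩
      obtain ⟨φ, hx, hy', q, hq⟩ := π_eq_iff.1 hxy.symm
      exact ⟨φ, q, hx, by rwa [move_eq hx hy' hq]⟩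
    · rintro ⟨φ, q, hx, hq⟩
      exact ⟨_, hq, π_move hx q⟩
  rw [this]
  refine isOpen_iUnion fun φ => isOpen_iUnion fun q => ?_
  refine ContinuousOn.isOpen_inter_preimage ?_ φ.1.open_source hW
  refine φ.1.continuousOn_symm.comp ?_ fun x hx =>
    A.invariant_target φ φ.2 q _ (φ.1.map_source hx)
  exact (continuous_reg.comp (Continuous.prodMk_right q)).comp_continuousOn φ.1.continuousOn

variable (A)

/-- The chart `φ^B` of the orbit space that is induced by a chart `φ`. -/
noncomputable def baseChart (φ : A.Chart) : OpenPartialHomeomorph A.OrbitSpace (Orthant n) where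
  toFun b := rad (φ.1 (Quotient.out b))
  invFun r := A.π (φ.1.symm (emb r))
  source := A.π '' φ.1.source
  target := emb ⁻¹' φ.1.target
  map_source' := by
    rintro _ ⟨x, hx, rfl⟩
    have h : A.π x = A.π (Quotient.out (A.π x)) := (Quotient.out_eq (A.π x)).symm
    change emb (rad (φ.1 _)) ∈ φ.1.target
    rw [rad_of_π_eq h hx, emb_rad]
    exact A.invariant_target φ φ.2 _ _ (φ.1.map_source hx)
  map_target' r hr := ⟨_, φ.1.map_target hr, rfl⟩
  left_inv' := by
    rintro _ ⟨x, hx, rfl⟩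
    have h : A.π x = A.π (Quotient.out (A.π x)) := (Quotient.out_eq (A.π x)).symm
    rw [rad_of_π_eq h hx, emb_rad]
    exact π_move hx _
  right_inv' r hr := by
    have h : A.π (φ.1.symm (emb r)) = A.π (Quotient.out (A.π (φ.1.symm (emb r)))) :=
      (Quotient.out_eq (A.π _)).symm
    rw [rad_of_π_eq h (φ.1.map_target hr), φ.1.right_inv hr, rad_emb]
  open_source := isOpenMap_π _ φ.1.open_source
  open_target := φ.1.open_target.preimage continuous_emb
  continuousOn_toFun := by
    rw [isQuotientMap_π.continuousOn_isOpen_iff (isOpenMap_π _ φ.1.open_source)]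
    have h1 : ContinuousOn (fun x => rad (φ.1 x)) (A.π ⁻¹' (A.π '' φ.1.source)) :=
      continuous_rad.comp_continuousOn (φ.1.continuousOn.mono fun x ⟨y, hy, hxy⟩ =>
        mem_source_of_π_eq hxy hy)
    refine h1.congr fun x ⟨y, hy, hxy⟩ => ?_
    exact rad_of_π_eq (Quotient.out_eq (A.π x)).symm (mem_source_of_π_eq hxy hy)
  continuousOn_invFun := continuous_π.comp_continuousOn
    (φ.1.continuousOn_symm.comp continuous_emb.continuousOn fun _ h => h)

variable {A}

lemma π_mem_source {φ : A.Chart} {x : M} : A.π x ∈ (A.baseChart φ).source ↔ x ∈ φ.1.source :=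
  ⟨fun ⟨_, hy, hxy⟩ => mem_source_of_π_eq hxy hy, fun h => ⟨x, h, rfl⟩⟩

lemma baseChart_π {φ : A.Chart} {x : M} (hx : x ∈ φ.1.source) :
    A.baseChart φ (A.π x) = rad (φ.1 x) :=
  rad_of_π_eq (Quotient.out_eq (A.π x)).symm hx

lemma zero_of_zero {φ ψ : A.Chart} {b : A.OrbitSpace} (hb : b ∈ (A.baseChart φ).source)
    (hb' : b ∈ (A.baseChart ψ).source) {i : Fin n} (hi : A.baseChart φ b i = 0) :
    A.baseChart ψ b (permFun (A.rho φ ψ) i) = 0 := by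
  obtain ⟨x, rfl⟩ := π_surjective b
  rw [π_mem_source] at hb hb'
  rw [baseChart_π hb, rad_eq_zero] at hi
  rw [baseChart_π hb', rad_eq_zero]
  obtain ⟨q, hq⟩ := (mapsFactor_iff (A.rho φ ψ) i _).2 rfl
  have h1 : A.move φ (Pi.mulSingle i q) x = x := move_eq hb hb (by
    ext1 j
    by_cases h : j = i
    · subst h; simp [reg, hi]
    · simp [reg, Pi.mulSingle_eq_of_ne h])
  have h2 := chart_move' hb hb' (Pi.mulSingle i q)
  rw [h1] at h2
  by_contra hne
  refine hq (reg_cancel (q' := 1) hne ?_)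
  rw [reg_one, ← h2]

lemma depth_le {φ ψ : A.Chart} {b : A.OrbitSpace} (hb : b ∈ (A.baseChart φ).source)
    (hb' : b ∈ (A.baseChart ψ).source) : depth (A.baseChart φ b) ≤ depth (A.baseChart ψ b) :=
  Set.ncard_le_ncard_of_injOn (permFun (A.rho φ ψ)) (fun _ hi => zero_of_zero hb hb' hi)
    ((perm n (A.rho φ ψ)).injective.injOn) (Set.toFinite _)

variable (A)

/-- The orbit space is a manifold with corners. -/
noncomputable def corners : Corners n A.OrbitSpace where
  atlas := Set.range A.baseChart
  cover b := by
    obtain ⟨x, rfl⟩ := π_surjective b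
    obtain ⟨φ, hφ, hx⟩ := A.cover x
    exact ⟨_, ⟨⟨φ, hφ⟩, rfl⟩, π_mem_source.2 hx⟩
  strata := by
    rintro _ ⟨φ, rfl⟩ _ ⟨ψ, rfl⟩ b ⟨hb, hb'⟩
    exact le_antisymm (depth_le hb hb') (depth_le hb' hb)

/-! ### The characteristic pair of a local action -/

variable {A}

lemma rho_unique {ψ : A.Chart} {W : Set M} (hW : IsOpen W) (hWψ : W ⊆ ψ.1.source)
    (hne : W.Nonempty) {ρ ρ' : QAut n}
    (h : ∀ x ∈ W, ∀ q, reg (ev ρ q) (ψ.1 x) = reg (ev ρ' q) (ψ.1 x)) : ρ = ρ' := by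
  have hd : Dense {h : HSpace n | ∀ i, h i ≠ 0} := by
    have : {h : HSpace n | ∀ i, h i ≠ 0} = Set.pi Set.univ fun _ => {(0 : ℍ[ℝ])}ᶜ := by
      ext; simp
    rw [this]
    exact dense_pi _ fun i _ => dense_compl_singleton 0
  have ho : IsOpen (ψ.1 '' W) := ψ.1.isOpen_image_of_subset_source hW hWψ
  obtain ⟨_, ⟨x, hx, rfl⟩, h0⟩ := hd.inter_open_nonempty _ ho (hne.image _)
  refine Subtype.ext (MulEquiv.ext fun q => funext fun i => ?_)
  exact reg_cancel (h0 i) (congrFun (h x hx q) i)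

lemma rho_comp {φ ψ χ : A.Chart} {x : M} (h1 : x ∈ φ.1.source) (h2 : x ∈ ψ.1.source)
    (h3 : x ∈ χ.1.source) : A.rho ψ χ * A.rho φ ψ = A.rho φ χ := by
  refine rho_unique (W := φ.1.source ∩ ψ.1.source ∩ χ.1.source)
    ((φ.1.open_source.inter ψ.1.open_source).inter χ.1.open_source) (fun _ h => h.2)
    ⟨x, ⟨h1, h2⟩, h3⟩ fun y ⟨⟨hφ, hψ⟩, hχ⟩ q => ?_
  have e : A.move φ q y = A.move ψ (ev (A.rho φ ψ) q) y :=
    (move_eq hψ (move_mem' hφ hψ q) (chart_move' hφ hψ q)).symm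
  rw [← chart_move' hφ hχ, e, chart_move' hψ hχ, ev_mul]

lemma rho_self {φ : A.Chart} {x : M} (h : x ∈ φ.1.source) : A.rho φ φ = 1 := by
  have := rho_comp h h h
  exact mul_eq_left.1 this

lemma rho_comp_base {φ ψ χ : A.Chart} {b : A.OrbitSpace} (h1 : b ∈ (A.baseChart φ).source)
    (h2 : b ∈ (A.baseChart ψ).source) (h3 : b ∈ (A.baseChart χ).source) :
    A.rho ψ χ * A.rho φ ψ = A.rho φ χ := by
  obtain ⟨x, rfl⟩ := π_surjective b
  exact rho_comp (π_mem_source.1 h1) (π_mem_source.1 h2) (π_mem_source.1 h3)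

lemma rho_self_base {φ : A.Chart} {b : A.OrbitSpace} (h : b ∈ (A.baseChart φ).source) :
    A.rho φ φ = 1 := by
  obtain ⟨x, rfl⟩ := π_surjective b
  exact rho_self (π_mem_source.1 h)

lemma exists_chart (b : A.OrbitSpace) : ∃ φ : A.Chart, b ∈ (A.baseChart φ).source := by
  obtain ⟨_, ⟨φ, rfl⟩, h⟩ := A.corners.cover b
  exact ⟨φ, h⟩

variable (A)

/-- The gluing data of `P_M`: the bundle obtained from the products `U^B × Aut(Qⁿ)`, for the
charts of the atlas, by means of the transition functions `h ↦ ρ ∘ h`. -/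
noncomputable def bundleCore : FiberBundleCore A.Chart A.OrbitSpace (QAut n) where
  baseSet φ := (A.baseChart φ).source
  isOpen_baseSet φ := (A.baseChart φ).open_source
  indexAt b := (exists_chart b).choose
  mem_baseSet_at b := (exists_chart b).choose_spec
  coordChange φ ψ _ h := A.rho φ ψ * h
  coordChange_self φ b hb h := by rw [rho_self_base hb, one_mul]
  continuousOn_coordChange φ ψ :=
    ((continuous_of_discreteTopology (f := fun h : QAut n => A.rho φ ψ * h)).comp
      continuous_snd).continuousOn
  coordChange_comp φ ψ χ b hb h := by
    rw [← mul_assoc, rho_comp_base hb.1.1 hb.1.2 hb.2]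

/-- The component in `Aut(Qⁿ)` of a point of the total space. -/
def component (p : A.bundleCore.TotalSpace) : QAut n := p.2

/-- The principal `Aut(Qⁿ)`-bundle `P_M`. -/
noncomputable def principalBundle : PrincipalBundle n A.OrbitSpace where
  Total := A.bundleCore.TotalSpace
  topology := inferInstance
  proj := A.bundleCore.proj
  act p g := ⟨p.1, A.component p * g⟩
  act_one p := congrArg (Bundle.TotalSpace.mk p.1) (mul_one (A.component p))
  act_mul p g h := congrArg (Bundle.TotalSpace.mk p.1) (mul_assoc (A.component p) g h).symm
  proj_act _ _ := rfl
  locallyTrivial b := ⟨A.bundleCore.localTriv (A.bundleCore.indexAt b),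
    A.bundleCore.mem_baseSet_at b, fun p g _ =>
      (mul_assoc (A.rho _ _) (A.component p) g).symm⟩

/-- The frame of `P_M` at `b` given by a chart, that is, the point `(b, 1)` of the copy of
`U^B × Aut(Qⁿ)` that belongs to the chart. -/
noncomputable def frame (φ : A.Chart) (b : A.OrbitSpace) : A.principalBundle.Total :=
  ⟨b, A.rho φ (A.bundleCore.indexAt b)⟩

variable {A}

lemma act_frame {φ ψ : A.Chart} {b : A.OrbitSpace} (h : b ∈ (A.baseChart φ).source)
    (h' : b ∈ (A.baseChart ψ).source) :
    A.principalBundle.act (A.frame φ b) (A.rho ψ φ) = A.frame ψ b :=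
  congrArg (Bundle.TotalSpace.mk b) (rho_comp_base h' h (A.bundleCore.mem_baseSet_at b))

lemma continuousOn_frame (φ : A.Chart) :
    ContinuousOn (A.frame φ) (A.baseChart φ).source := by
  have h := (A.bundleCore.localTriv φ).continuousOn_invFun
  have h2 : ContinuousOn (fun b : A.OrbitSpace => (b, (1 : QAut n))) (A.baseChart φ).source :=
    (Continuous.prodMk_left (1 : QAut n)).continuousOn
  refine (h.comp h2 fun b hb => ?_).congr fun b hb => ?_
  · exact (A.bundleCore.mem_localTriv_target φ _).2 hb
  · exact congrArg (Bundle.TotalSpace.mk b) (mul_one (A.rho φ (A.bundleCore.indexAt b))).symm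

variable (A)

/-- The fibre over `b` of the bundle `𝓛_M`: in the frame given by a chart, it is spanned by the
integral element that generates the 3-sphere that fixes the points of `M` over `b`, i.e. the factor
of `Qⁿ` that corresponds to the vanishing coordinate of `b` in the chart. -/
def stabLattice (b : A.OrbitSpace) : AddSubgroup (A.principalBundle.latticeFiber b) where
  carrier := {ξ | ∀ φ : A.Chart, b ∈ (A.baseChart φ).source → ∀ i, A.baseChart φ b i = 0 →
    ξ.1 ⟨A.frame φ b, rfl⟩ ∈ AddSubgroup.zmultiples (Pi.single i 1 : Lattice n)}
  add_mem' h h' φ hb i hi := add_mem (h φ hb i hi) (h' φ hb i hi)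
  zero_mem' _ _ _ _ := zero_mem _
  neg_mem' h φ hb i hi := neg_mem (h φ hb i hi)

variable {A}

lemma depth_eq {k : ℕ} {b : A.OrbitSpace} (hb : b ∈ A.corners.stratum k) {φ : A.Chart}
    (h : b ∈ (A.baseChart φ).source) : depth (A.baseChart φ b) = k := by
  obtain ⟨c, hc, hbc, hd⟩ := hb
  rw [← hd]
  exact A.corners.strata _ ⟨φ, rfl⟩ c hc b ⟨h, hbc⟩

lemma mem_stratum {b : A.OrbitSpace} {φ : A.Chart} (h : b ∈ (A.baseChart φ).source) :
    b ∈ A.corners.stratum (depth (A.baseChart φ b)) :=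
  ⟨_, ⟨φ, rfl⟩, h, rfl⟩

lemma inFrame_frame {b : A.OrbitSpace} (hb : b ∈ A.corners.stratum 1) {φ : A.Chart}
    (h : b ∈ (A.baseChart φ).source) {i : Fin n} (hi : A.baseChart φ b i = 0) :
    inFrame A.principalBundle (S := A.corners.stratum 1) (fun b => A.stabLattice b)
      (A.frame φ b) = (AddSubgroup.zmultiples (Pi.single i 1 : Lattice n) : Set (Lattice n)) := by
  ext v
  constructor
  · rintro ⟨_, ξ, hξ, rfl⟩
    exact hξ φ h i hi
  · intro hv
    refine ⟨hb, A.principalBundle.latticeMk (A.frame φ b) v, ?_,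
      A.principalBundle.latticeMk_self _ _⟩
    intro ψ h' j hj
    obtain ⟨k, rfl⟩ := AddSubgroup.mem_zmultiples_iff.1 hv
    have h1 : (⟨A.frame ψ b, rfl⟩ : A.principalBundle.Fib b) =
        A.principalBundle.fibAct ⟨A.frame φ b, rfl⟩ (A.rho ψ φ) :=
      Subtype.ext (act_frame h h').symm
    have h2 := (A.principalBundle.latticeMk (A.frame φ b)
      (k • (Pi.single i 1 : Lattice n))).2 ⟨A.frame φ b, rfl⟩ (A.rho ψ φ)
    have h3 : (A.rho ψ φ)⁻¹ = A.rho φ ψ :=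
      inv_eq_of_mul_eq_one_right ((rho_comp_base h h' h).trans (rho_self_base h))
    have h4 : permFun (A.rho φ ψ) i = j := by
      have h5 := zero_of_zero h h' hi
      obtain ⟨l, hl⟩ := Set.ncard_eq_one.1 (depth_eq hb h')
      have h6 : j ∈ ({l} : Set (Fin n)) := hl ▸ hj
      have h7 : permFun (A.rho φ ψ) i ∈ ({l} : Set (Fin n)) := hl ▸ h5
      rw [Set.mem_singleton_iff] at h6 h7
      rw [h6, h7]
    have h5 : k • (Pi.single i 1 : Lattice n) = Pi.single i k := by
      rw [← Pi.single_smul, smul_eq_mul, mul_one]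
    have h6 : (A.principalBundle.latticeMk (A.frame φ b)
        (k • (Pi.single i 1 : Lattice n))).1 ⟨A.frame ψ b, rfl⟩ = Pi.single j k := by
      refine (congrArg _ h1).trans (h2.trans ?_)
      rw [A.principalBundle.latticeMk_self, h3, h5, latticeEv_single]
      exact congrArg (fun l => (Pi.single l k : Lattice n)) h4
    refine AddSubgroup.mem_zmultiples_iff.2 ⟨k, ?_⟩
    refine Eq.trans ?_ h6.symm
    rw [← Pi.single_smul, smul_eq_mul, mul_one]

/-- Every neighbourhood of a point of a face of the orbit space contains points that lie on no
other face. -/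
lemma exists_near {b : A.OrbitSpace} {φ : A.Chart} (h : b ∈ (A.baseChart φ).source) {i : Fin n}
    (hi : A.baseChart φ b i = 0) {V : Set A.OrbitSpace} (hV : IsOpen V) (hb : b ∈ V) :
    ∃ b' ∈ V, b' ∈ (A.baseChart φ).source ∧ ∀ j, A.baseChart φ b' j = 0 ↔ j = i := by
  let γ : NNReal → Orthant n := fun t j => if j = i then 0 else A.baseChart φ b j + t
  have hγ : Continuous γ := by
    refine continuous_pi fun j => ?_
    by_cases hj : j = i
    · simp only [γ, hj, if_true]; exact continuous_const
    · simp only [γ, hj, if_false]; fun_prop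
  have h0 : γ 0 = A.baseChart φ b := by
    ext1 j
    by_cases hj : j = i
    · subst hj; simp [γ, hi]
    · simp [γ, hj]
  have hO : IsOpen (((A.baseChart φ).symm).source ∩ (A.baseChart φ).symm ⁻¹' V) :=
    (A.baseChart φ).symm.isOpen_inter_preimage hV
  have hmem : γ 0 ∈ ((A.baseChart φ).symm).source ∩ (A.baseChart φ).symm ⁻¹' V := by
    rw [h0]
    exact ⟨(A.baseChart φ).map_source h, by
      rw [Set.mem_preimage, (A.baseChart φ).left_inv h]; exact hb⟩
  have hnhds : γ ⁻¹' (((A.baseChart φ).symm).source ∩ (A.baseChart φ).symm ⁻¹' V) ∈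
      𝓝 (0 : NNReal) := (hO.preimage hγ).mem_nhds hmem
  obtain ⟨t, ⟨ht, ht'⟩, h1⟩ :=
    Filter.nonempty_of_mem (Filter.inter_mem (nhdsWithin_le_nhds hnhds)
      (self_mem_nhdsWithin (a := (0 : NNReal)) (s := Set.Ioi 0)))
  refine ⟨(A.baseChart φ).symm (γ t), ht', (A.baseChart φ).map_target ht, fun j => ?_⟩
  rw [(A.baseChart φ).right_inv ht]
  by_cases hj : j = i
  · simp [γ, hj]
  · have : t ≠ 0 := (Set.mem_Ioi.1 h1).ne'
    simp [γ, hj, this]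

/-- Coordinate sublattices are direct summands. -/
lemma span_single (Z : Set (Fin n)) :
    (∃ D : Submodule ℤ (Lattice n),
      IsCompl (Submodule.span ℤ ((fun i => (Pi.single i 1 : Lattice n)) '' Z)) D) ∧
    Module.finrank ℤ (Submodule.span ℤ ((fun i => (Pi.single i 1 : Lattice n)) '' Z)) =
      Z.ncard := by
  have hli : LinearIndependent ℤ (fun i : Fin n => (Pi.single i 1 : Lattice n)) := by
    have := (Pi.basisFun ℤ (Fin n)).linearIndependent
    convert this using 2
    · rw [Pi.basisFun_apply]
    · exact Subsingleton.elim _ _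
  have hsp : Submodule.span ℤ (Set.range fun i : Fin n => (Pi.single i 1 : Lattice n)) = ⊤ := by
    rw [← (Pi.basisFun ℤ (Fin n)).span_eq]
    congr 2
    ext1 i
    rw [Pi.basisFun_apply]
  refine ⟨⟨Submodule.span ℤ ((fun i => (Pi.single i 1 : Lattice n)) '' Zᶜ), ?_, ?_⟩, ?_⟩
  · exact hli.disjoint_span_image disjoint_compl_right
  · rw [codisjoint_iff, ← Submodule.span_union, ← Set.image_union, Set.union_compl_self,
      Set.image_univ, hsp]
  · have h1 : LinearIndepOn ℤ id ((fun i : Fin n => (Pi.single i 1 : Lattice n)) '' Z) :=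
      (hli.linearIndepOn (s := Z)).id_image
    have : Fintype ((fun i : Fin n => (Pi.single i 1 : Lattice n)) '' Z) := Fintype.ofFinite _
    have h2 := finrank_span_set_eq_card (R := ℤ)
      (s := (fun i : Fin n => (Pi.single i 1 : Lattice n)) '' Z) h1
    rw [h2, ← Set.ncard_eq_toFinset_card', Set.ncard_image_of_injective _ hli.injective]

lemma isOpen_adapted (φ : A.Chart) (Z : Set (Fin n)) :
    IsOpen {b | b ∈ (A.baseChart φ).source ∧ ∀ j ∉ Z, A.baseChart φ b j ≠ 0} := by
  have h1 : IsOpen {r : Orthant n | ∀ j ∉ Z, r j ≠ 0} := by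
    have : {r : Orthant n | ∀ j ∉ Z, r j ≠ 0} = ⋂ j ∈ Zᶜ, {r : Orthant n | r j ≠ 0} := by
      ext; simp
    rw [this]
    refine (Set.toFinite _).isOpen_biInter fun j _ => ?_
    exact isOpen_ne_fun (continuous_apply j) continuous_const
  exact (A.baseChart φ).isOpen_inter_preimage h1

lemma inFrame_adapted {φ : A.Chart} {b : A.OrbitSpace} (h : b ∈ (A.baseChart φ).source)
    (hb : b ∈ A.corners.stratum 1) {Z : Set (Fin n)} (hZ : ∀ j ∉ Z, A.baseChart φ b j ≠ 0) :
    ∃ i ∈ Z, A.baseChart φ b i = 0 := by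
  obtain ⟨i, hi⟩ := Set.ncard_eq_one.1 (depth_eq hb h)
  have h0 : A.baseChart φ b i = 0 := by
    have : i ∈ {i | A.baseChart φ b i = 0} := hi ▸ Set.mem_singleton i
    exact this
  exact ⟨i, by_contra fun hc => hZ i hc h0, h0⟩

lemma mem_stratum_one {φ : A.Chart} {b : A.OrbitSpace} (h : b ∈ (A.baseChart φ).source)
    {i : Fin n} (hi : ∀ j, A.baseChart φ b j = 0 ↔ j = i) : b ∈ A.corners.stratum 1 := by
  refine ⟨_, ⟨φ, rfl⟩, h, ?_⟩
  have : {j | A.baseChart φ b j = 0} = {i} := by ext j; exact hi j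
  rw [depth, this, Set.ncard_singleton]

variable (A)

/-- The characteristic pair `(P_M, 𝓛_M)` of a local `Qⁿ`-action. -/
noncomputable def charPair : CharPair n A.corners where
  P := A.principalBundle
  L b := A.stabLattice b
  locallyTrivial b hb := by
    obtain ⟨φ, h⟩ := exists_chart b
    obtain ⟨i, hi⟩ := Set.ncard_eq_one.1 (depth_eq hb h)
    have hne : ∀ j ∉ ({i} : Set (Fin n)), A.baseChart φ b j ≠ 0 := fun j hj hc => by
      have : j ∈ {j | A.baseChart φ b j = 0} := hc
      rw [hi] at this
      exact hj this
    refine ⟨_, isOpen_adapted φ {i}, ⟨h, hne⟩, A.frame φ,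
      (continuousOn_frame φ).mono fun _ h => h.1, fun _ _ => rfl, i, fun b' ⟨⟨h', hne'⟩, hb'⟩ => ?_⟩
    obtain ⟨j, rfl, hj⟩ := inFrame_adapted h' hb' hne'
    exact inFrame_frame hb' h' hj
  unimodular k b hb := by
    obtain ⟨φ, h⟩ := exists_chart b
    have hk := depth_eq hb h
    set Z : Set (Fin n) := {j | A.baseChart φ b j = 0} with hZ
    refine ⟨_, isOpen_adapted φ Z, ⟨h, fun j hj => hj⟩, A.frame φ,
      (continuousOn_frame φ).mono fun _ h => h.1, fun _ _ => rfl, fun V hVU hV hbV => ?_⟩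
    have key : Submodule.span ℤ (⋃ b' ∈ V, inFrame A.principalBundle (S := A.corners.stratum 1)
        (fun b => A.stabLattice b) (A.frame φ b')) =
        Submodule.span ℤ ((fun i => (Pi.single i 1 : Lattice n)) '' Z) := by
      refine le_antisymm (Submodule.span_le.2 ?_) (Submodule.span_le.2 ?_)
      · refine Set.iUnion₂_subset fun b' hb' v hv => ?_
        have hs : b' ∈ A.corners.stratum 1 := hv.choose
        obtain ⟨i, hiZ, hi⟩ := inFrame_adapted (hVU hb').1 hs (hVU hb').2
        rw [inFrame_frame hs (hVU hb').1 hi] at hv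
        obtain ⟨c, rfl⟩ := AddSubgroup.mem_zmultiples_iff.1 hv
        exact Submodule.smul_mem _ c (Submodule.subset_span ⟨i, hiZ, rfl⟩)
      · rintro _ ⟨i, hi, rfl⟩
        obtain ⟨b', hb', h', hz⟩ := exists_near h hi hV hbV
        refine Submodule.subset_span (Set.mem_iUnion₂.2 ⟨b', hb', ?_⟩)
        rw [inFrame_frame (mem_stratum_one h' hz) h' ((hz i).2 rfl)]
        exact AddSubgroup.mem_zmultiples _
    rw [key, ← hk]
    exact span_single Z

variable {A}

lemma mem_collapsed {φ : A.Chart} {b : A.OrbitSpace} (h : b ∈ (A.baseChart φ).source) {i : Fin n}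
    (hi : A.baseChart φ b i = 0) : i ∈ A.charPair.collapsed (A.frame φ b) := by
  refine mem_closure_iff.2 fun O hO hbO => ?_
  obtain ⟨V, hV, hbV, hVO⟩ := mem_nhds_iff.1
    (((continuousOn_frame φ).continuousAt ((A.baseChart φ).open_source.mem_nhds h)).preimage_mem_nhds
      (hO.mem_nhds hbO))
  obtain ⟨b', hb', h', hz⟩ := exists_near h hi hbV hVO
  refine ⟨A.frame φ b', hV hb', ?_⟩
  have := inFrame_frame (mem_stratum_one h' hz) h' ((hz i).2 rfl)
  change _ ∈ inFrame A.principalBundle (S := A.corners.stratum 1) (fun b => A.stabLattice b)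
      (A.frame φ b')
  rw [this]
  exact AddSubgroup.mem_zmultiples _

/-! ### The Euler class of a local action -/

variable (A)

/-- The local identification `h_φ` of `M` with the canonical model over the domain of a chart: the
point with coordinate `q · r`, `q ∈ Qⁿ`, `r ∈ ℝⁿ_{≥ 0}`, corresponds to the class of `q` in the
frame given by the chart. -/
noncomputable def toCanonical (φ : A.Chart) (x : M) : A.charPair.Model :=
  A.charPair.modelMk (A.frame φ (A.π x), phase (φ.1 x))

/-- The point over `b` that corresponds under `h_φ` to the unit element, that is, the point whose
coordinates in the chart `φ` are non-negative real numbers. -/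
noncomputable def unitPoint (φ : A.Chart) (b : A.OrbitSpace) : M :=
  φ.1.symm (emb (A.baseChart φ b))

/-- The section `θ_{φψ}` of the canonical model with `h_ψ (h_φ⁻¹(x)) = x · θ_{φψ}`. Its value is
`h_ψ (h_φ⁻¹(1))`. -/
noncomputable def theta (φ ψ : A.Chart) (b : A.OrbitSpace) : A.charPair.ModelFiber b :=
  A.charPair.toModel b (A.principalBundle.torusMk (A.frame ψ b) (phase (ψ.1 (A.unitPoint φ b))))

variable {A}

lemma unitPoint_mem {φ : A.Chart} {b : A.OrbitSpace} (h : b ∈ (A.baseChart φ).source) :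
    A.unitPoint φ b ∈ φ.1.source :=
  φ.1.map_target ((A.baseChart φ).map_source h)

lemma chart_unitPoint {φ : A.Chart} {b : A.OrbitSpace} (h : b ∈ (A.baseChart φ).source) :
    φ.1 (A.unitPoint φ b) = emb (A.baseChart φ b) :=
  φ.1.right_inv ((A.baseChart φ).map_source h)

lemma π_unitPoint {φ : A.Chart} {b : A.OrbitSpace} (h : b ∈ (A.baseChart φ).source) :
    A.π (A.unitPoint φ b) = b :=
  (A.baseChart φ).left_inv h

lemma continuousOn_unitPoint (φ : A.Chart) :
    ContinuousOn (A.unitPoint φ) (A.baseChart φ).source :=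
  φ.1.continuousOn_symm.comp (continuous_emb.comp_continuousOn (A.baseChart φ).continuousOn)
    fun _ h => (A.baseChart φ).map_source h

lemma isQuotientMap_polar :
    IsQuotientMap (fun x : Orthant n × QTorus n => reg x.2 (emb x.1)) := by
  have hc : Continuous (fun x : Orthant n × QTorus n => reg x.2 (emb x.1)) :=
    continuous_reg.comp (continuous_snd.prodMk (continuous_emb.comp continuous_fst))
  have h1 : IsClosedEmbedding
      (fun x : Orthant n × QTorus n => (reg x.2 (emb x.1), x.2)) := by
    refine Function.LeftInverse.isClosedEmbedding
      (g := fun x : Orthant n × QTorus n => (reg x.2 (emb x.1), x.2))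
      (f := fun y : HSpace n × QTorus n => (rad y.1, y.2)) ?_ ?_ ?_
    · rintro ⟨r, q⟩
      simp only [rad_reg, rad_emb]
    · exact (continuous_rad.comp continuous_fst).prodMk continuous_snd
    · exact hc.prodMk continuous_snd
  have h2 : IsClosedMap (fun x : Orthant n × QTorus n => reg x.2 (emb x.1)) :=
    isClosedMap_fst_of_compactSpace.comp h1.isClosedMap
  exact h2.isQuotientMap hc fun h => ⟨(rad h, phase h), reg_phase h⟩

lemma continuousOn_toCanonical (φ : A.Chart) :
    ContinuousOn (A.toCanonical φ) φ.1.source := by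
  have h1 : ContinuousOn (fun h : HSpace n =>
      A.charPair.modelMk (A.frame φ (A.π (φ.1.symm h)), phase h)) φ.1.target := by
    rw [isQuotientMap_polar.continuousOn_isOpen_iff φ.1.open_target]
    have h2 : ContinuousOn (fun x : Orthant n × QTorus n =>
        (A.frame φ ((A.baseChart φ).symm x.1), x.2))
        ((fun x : Orthant n × QTorus n => reg x.2 (emb x.1)) ⁻¹' φ.1.target) := by
      refine ContinuousOn.prodMk ?_ continuous_snd.continuousOn
      have ht : ∀ x ∈ ((fun x : Orthant n × QTorus n => reg x.2 (emb x.1)) ⁻¹' φ.1.target),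
          x.1 ∈ (A.baseChart φ).target := fun x hx => by
        have := A.invariant_target φ φ.2 x.2⁻¹ _ hx
        simp only [← reg_mul, inv_mul_cancel, reg_one] at this
        exact this
      exact (continuousOn_frame φ).comp ((A.baseChart φ).continuousOn_symm.comp
        continuous_fst.continuousOn ht) fun x hx => (A.baseChart φ).map_target (ht x hx)
    refine (continuous_coinduced_rng.comp_continuousOn h2).congr fun x hx => ?_
    obtain ⟨r, q⟩ := x
    have hr : emb r ∈ φ.1.target := by
      have := A.invariant_target φ φ.2 q⁻¹ _ hx
      simp only [← reg_mul, inv_mul_cancel, reg_one] at this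
      exact this
    have hy := φ.1.map_target hr
    have hπ : A.π (φ.1.symm (reg q (emb r))) = (A.baseChart φ).symm r := by
      have := π_move hy q
      rwa [move, φ.1.right_inv hr] at this
    change A.charPair.modelMk (A.frame φ (A.π (φ.1.symm (reg q (emb r)))), phase (reg q (emb r))) =
      A.charPair.modelMk (A.frame φ ((A.baseChart φ).symm r), q)
    rw [hπ]
    refine A.charPair.modelMk_eq fun i hi => ?_
    have hri : r i ≠ 0 := fun hc => hi (mem_collapsed ((A.baseChart φ).map_target hr) (by
      rw [(A.baseChart φ).right_inv hr, hc]))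
    have h3 := reg_phase (reg q (emb r))
    rw [rad_reg, rad_emb] at h3
    exact reg_cancel (emb_ne_zero hri) (congrFun h3 i)
  refine (h1.comp φ.1.continuousOn fun x hx => φ.1.map_source hx).congr fun x hx => ?_
  simp only [toCanonical, Function.comp_apply, φ.1.left_inv hx]

lemma theta_eq {φ ψ : A.Chart} {b : A.OrbitSpace} (h : b ∈ (A.baseChart φ).source) :
    (⟨b, A.theta φ ψ b⟩ : A.charPair.Model) = A.toCanonical ψ (A.unitPoint φ b) := by
  rw [toCanonical, π_unitPoint h]; rfl

lemma mem_of_mem_base {φ ψ : A.Chart} {b : A.OrbitSpace} (h : b ∈ (A.baseChart φ).source)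
    (h' : b ∈ (A.baseChart ψ).source) : A.unitPoint φ b ∈ ψ.1.source := by
  rw [← π_mem_source, π_unitPoint h]; exact h'

lemma isSection_theta (φ ψ : A.Chart) :
    A.charPair.IsSection ((A.baseChart φ).source ∩ (A.baseChart ψ).source) (A.theta φ ψ) := by
  have h1 : ContinuousOn (fun b => A.toCanonical ψ (A.unitPoint φ b))
      ((A.baseChart φ).source ∩ (A.baseChart ψ).source) :=
    (continuousOn_toCanonical ψ).comp ((continuousOn_unitPoint φ).mono fun _ h => h.1)
      fun b hb => mem_of_mem_base hb.1 hb.2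
  exact h1.congr fun b hb => theta_eq hb.1

lemma chart_unitPoint' {φ ψ : A.Chart} {b : A.OrbitSpace} (h : b ∈ (A.baseChart φ).source)
    (h' : b ∈ (A.baseChart ψ).source) : ψ.1 (A.unitPoint φ b) =
      reg (phase (ψ.1 (A.unitPoint φ b))) (emb (A.baseChart ψ b)) := by
  conv_lhs => rw [← reg_phase (ψ.1 (A.unitPoint φ b))]
  rw [← baseChart_π (mem_of_mem_base h h'), π_unitPoint h]

lemma torusMk_frame {φ ψ : A.Chart} {b : A.OrbitSpace} (h : b ∈ (A.baseChart φ).source)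
    (h' : b ∈ (A.baseChart ψ).source) (q : QTorus n) :
    A.principalBundle.torusMk (A.frame φ b) q =
      A.principalBundle.torusMk (A.frame ψ b) (ev (A.rho φ ψ) q) := by
  refine A.principalBundle.torusFiber_ext (b := b) ⟨A.frame ψ b, rfl⟩ ?_
  have h1 : (⟨A.frame ψ b, rfl⟩ : A.principalBundle.Fib b) =
      A.principalBundle.fibAct ⟨A.frame φ b, rfl⟩ (A.rho ψ φ) := Subtype.ext (act_frame h h').symm
  have h3 : (A.rho ψ φ)⁻¹ = A.rho φ ψ :=
    inv_eq_of_mul_eq_one_right ((rho_comp_base h h' h).trans (rho_self_base h))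
  refine Eq.trans ?_ (A.principalBundle.torusMk_self (A.frame ψ b) _).symm
  refine (congrArg _ h1).trans (((A.principalBundle.torusMk (A.frame φ b) q).2 _ _).trans ?_)
  rw [h3]
  exact congrArg _ (A.principalBundle.torusMk_self (A.frame φ b) q)

lemma theta_cocycle {φ ψ χ : A.Chart} {b : A.OrbitSpace} (h1 : b ∈ (A.baseChart φ).source)
    (h2 : b ∈ (A.baseChart ψ).source) (h3 : b ∈ (A.baseChart χ).source) :
    A.theta φ ψ b * A.theta ψ χ b = A.theta φ χ b := by
  unfold theta
  rw [torusMk_frame h2 h3]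
  refine Eq.trans (map_mul (A.charPair.toModel b) _ _).symm ?_
  refine A.charPair.toModel_eq (b := b) ⟨A.frame χ b, rfl⟩ fun i hi => ?_
  have hne : emb (A.baseChart χ b) i ≠ 0 := emb_ne_zero fun hc => hi (mem_collapsed h3 hc)
  have e1 : A.move ψ (phase (ψ.1 (A.unitPoint φ b))) (A.unitPoint ψ b) = A.unitPoint φ b :=
    move_eq (unitPoint_mem h2) (mem_of_mem_base h1 h2) (by
      rw [chart_unitPoint h2]; exact chart_unitPoint' h1 h2)
  have e2 := chart_move' (unitPoint_mem h2) (mem_of_mem_base h2 h3)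
    (phase (ψ.1 (A.unitPoint φ b)))
  rw [e1, chart_unitPoint' h2 h3, chart_unitPoint' h1 h3, ← reg_mul] at e2
  have e3 := reg_cancel hne (congrFun e2 i)
  refine Eq.trans ?_ (e3.symm.trans ?_)
  · exact congrArg₂ (fun x y : QTorus n => x i * y i)
      (A.principalBundle.torusMk_self (A.frame χ b) _)
      (A.principalBundle.torusMk_self (A.frame χ b) _)
  · exact (congrFun (A.principalBundle.torusMk_self (A.frame χ b) _) i).symm

variable (A)

/-- The cocycle `(θ_{φψ})` of a local `Qⁿ`-action. -/
noncomputable def eulerCocycle : A.charPair.Cocycle where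
  ι := A.Chart
  U φ := (A.baseChart φ).source
  isOpen φ := (A.baseChart φ).open_source
  cover := exists_chart
  θ := A.theta
  isSection := isSection_theta
  cocycle _ _ _ _ hb := theta_cocycle hb.1.1 hb.1.2 hb.2

/-- The Euler class `e(M) ∈ H¹(B_M, 𝒮)` of a local `Qⁿ`-action. -/
noncomputable def eulerClass : A.charPair.H1 := Quot.mk _ A.eulerCocycle

end LocalAction

end LocalQ

/-! In a chart `φ` a point of `M` has polar coordinates `q · r`: the radius `r` is a coordinate of
its orbit, and `q` matters only up to the factors `i` with `r i = 0`. Sending `q · r` to the class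
of `q` in the frame of `φ` therefore identifies the chart domain with the part of the canonical
model over its image. This identification `h_φ` (`toCanonical`) is a homeomorphism because the polar
map `Orthant × Qⁿ → ℍⁿ` is closed, `Qⁿ` being compact, hence a quotient map. It turns the action
into left multiplication in the fibre groups (`toCanonical_move`), and two such identifications
differ by right multiplication by `θ_{φψ}` (`toCanonical_eq_rmul`). Left and right multiplications
commute (`lact_rmul`). So `M` is the canonical model twisted from the right by a cocycle, and the
theorem is the classification of twisted forms by `H¹`.

Two points need care because the fibre groups jump from stratum to stratum. First, an arbitrary
characteristic pair has to look locally like that of `ℍⁿ`. Unimodularity forces the faces through a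
corner to belong to distinct factors, so after a permutation of coordinates the `i`-th coordinate
vanishes exactly where the `i`-th factor is collapsed (`exists_adaptedChart`); over such a chart the
model is an open subset of `ℍⁿ`. Second, multiplication by sections must be continuous although the
phase `h / |h|` is not: the phase is only ever multiplied by a vector of the same radii, which
vanishes where the phase jumps (`tendsto_reg_phase`). This makes the cohomology relation an
equivalence relation (`h1_eq_iff`).

Part (1). For an equivariant homeomorphism `f`, the local automorphisms `ρ` tell where the frames of
the charts go, and this is an isomorphism of characteristic pairs (`exists_iso`). The maps `h_ψ ∘ f`
are then equivariant identifications of `M₁` with the model of `M₂`, with transition cocycle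
`e(M₂)`; comparing them with the `h_φ` at unit points gives the 0-cochain (`pull_eq_eulerClass`).
Conversely, a 0-cochain `g` defines `f` locally by `h'(f x) = h(x) · g`, the coboundary relation
makes the definitions agree, and compactness makes the continuous bijection a homeomorphism
(`exists_isEquivariant`).

Part (2). Copies of the model are glued by right multiplication by the cocycle. A local action needs
a single `ρ` for each pair of charts, even over a disconnected overlap; a Lebesgue number argument
provides such charts (`nonempty_gluingData`). The Euler class is again read off by
`pull_eq_eulerClass`. -/

namespace LocalQ

open Set Topology Quaternion Filter

/-! ### Local sections of a principal bundle with discrete group -/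

namespace PrincipalBundle

variable {n : ℕ} {B : Type u} [TopologicalSpace B] (P : PrincipalBundle n B)

/-- `s` restricts to a continuous section of `P` over `U`. -/
def SectionOn (s : B → P.Total) (U : Set B) : Prop :=
  ContinuousOn s U ∧ ∀ b ∈ U, P.proj (s b) = b

variable {P}

lemma SectionOn.mono {s : B → P.Total} {U V : Set B} (h : P.SectionOn s U) (hV : V ⊆ U) :
    P.SectionOn s V :=
  ⟨h.1.mono hV, fun b hb => h.2 b (hV hb)⟩

lemma act_left_cancel {p : P.Total} {g g' : QAut n} (h : P.act p g = P.act p g') : g = g' :=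
  (P.existsUnique_act (P.proj_act p g').symm).unique h rfl

variable (P) in
lemma continuous_proj : Continuous P.proj := by
  refine continuous_iff_continuousAt.2 fun p => ?_
  obtain ⟨e, he, -⟩ := P.locallyTrivial (P.proj p)
  exact e.continuousAt_proj (e.mem_source.2 he)

/-- Frames near a given frame are the parallel ones. -/
lemma SectionOn.eventually_eq_act {s : B → P.Total} {U : Set B} (hs : P.SectionOn s U)
    {p : P.Total} (hU : U ∈ 𝓝 (P.proj p)) {g : QAut n} (hp : P.act (s (P.proj p)) g = p) :
    ∀ᶠ p' in 𝓝 p, P.act (s (P.proj p')) g = p' := by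
  obtain ⟨e, he, hact⟩ := P.locallyTrivial (P.proj p)
  have hsb : P.proj (s (P.proj p)) = P.proj p := hs.2 _ (mem_of_mem_nhds hU)
  -- `Aut(Qⁿ)` is discrete, so the group coordinate of a trivialization is locally constant.
  have key : ∀ p₀ : P.Total, P.proj p₀ = P.proj p → ∀ᶠ p' in 𝓝 p₀, (e p').2 = (e p₀).2 := by
    intro p₀ h0
    have h1 : ContinuousAt (fun p' => (e p').2) p₀ :=
      continuous_snd.continuousAt.comp (e.continuousAt (e.mem_source.2 (h0 ▸ he)))
    rw [ContinuousAt, nhds_discrete (QAut n), tendsto_pure] at h1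
    exact h1
  have hsc : ContinuousAt (fun p' => s (P.proj p')) p :=
    (hs.1.continuousAt hU).comp P.continuous_proj.continuousAt
  filter_upwards [key p rfl, hsc.eventually (key _ hsb),
    P.continuous_proj.continuousAt.eventually (e.open_baseSet.mem_nhds he),
    P.continuous_proj.continuousAt.eventually hU] with p' h1 h2 h3 h4
  have h5 := hs.2 _ h4
  apply e.injOn
  · rw [e.mem_source, P.proj_act, h5]; exact h3
  · rw [e.mem_source]; exact h3
  · refine Prod.ext ?_ ?_
    · exact (e.coe_fst' (by rw [P.proj_act, h5]; exact h3)).trans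
        ((P.proj_act _ _).trans (h5.trans (e.coe_fst' h3).symm))
    · refine (hact _ _ (by rw [h5]; exact h3)).trans ?_
      rw [h2, ← hact _ _ (by rw [hsb]; exact he), hp]
      exact h1.symm

/-- Both sections are parallel, so the element relating them at `b` relates them nearby. All later
local constancy of automorphisms and of `𝓛` in frames rests on this. -/
lemma SectionOn.eventually_eq {s s' : B → P.Total} {U U' : Set B} (hs : P.SectionOn s U)
    (hs' : P.SectionOn s' U') {b : B} (hU : U ∈ 𝓝 b) (hU' : U' ∈ 𝓝 b) {g : QAut n}
    (h : P.act (s b) g = s' b) : ∀ᶠ b' in 𝓝 b, P.act (s b') g = s' b' := by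
  have hb := hs'.2 b (mem_of_mem_nhds hU')
  have h1 := (hs'.1.continuousAt hU').eventually
    (hs.eventually_eq_act (p := s' b) (by rwa [hb]) (by rwa [hb]))
  filter_upwards [h1, hU'] with b' h2 h3
  rwa [hs'.2 b' h3] at h2

lemma SectionOn.exists_act {s s' : B → P.Total} {U U' : Set B} (hs : P.SectionOn s U)
    (hs' : P.SectionOn s' U') {b : B} (h : b ∈ U) (h' : b ∈ U') :
    ∃ g, P.act (s b) g = s' b :=
  (P.existsUnique_act ((hs.2 b h).trans (hs'.2 b h').symm)).exists

variable (P) in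
lemma exists_sectionOn (b : B) :
    ∃ (U : Set B) (s : B → P.Total), IsOpen U ∧ b ∈ U ∧ P.SectionOn s U := by
  obtain ⟨e, he, -⟩ := P.locallyTrivial b
  refine ⟨e.baseSet, fun b => e.toOpenPartialHomeomorph.symm (b, 1), e.open_baseSet, he, ?_, ?_⟩
  · exact e.toOpenPartialHomeomorph.continuousOn_symm.comp
      (Continuous.prodMk_left (1 : QAut n)).continuousOn fun b hb => e.mem_target.2 hb
  · exact fun b hb => e.proj_symm_apply (e.mem_target.2 hb)

/-- Continuity of an equivariant map can be tested on local sections. -/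
lemma continuous_of_sectionOn {B' : Type u} [TopologicalSpace B'] {P' : PrincipalBundle n B'}
    {G : P.Total → P'.Total} (hG : ∀ p g, G (P.act p g) = P'.act (G p) g)
    (h : ∀ b, ∃ (U : Set B) (s : B → P.Total), U ∈ 𝓝 b ∧ P.SectionOn s U ∧
      ContinuousAt (fun b => G (s b)) b) : Continuous G := by
  refine continuous_iff_continuousAt.2 fun p => ?_
  obtain ⟨U, s, hU, hs, hc⟩ := h (P.proj p)
  obtain ⟨g, hg, -⟩ := P.existsUnique_act (hs.2 _ (mem_of_mem_nhds hU))
  have h1 : ContinuousAt (fun p' => P'.act (G (s (P.proj p'))) g) p :=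
    (P'.continuous_act g).continuousAt.comp
      (ContinuousAt.comp (g := fun b => G (s b)) hc P.continuous_proj.continuousAt)
  refine h1.congr ?_
  filter_upwards [hs.eventually_eq_act hU hg] with p' hp'
  rw [← hG, hp']

/-- The element `[p, q]` of the fibre over `b` of the quaternionic torus bundle. -/
noncomputable def fibMk {b : B} (p : P.Fib b) (q : QTorus n) : P.torusFiber b :=
  ⟨fun p' => ev (P.diff (p.2.trans p'.2.symm))⁻¹ q, by
    obtain ⟨p, rfl⟩ := p
    exact (P.torusMk p q).2⟩

lemma fibMk_self {b : B} (p : P.Fib b) (q : QTorus n) : (P.fibMk p q).1 p = q := by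
  obtain ⟨p, rfl⟩ := p
  exact P.torusMk_self p q

lemma fibMk_apply {b : B} (p : P.Fib b) (f : P.torusFiber b) : P.fibMk p (f.1 p) = f :=
  P.torusFiber_ext p (fibMk_self _ _)

lemma fibMk_mul {b : B} (p : P.Fib b) (q q' : QTorus n) :
    P.fibMk p (q * q') = P.fibMk p q * P.fibMk p q' := by
  refine P.torusFiber_ext p ?_
  change _ = (P.fibMk p q).1 p * (P.fibMk p q').1 p
  simp only [fibMk_self]

lemma fibMk_one {b : B} (p : P.Fib b) : P.fibMk p 1 = 1 :=
  P.torusFiber_ext p (fibMk_self _ _)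

lemma fibMk_act {b : B} (p : P.Fib b) (g : QAut n) (q : QTorus n) :
    P.fibMk (P.fibAct p g) q = P.fibMk p (ev g q) := by
  refine P.torusFiber_ext (P.fibAct p g) ?_
  rw [(P.fibMk p (ev g q)).2, fibMk_self, fibMk_self, ← ev_mul, inv_mul_cancel, ev_one]

end PrincipalBundle

open PrincipalBundle

/-! ### Left and right multiplication on the canonical model -/

namespace CharPair

variable {n : ℕ} {B : Type u} [TopologicalSpace B] {C : Corners n B} {X : CharPair n C}

/-- Allows computation in the group over a fixed `b` when `X.P.proj p = b` is only a propositional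
equality. -/
lemma modelMk_eq_fibMk {b : B} (p : X.P.Fib b) (q : QTorus n) :
    X.modelMk (p.1, q) = ⟨b, X.toModel b (X.P.fibMk p q)⟩ := by
  obtain ⟨p, rfl⟩ := p
  rfl

lemma toModel_surjective (b : B) : Function.Surjective (X.toModel b) :=
  QuotientGroup.mk'_surjective _

lemma exists_fibMk {b : B} (p : X.P.Fib b) (m : X.ModelFiber b) :
    ∃ q, X.toModel b (X.P.fibMk p q) = m := by
  obtain ⟨f, rfl⟩ := X.toModel_surjective b m
  exact ⟨f.1 p, by rw [fibMk_apply]⟩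

lemma exists_modelMk {p : X.P.Total} {x : X.Model} (h : X.P.proj p = x.base) :
    ∃ q, X.modelMk (p, q) = x := by
  obtain ⟨b, m⟩ := x
  obtain ⟨q, hq⟩ := exists_fibMk ⟨p, h⟩ m
  exact ⟨q, (modelMk_eq_fibMk ⟨p, h⟩ q).trans (congrArg (Model.mk b) hq)⟩

lemma Model.ext_val {b : B} {m m' : X.ModelFiber b} (h : (⟨b, m⟩ : X.Model) = ⟨b, m'⟩) :
    m = m' := by
  cases h; rfl

/-- Membership in the isotropy subgroup is a condition in all frames; forwards it is read in the
frame `p`, and backwards `toModel_eq` spreads it from `p` to the others by equivariance. -/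
lemma toModel_fibMk_eq_iff {b : B} {p : X.P.Fib b} {q q' : QTorus n} :
    X.toModel b (X.P.fibMk p q) = X.toModel b (X.P.fibMk p q') ↔
      ∀ i ∉ X.collapsed p.1, q i = q' i := by
  refine ⟨fun h i hi => ?_, fun h => X.toModel_eq p fun i hi => ?_⟩
  · have h1 : (X.P.fibMk p q)⁻¹ * X.P.fibMk p q' ∈ X.isotropyFiber b := QuotientGroup.eq.1 h
    have h2 : ((X.P.fibMk p q).1 p i)⁻¹ * (X.P.fibMk p q').1 p i = 1 := h1 p i hi
    rw [fibMk_self, fibMk_self] at h2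
    exact inv_mul_eq_one.1 h2
  · rw [fibMk_self, fibMk_self, h i hi]

lemma modelMk_eq_iff {p : X.P.Total} {q q' : QTorus n} :
    X.modelMk (p, q) = X.modelMk (p, q') ↔ ∀ i ∉ X.collapsed p, q i = q' i :=
  ⟨fun h => toModel_fibMk_eq_iff.1 (Model.ext_val
    (((modelMk_eq_fibMk ⟨p, rfl⟩ q).symm.trans h).trans (modelMk_eq_fibMk ⟨p, rfl⟩ q'))),
    X.modelMk_eq⟩

lemma modelMk_act (p : X.P.Total) (g : QAut n) (q : QTorus n) :
    X.modelMk (X.P.act p g, q) = X.modelMk (p, ev g q) := by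
  rw [modelMk_eq_fibMk ⟨p, rfl⟩, ← fibMk_act]
  exact modelMk_eq_fibMk (X.P.fibAct ⟨p, rfl⟩ g) q

/-- The topology is coinduced by definition, and surjectivity holds because every fibre of `P` is
nonempty. Continuity of maps out of the model is thereby tested on `P × Qⁿ`. -/
lemma isQuotientMap_modelMk : IsQuotientMap X.modelMk :=
  ⟨⟨rfl⟩, fun x => by
    obtain ⟨U, s, -, hb, hs⟩ := X.P.exists_sectionOn x.base
    obtain ⟨q, hq⟩ := exists_modelMk (hs.2 _ hb)
    exact ⟨_, hq⟩⟩

variable (X) in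
lemma continuous_base : Continuous (Model.base : X.Model → B) :=
  isQuotientMap_modelMk.continuous_iff.2 (X.P.continuous_proj.comp continuous_fst)

/-- Multiplication from the right by a section of the canonical model. -/
noncomputable def rmul (x : X.Model) (θ : (b : B) → X.ModelFiber b) : X.Model :=
  ⟨x.base, x.val * θ x.base⟩

open Classical in
/-- Multiplication from the left by the class of `[p, q]`. -/
noncomputable def lact (p : X.P.Total) (q : QTorus n) (x : X.Model) : X.Model :=
  -- Away from the fibre over the base point of `p` the default is the identity, so that
  -- `base_lact`, `lact_act` and `lact_rmul` hold without hypotheses.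
  if h : X.P.proj p = x.base then ⟨x.base, X.toModel _ (X.P.fibMk ⟨p, h⟩ q) * x.val⟩ else x

lemma lact_mk {b : B} (p : X.P.Fib b) (q : QTorus n) (m : X.ModelFiber b) :
    lact p.1 q ⟨b, m⟩ = ⟨b, X.toModel _ (X.P.fibMk p q) * m⟩ :=
  dif_pos p.2

lemma lact_of_ne {p : X.P.Total} {x : X.Model} (h : X.P.proj p ≠ x.base) (q : QTorus n) :
    lact p q x = x :=
  dif_neg h

lemma base_lact (p : X.P.Total) (q : QTorus n) (x : X.Model) : (lact p q x).base = x.base := by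
  unfold lact; split_ifs <;> rfl

lemma lact_modelMk (p : X.P.Total) (q q' : QTorus n) :
    lact p q (X.modelMk (p, q')) = X.modelMk (p, q * q') := by
  rw [modelMk_eq_fibMk ⟨p, rfl⟩, modelMk_eq_fibMk ⟨p, rfl⟩, fibMk_mul, map_mul]
  exact lact_mk ⟨p, rfl⟩ _ _

/-- The relation `[p g, q] = [p, g(q)]` of the associated bundle. It is the source of the
automorphisms in the equivariance of overlap maps. -/
lemma lact_act (p : X.P.Total) (g : QAut n) (q : QTorus n) (x : X.Model) :
    lact (X.P.act p g) q x = lact p (ev g q) x := by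
  by_cases h : X.P.proj p = x.base
  · obtain ⟨b, m⟩ := x
    rw [lact_mk ⟨p, h⟩, ← fibMk_act]
    exact lact_mk (X.P.fibAct ⟨p, h⟩ g) q m
  · have h' : X.P.proj (X.P.act p g) ≠ x.base := by rwa [X.P.proj_act]
    rw [lact_of_ne h, lact_of_ne h']

/-- Associativity in the fibre groups. This is why twisting the model from the right by a cocycle
leaves the action intact. -/
lemma lact_rmul (p : X.P.Total) (q : QTorus n) (x : X.Model) (θ : (b : B) → X.ModelFiber b) :
    lact p q (rmul x θ) = rmul (lact p q x) θ := by
  obtain ⟨b, m⟩ := x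
  by_cases h : X.P.proj p = b
  · rw [lact_mk ⟨p, h⟩]
    refine (lact_mk ⟨p, h⟩ _ _).trans ?_
    rw [rmul, mul_assoc]
  · rw [lact_of_ne (x := rmul _ θ) h, lact_of_ne (x := ⟨b, m⟩) h]

lemma rmul_injective {x y : X.Model} {θ : (b : B) → X.ModelFiber b} (h : rmul x θ = rmul y θ) :
    x = y := by
  obtain ⟨b, m⟩ := x
  obtain ⟨b', m'⟩ := y
  have hb : b = b' := congrArg Model.base h
  subst hb
  exact congrArg (Model.mk b) (mul_right_cancel (Model.ext_val h))

lemma rmul_rmul (x : X.Model) (θ θ' : (b : B) → X.ModelFiber b) :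
    rmul (rmul x θ) θ' = rmul x (fun b => θ b * θ' b) :=
  congrArg (Model.mk x.base) (mul_assoc _ _ _)

lemma rmul_congr {x : X.Model} {θ θ' : (b : B) → X.ModelFiber b} (h : θ x.base = θ' x.base) :
    rmul x θ = rmul x θ' := by
  rw [rmul, rmul, h]

lemma rmul_inv (x : X.Model) (θ : (b : B) → X.ModelFiber b) :
    rmul (rmul x (fun b => (θ b)⁻¹)) θ = x :=
  congrArg (Model.mk x.base) (inv_mul_cancel_right _ _)

end CharPair

end LocalQ

namespace LocalQ

open Set Topology Quaternion Filter

open PrincipalBundle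

/-! ### Polar coordinates on `ℍⁿ` -/

section Polar

variable {n : ℕ}

lemma continuous_ev (g : QAut n) : Continuous (ev g) := g.2.1

lemma tendsto_reg {Y : Type*} {l : Filter Y} {u : Y → QTorus n} {v : Y → HSpace n}
    {q : QTorus n} {h : HSpace n} (hu : Tendsto u l (𝓝 q)) (hv : Tendsto v l (𝓝 h)) :
    Tendsto (fun y => reg (u y) (v y)) l (𝓝 (reg q h)) := by
  rw [tendsto_pi_nhds] at *
  intro i
  have h1 := (continuous_subtype_val.tendsto _).comp (hu i)
  exact h1.mul (hv i)

lemma emb_eq_zero {r : Orthant n} {i : Fin n} (h : r i = 0) : emb r i = 0 := by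
  rw [emb, h]; simp

lemma reg_emb_congr {q q' : QTorus n} {r : Orthant n} (h : ∀ i, r i ≠ 0 → q i = q' i) :
    reg q (emb r) = reg q' (emb r) := by
  ext1 i
  by_cases hi : r i = 0
  · simp only [reg, emb_eq_zero hi, mul_zero]
  · simp only [reg, h i hi]

lemma phase_reg_emb {q : QTorus n} {r : Orthant n} {i : Fin n} (hi : r i ≠ 0) :
    phase (reg q (emb r)) i = q i := by
  have h := reg_phase (reg q (emb r))
  rw [rad_reg, rad_emb] at h
  exact reg_cancel (emb_ne_zero hi) (congrFun h i)

lemma norm_reg (q : QTorus n) (h : HSpace n) (i : Fin n) : ‖reg q h i‖ = ‖h i‖ :=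
  congrArg (fun r : Orthant n => ((r i : NNReal) : ℝ)) (rad_reg q h)

/-- Multiplication of points of `ℍⁿ` with equal radii, `(q · r, h) ↦ q · h`, is continuous. -/
lemma tendsto_reg_phase {Y : Type*} {l : Filter Y} {u v : Y → HSpace n} {h k : HSpace n}
    (hu : Tendsto u l (𝓝 h)) (hv : Tendsto v l (𝓝 k)) (hr : rad h = rad k) :
    Tendsto (fun y => reg (phase (u y)) (v y)) l (𝓝 (reg (phase h) k)) := by
  rw [tendsto_pi_nhds] at hu hv ⊢
  intro i
  -- Where `h i = 0` the phase is discontinuous, but it has norm one, and equality of radii gives `k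
  -- i = 0`, so the product tends to zero. Elsewhere the phase is continuous.
  by_cases hi : h i = 0
  · have hk : k i = 0 := by rwa [← rad_eq_zero, ← hr, rad_eq_zero]
    have h0 : reg (phase h) k i = 0 := by rw [reg, hk, mul_zero]
    rw [h0, tendsto_zero_iff_norm_tendsto_zero]
    simp only [norm_reg]
    rw [← tendsto_zero_iff_norm_tendsto_zero, ← hk]
    exact hv i
  · have h1 : Tendsto (fun y => ((‖u y i‖⁻¹ : ℝ) • u y i) * v y i) l
        (𝓝 (((‖h i‖⁻¹ : ℝ) • h i) * k i)) :=
      (((hu i).norm.inv₀ (norm_ne_zero_iff.2 hi)).smul (hu i)).mul (hv i)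
    have h2 : reg (phase h) k i = ((‖h i‖⁻¹ : ℝ) • h i) * k i := by
      simp only [reg, phase, hi, dite_false]
    rw [h2]
    refine h1.congr' ?_
    filter_upwards [(hu i).eventually_ne hi] with y hy
    simp only [reg, phase, hy, dite_false]

end Polar

/-! ### Adapted charts and coordinates on the canonical model -/

namespace CharPair

variable {n : ℕ} {B : Type u} [TopologicalSpace B] {C : Corners n B}

/-- A chart of the base together with a section of `P` over its domain, such that the faces of
the orthant correspond to the factors of `Qⁿ` generated by the fibres of `𝓛`. -/
structure AdaptedChart (X : CharPair n C) where
  e : OpenPartialHomeomorph B (Orthant n)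
  s : B → X.P.Total
  sectionOn : X.P.SectionOn s e.source
  zero_iff : ∀ b ∈ e.source, ∀ i, e b i = 0 ↔ i ∈ X.collapsed (s b)

namespace AdaptedChart

variable {X : CharPair n C} (D : X.AdaptedChart)

lemma proj_s {b : B} (hb : b ∈ D.e.source) : X.P.proj (D.s b) = b := D.sectionOn.2 b hb

lemma modelMk_eq_iff {b : B} (hb : b ∈ D.e.source) {q q' : QTorus n} :
    X.modelMk (D.s b, q) = X.modelMk (D.s b, q') ↔ ∀ i, D.e b i ≠ 0 → q i = q' i := by
  rw [CharPair.modelMk_eq_iff]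
  simp only [ne_eq, D.zero_iff b hb]

open Classical in
/-- The coordinates of a point of the canonical model with respect to an adapted chart. -/
noncomputable def coordFun (x : X.Model) : HSpace n :=
  if h : X.P.proj (D.s x.base) = x.base then reg (exists_modelMk h).choose (emb (D.e x.base)) else 0

lemma base_modelMk {b : B} (hb : b ∈ D.e.source) (q : QTorus n) :
    (X.modelMk (D.s b, q)).base = b :=
  D.proj_s hb

lemma coordFun_modelMk {b : B} (hb : b ∈ D.e.source) (q : QTorus n) :
    D.coordFun (X.modelMk (D.s b, q)) = reg q (emb (D.e b)) := by
  -- Generalizing over `x` is needed because the base of `modelMk` equals `b` only propositionally.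
  have key : ∀ x : X.Model, x.base = b → x = X.modelMk (D.s b, q) →
      D.coordFun x = reg q (emb (D.e b)) := by
    rintro x rfl hx
    have h := D.proj_s hb
    rw [coordFun, dif_pos h]
    exact reg_emb_congr ((D.modelMk_eq_iff hb).1 ((exists_modelMk h).choose_spec.trans hx))
  exact key _ (D.base_modelMk hb q) rfl

lemma exists_modelMk {x : X.Model} (hx : x.base ∈ D.e.source) :
    ∃ q, X.modelMk (D.s x.base, q) = x :=
  CharPair.exists_modelMk (D.proj_s hx)

lemma rad_coordFun {x : X.Model} (hx : x.base ∈ D.e.source) :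
    rad (D.coordFun x) = D.e x.base := by
  obtain ⟨q, hq⟩ := D.exists_modelMk hx
  rw [← hq, D.coordFun_modelMk hx, rad_reg, rad_emb, D.base_modelMk hx]

/-- Tested on `P × Qⁿ`: near `(p, q)` all frames have the form `s · g` with one fixed `g`, so the
composite is `(p', q') ↦ g(q') · e(proj p')`. -/
lemma continuousOn_coordFun : ContinuousOn D.coordFun (Model.base ⁻¹' D.e.source) := by
  rw [isQuotientMap_modelMk.continuousOn_isOpen_iff
    (D.e.open_source.preimage X.continuous_base)]
  rintro ⟨p, q⟩ (hp : X.P.proj p ∈ D.e.source)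
  refine ContinuousAt.continuousWithinAt ?_
  have hU := D.e.open_source.mem_nhds hp
  obtain ⟨g, hg, -⟩ := X.P.existsUnique_act (D.proj_s hp)
  have h1 : ContinuousAt (fun x : X.P.Total × QTorus n =>
      reg (ev g x.2) (emb (D.e (X.P.proj x.1)))) (p, q) := by
    have h2 : ContinuousAt (fun x : X.P.Total × QTorus n => D.e (X.P.proj x.1)) (p, q) :=
      ContinuousAt.comp (g := D.e) (D.e.continuousAt hp)
        (X.P.continuous_proj.comp continuous_fst).continuousAt
    exact tendsto_reg ((continuous_ev g).comp continuous_snd).continuousAt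
      (ContinuousAt.comp (g := emb) continuous_emb.continuousAt h2)
  refine h1.congr ?_
  filter_upwards [continuous_fst.continuousAt.eventually (D.sectionOn.eventually_eq_act hU hg),
    (X.P.continuous_proj.comp continuous_fst).continuousAt.eventually hU] with x hx hx'
  obtain ⟨p', q'⟩ := x
  change _ = D.coordFun (X.modelMk (p', q'))
  conv_rhs => rw [← (show X.P.act (D.s (X.P.proj p')) g = p' from hx), modelMk_act]
  exact (D.coordFun_modelMk hx' _).symm

/-- The inverse of `coordFun`. -/
noncomputable def point (h : HSpace n) : X.Model := X.modelMk (D.s (D.e.symm (rad h)), phase h)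

lemma base_point {h : HSpace n} (hh : rad h ∈ D.e.target) :
    (D.point h).base = D.e.symm (rad h) :=
  D.proj_s (D.e.map_target hh)

/-- The phase in the definition of `point` is not continuous, so continuity is tested through the
polar map. There the composite is `(r, q) ↦ [s(e⁻¹ r), q]`, since `q` and the phase of `q · r`
differ only in collapsed factors. -/
lemma continuousOn_point : ContinuousOn D.point (rad ⁻¹' D.e.target) := by
  rw [LocalAction.isQuotientMap_polar.continuousOn_isOpen_iff
    (D.e.open_target.preimage continuous_rad)]
  have h2 : ContinuousOn (fun x : Orthant n × QTorus n => (D.s (D.e.symm x.1), x.2))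
      ((fun x : Orthant n × QTorus n => reg x.2 (emb x.1)) ⁻¹' (rad ⁻¹' D.e.target)) := by
    have ht : ∀ x ∈ ((fun x : Orthant n × QTorus n => reg x.2 (emb x.1)) ⁻¹'
        (rad ⁻¹' D.e.target)), x.1 ∈ D.e.target := fun x hx => by
      rw [mem_preimage, mem_preimage, rad_reg, rad_emb] at hx
      exact hx
    exact (D.sectionOn.1.comp (D.e.continuousOn_symm.comp continuous_fst.continuousOn ht)
      fun x hx => D.e.map_target (ht x hx)).prodMk continuous_snd.continuousOn
  refine (isQuotientMap_modelMk.continuous.comp_continuousOn h2).congr ?_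
  rintro ⟨r, q⟩ hx
  have hr : r ∈ D.e.target := by
    rwa [mem_preimage, mem_preimage, rad_reg, rad_emb] at hx
  change X.modelMk (D.s (D.e.symm (rad (reg q (emb r)))), _) = _
  rw [rad_reg, rad_emb]
  refine (D.modelMk_eq_iff (D.e.map_target hr)).2 fun i hi => ?_
  rw [D.e.right_inv hr] at hi
  exact phase_reg_emb hi

/-- The chart of the canonical model with values in `ℍⁿ` given by an adapted chart. -/
noncomputable def coord : OpenPartialHomeomorph X.Model (HSpace n) where
  toFun := D.coordFun
  invFun := D.point
  source := Model.base ⁻¹' D.e.source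
  target := rad ⁻¹' D.e.target
  map_source' x hx := by
    rw [mem_preimage, D.rad_coordFun hx]
    exact D.e.map_source hx
  map_target' h hh := by
    rw [mem_preimage, D.base_point hh]
    exact D.e.map_target hh
  left_inv' x hx := by
    obtain ⟨q, hq⟩ := D.exists_modelMk hx
    have hc : D.coordFun x = reg q (emb (D.e x.base)) := by
      conv_lhs => rw [← hq]
      exact D.coordFun_modelMk hx q
    rw [point, hc, rad_reg, rad_emb, D.e.left_inv hx]
    refine Eq.trans ?_ hq
    exact (D.modelMk_eq_iff hx).2 fun i hi => phase_reg_emb hi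
  right_inv' h hh := by
    rw [point, D.coordFun_modelMk (D.e.map_target hh), D.e.right_inv hh, reg_phase]
  open_source := D.e.open_source.preimage X.continuous_base
  open_target := D.e.open_target.preimage continuous_rad
  continuousOn_toFun := D.continuousOn_coordFun
  continuousOn_invFun := D.continuousOn_point

lemma coord_modelMk {b : B} (hb : b ∈ D.e.source) (q : QTorus n) :
    D.coord (X.modelMk (D.s b, q)) = reg q (emb (D.e b)) :=
  D.coordFun_modelMk hb q

lemma rad_coord {x : X.Model} (hx : x.base ∈ D.e.source) : rad (D.coord x) = D.e x.base :=
  D.rad_coordFun hx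

lemma coord_lact {x : X.Model} (hx : x.base ∈ D.e.source) (q : QTorus n) :
    D.coord (lact (D.s x.base) q x) = reg q (D.coord x) := by
  obtain ⟨q', hq⟩ := D.exists_modelMk hx
  have h1 : D.coord x = reg q' (emb (D.e x.base)) := by
    conv_lhs => rw [← hq]
    exact D.coord_modelMk hx q'
  have h2 : lact (D.s x.base) q x = X.modelMk (D.s x.base, q * q') := by
    conv_lhs => arg 3; rw [← hq]
    exact lact_modelMk _ _ _
  rw [h1, h2, D.coord_modelMk hx, reg_mul]

/-- In the frame of the chart, `[q][q'] = [q q']` reads `q · r`, `q' · r ↦ q · (q' · r)`. Replacing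
`q` by the phase of `q · r` changes only coordinates in which the result vanishes. -/
lemma coord_rmul {x : X.Model} (hx : x.base ∈ D.e.source) (θ : (b : B) → X.ModelFiber b) :
    D.coord (rmul x θ) = reg (phase (D.coord x)) (D.coord ⟨x.base, θ x.base⟩) := by
  obtain ⟨b, m⟩ := x
  replace hx : b ∈ D.e.source := hx
  obtain ⟨q, rfl⟩ := exists_fibMk ⟨D.s b, D.proj_s hx⟩ m
  obtain ⟨q', hq'⟩ := exists_fibMk ⟨D.s b, D.proj_s hx⟩ (θ b)
  have hm : ∀ q, D.coord ⟨b, X.toModel b (X.P.fibMk ⟨D.s b, D.proj_s hx⟩ q)⟩ =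
      reg q (emb (D.e b)) := fun q => by
    rw [← modelMk_eq_fibMk]; exact D.coord_modelMk hx q
  change D.coord ⟨b, X.toModel b _ * θ b⟩ = reg (phase (D.coord ⟨b, _⟩)) (D.coord ⟨b, θ b⟩)
  rw [← hq', ← map_mul, ← fibMk_mul, hm, hm, hm, ← reg_mul]
  refine reg_emb_congr fun i hi => ?_
  rw [Pi.mul_apply, Pi.mul_apply, phase_reg_emb hi]

/-- As `r` is real, the conjugate of `q · r` is `q⁻¹ · r`; inversion of sections thus becomes the
continuous map `star`. -/
lemma coord_inv {b : B} (hb : b ∈ D.e.source) (m : X.ModelFiber b) :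
    D.coord ⟨b, m⁻¹⟩ = star (D.coord ⟨b, m⟩) := by
  obtain ⟨q, rfl⟩ := exists_fibMk ⟨D.s b, D.proj_s hb⟩ m
  have hm : ∀ q, D.coord ⟨b, X.toModel b (X.P.fibMk ⟨D.s b, D.proj_s hb⟩ q)⟩ =
      reg q (emb (D.e b)) := fun q => by
    rw [← modelMk_eq_fibMk]; exact D.coord_modelMk hb q
  have h1 : (X.P.fibMk ⟨D.s b, D.proj_s hb⟩ q)⁻¹ = X.P.fibMk ⟨D.s b, D.proj_s hb⟩ q⁻¹ := by
    rw [inv_eq_iff_mul_eq_one, ← fibMk_mul, mul_inv_cancel, fibMk_one]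
  rw [← map_inv, h1, hm, hm]
  ext1 i
  have hq : (q i : ℍ[ℝ]) * star (q i : ℍ[ℝ]) = 1 := by
    rw [Quaternion.self_mul_star, Quaternion.normSq_eq_norm_mul_self,
      mem_sphere_zero_iff_norm.1 (q i).2]
    norm_num
  have h2 : ((q⁻¹ i : Q) : ℍ[ℝ]) = star (q i : ℍ[ℝ]) := by
    have h3 : ((q⁻¹ i : Q) : ℍ[ℝ]) = ((q i : Q) : ℍ[ℝ])⁻¹ := rfl
    rw [h3]
    exact inv_eq_of_mul_eq_one_right hq
  simp only [reg, emb, Pi.star_apply, star_mul, h2, Quaternion.star_coe]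
  exact (Quaternion.coe_commutes _ _).symm

/-- By `coord_rmul` the map is, in coordinates, a product of a phase with a vector of the same
radii, so `tendsto_reg_phase` applies. -/
lemma continuousAt_rmul {x : X.Model} (hx : x.base ∈ D.e.source) {θ : (b : B) → X.ModelFiber b}
    (hθ : ContinuousAt (fun b => (⟨b, θ b⟩ : X.Model)) x.base) :
    ContinuousAt (fun y => rmul y θ) x := by
  have h1 : Tendsto (fun y : X.Model => D.coord ⟨y.base, θ y.base⟩) (𝓝 x)
      (𝓝 (D.coord ⟨x.base, θ x.base⟩)) :=
    (D.coord.continuousAt (x := ⟨x.base, θ x.base⟩) hx).tendsto.comp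
      (hθ.tendsto.comp X.continuous_base.continuousAt)
  have h2 := tendsto_reg_phase (D.coord.continuousAt (x := x) hx) h1 (by
    rw [D.rad_coord hx]; exact (D.rad_coord (x := ⟨x.base, θ x.base⟩) hx).symm)
  rw [← D.coord_rmul hx] at h2
  have hx' : rmul x θ ∈ D.coord.source := hx
  have h3 := (D.coord.symm.continuousAt (D.coord.map_source hx')).tendsto.comp h2
  rw [D.coord.left_inv hx'] at h3
  refine h3.congr' ?_
  filter_upwards [D.coord.open_source.mem_nhds (x := x) hx] with y hy
  have hy' : rmul y θ ∈ D.coord.source := hy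
  rw [Function.comp_apply, ← D.coord_rmul hy, D.coord.left_inv hy']

lemma continuousAt_inv {b : B} (hb : b ∈ D.e.source) {θ : (b : B) → X.ModelFiber b}
    (hθ : ContinuousAt (fun b => (⟨b, θ b⟩ : X.Model)) b) :
    ContinuousAt (fun b => (⟨b, (θ b)⁻¹⟩ : X.Model)) b := by
  have h1 : Tendsto (fun b => star (D.coord ⟨b, θ b⟩)) (𝓝 b) (𝓝 (star (D.coord ⟨b, θ b⟩))) :=
    (continuous_star.tendsto _).comp
      ((D.coord.continuousAt (x := ⟨b, θ b⟩) hb).tendsto.comp hθ.tendsto)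
  rw [← D.coord_inv hb] at h1
  have hb' : (⟨b, (θ b)⁻¹⟩ : X.Model) ∈ D.coord.source := hb
  have h3 := (D.coord.symm.continuousAt (D.coord.map_source hb')).tendsto.comp h1
  rw [D.coord.left_inv hb'] at h3
  refine h3.congr' ?_
  filter_upwards [D.e.open_source.mem_nhds hb] with y hy
  have hy' : (⟨y, (θ y)⁻¹⟩ : X.Model) ∈ D.coord.source := hy
  rw [Function.comp_apply, ← D.coord_inv hy, D.coord.left_inv hy']

lemma continuousAt_one {b : B} (hb : b ∈ D.e.source) :
    ContinuousAt (fun b => (⟨b, 1⟩ : X.Model)) b := by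
  have h1 : ContinuousAt (fun b => X.modelMk (D.s b, 1)) b :=
    isQuotientMap_modelMk.continuous.continuousAt.comp (ContinuousAt.prodMk
      (D.sectionOn.1.continuousAt (D.e.open_source.mem_nhds hb)) continuousAt_const)
  refine h1.congr ?_
  filter_upwards [D.e.open_source.mem_nhds hb] with y hy
  rw [modelMk_eq_fibMk ⟨D.s y, D.proj_s hy⟩, fibMk_one, map_one]

end AdaptedChart

end CharPair

end LocalQ

namespace LocalQ

open Set Topology Quaternion Filter

open PrincipalBundle

/-! ### Faces and boxes in the orthant -/

section Orthant

variable {n : ℕ} {B : Type u} [TopologicalSpace B]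

/-- Every neighbourhood of a point of a face contains points that lie on no other face. -/
lemma exists_near_face (c : OpenPartialHomeomorph B (Orthant n)) {b : B} (h : b ∈ c.source)
    {i : Fin n} (hi : c b i = 0) {V : Set B} (hV : V ∈ 𝓝 b) :
    ∃ b' ∈ V, b' ∈ c.source ∧ ∀ j, c b' j = 0 ↔ j = i := by
  -- Adding `t` to every coordinate except the `i`-th leaves all faces but the `i`-th for `t ≠ 0`
  -- and returns to `b` as `t → 0`.
  let γ : NNReal → Orthant n := fun t j => if j = i then 0 else c b j + t
  have hγ : Continuous γ := by
    refine continuous_pi fun j => ?_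
    by_cases hj : j = i
    · simp only [γ, hj, if_true]; exact continuous_const
    · simp only [γ, hj, if_false]; fun_prop
  have h0 : γ 0 = c b := by
    ext1 j
    by_cases hj : j = i
    · subst hj; simp [γ, hi]
    · simp [γ, hj]
  have h1 : Tendsto (fun t => c.symm (γ t)) (𝓝 0) (𝓝 b) := by
    have h2 := (c.symm.continuousAt (c.map_source h)).tendsto
    rw [c.left_inv h, ← h0] at h2
    exact h2.comp hγ.continuousAt
  have h2 : ∀ᶠ t in 𝓝 (0 : NNReal), γ t ∈ c.target :=
    hγ.continuousAt.eventually (c.open_target.mem_nhds (h0 ▸ c.map_source h))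
  obtain ⟨t, ⟨ht, ht'⟩, ht0⟩ := ((((h1.eventually hV).and h2).filter_mono
    (nhdsWithin_le_nhds (s := Ioi 0))).and self_mem_nhdsWithin).exists
  refine ⟨c.symm (γ t), ht, c.map_target ht', fun j => ?_⟩
  rw [c.right_inv ht']
  by_cases hj : j = i
  · simp [γ, hj]
  · have : t ≠ 0 := fun h => by simp [h] at ht0
    simp [γ, hj, this]

lemma ordConnected_nnreal_ball (a : NNReal) (ε : ℝ) : (Metric.ball a ε).OrdConnected := by
  have : Metric.ball a ε = NNReal.toReal ⁻¹' (Metric.ball (a : ℝ) ε) := rfl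
  rw [this, Real.ball_eq_Ioo]
  exact ordConnected_Ioo.preimage_mono NNReal.coe_mono

lemma isPreconnected_ball (r : Orthant n) {ε : ℝ} (hε : 0 < ε) :
    IsPreconnected (Metric.ball r ε) := by
  rw [ball_pi r hε]
  exact isPreconnected_univ_pi fun i => (ordConnected_nnreal_ball _ _).isPreconnected

/-- Balls of the sup metric are boxes, and intersecting with an open face only replaces the `j`-th
side by its part in `{0}` and the other sides by their parts in `(0, ∞)`. Along such connected
pieces the fibres of `𝓛` are constant. -/
lemma isPreconnected_ball_face (r : Orthant n) {ε : ℝ} (hε : 0 < ε) (j : Fin n) :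
    IsPreconnected (Metric.ball r ε ∩ {r' | ∀ l, r' l = 0 ↔ l = j}) := by
  have : Metric.ball r ε ∩ {r' | ∀ l, r' l = 0 ↔ l = j} =
      pi univ fun l => Metric.ball (r l) ε ∩ (if l = j then Iic 0 else Ioi 0) := by
    rw [ball_pi r hε]
    ext r'
    simp only [mem_inter_iff, Set.mem_pi, mem_univ, forall_true_left, mem_ofPred_eq, ← forall_and]
    refine forall_congr' fun l => and_congr_right fun _ => ?_
    by_cases hl : l = j
    · simp [hl]
    · simp [hl, pos_iff_ne_zero]
  rw [this]
  refine isPreconnected_univ_pi fun l => OrdConnected.isPreconnected ?_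
  refine (ordConnected_nnreal_ball _ _).inter ?_
  split_ifs
  · exact ordConnected_Iic
  · exact ordConnected_Ioi

/-- Permutation of the coordinates of the orthant. -/
def permOrthant (μ : Equiv.Perm (Fin n)) : Orthant n ≃ₜ Orthant n where
  toFun r i := r (μ.symm i)
  invFun r i := r (μ i)
  left_inv r := by ext1 i; simp
  right_inv r := by ext1 i; simp
  continuous_toFun := by fun_prop
  continuous_invFun := by fun_prop

lemma depth_permOrthant (μ : Equiv.Perm (Fin n)) (r : Orthant n) :
    depth (permOrthant μ r) = depth r := by
  have : {i | r i = 0} = μ.symm '' {i | permOrthant μ r i = 0} := by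
    ext i
    constructor
    · intro hi
      refine ⟨μ i, ?_, μ.symm_apply_apply i⟩
      change r (μ.symm (μ i)) = 0
      rwa [μ.symm_apply_apply]
    · rintro ⟨j, hj, rfl⟩
      exact hj
  rw [depth, depth, this, ncard_image_of_injective _ μ.symm.injective]

lemma single_mem_zmultiples {i j : Fin n}
    (h : (Pi.single i 1 : Lattice n) ∈ AddSubgroup.zmultiples (Pi.single j 1 : Lattice n)) :
    i = j := by
  obtain ⟨k, hk⟩ := AddSubgroup.mem_zmultiples_iff.1 h
  by_contra hij
  have := congrFun hk i
  simp [Pi.single_eq_of_ne hij] at this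

lemma latticeEv_mem_zmultiples {g : QAut n} {i : Fin n} {v : Lattice n} :
    latticeEv g v ∈ AddSubgroup.zmultiples (Pi.single (perm n g i) 1 : Lattice n) ↔
      v ∈ AddSubgroup.zmultiples (Pi.single i 1 : Lattice n) := by
  have hs : ∀ (k : ℤ) (i : Fin n), k • (Pi.single i 1 : Lattice n) = Pi.single i k := fun k i => by
    rw [← Pi.single_smul, smul_eq_mul, mul_one]
  simp only [AddSubgroup.mem_zmultiples_iff, hs]
  simp only [← latticeEv_single]
  refine exists_congr fun k => ⟨fun h => ?_, fun h => by rw [h]⟩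
  have := congrArg (latticeEv g⁻¹) h
  rwa [← latticeEv_mul, ← latticeEv_mul, inv_mul_cancel, latticeEv_one, latticeEv_one] at this

end Orthant

/-! ### Strata, and the sublattice bundle in parallel frames -/

section Frames

variable {n : ℕ} {B : Type u} [TopologicalSpace B]

lemma inFrame_act_eq {P : PrincipalBundle n B} {S : Set B}
    {L : (b : S) → AddSubgroup (P.latticeFiber b)} {p : P.Total} {g : QAut n} {i : Fin n}
    (h : inFrame P L p = (AddSubgroup.zmultiples (Pi.single (perm n g i) 1 : Lattice n) :
      Set (Lattice n))) :
    inFrame P L (P.act p g) = (AddSubgroup.zmultiples (Pi.single i 1 : Lattice n) :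
      Set (Lattice n)) := by
  ext v
  rw [inFrame_act, h]
  exact latticeEv_mem_zmultiples

variable {C : Corners n B}

lemma Corners.depth_eq {k : ℕ} {b : B} (hb : b ∈ C.stratum k)
    {c : OpenPartialHomeomorph B (Orthant n)} (hc : c ∈ C.atlas) (h : b ∈ c.source) :
    depth (c b) = k := by
  obtain ⟨c', hc', hb', hd⟩ := hb
  rw [← hd]
  exact C.strata _ hc _ hc' b ⟨h, hb'⟩

lemma Corners.stratum_unique {k k' : ℕ} {b : B} (hb : b ∈ C.stratum k) (hb' : b ∈ C.stratum k') :
    k = k' := by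
  obtain ⟨c, hc, h⟩ := C.cover b
  rw [← C.depth_eq hb hc h, ← C.depth_eq hb' hc h]

lemma depth_eq_one_iff {r : Orthant n} : depth r = 1 ↔ ∃ i, ∀ j, r j = 0 ↔ j = i := by
  rw [depth, ncard_eq_one]
  exact exists_congr fun i => Set.ext_iff

lemma base_mem_of_mem_inFrame {X : CharPair n C} {p : X.P.Total} {v : Lattice n}
    (h : v ∈ inFrame X.P X.L p) : X.P.proj p ∈ C.stratum 1 :=
  h.choose

/-- The fibres of `𝓛` are locally constant in parallel frames. -/
lemma CharPair.eventually_inFrame_eq {X : CharPair n C} {s : B → X.P.Total} {U : Set B}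
    (hs : X.P.SectionOn s U) {b : B} (hU : U ∈ 𝓝 b) (hb : b ∈ C.stratum 1) :
    ∃ i, ∀ᶠ b' in 𝓝 b, b' ∈ C.stratum 1 → inFrame X.P X.L (s b') =
      (AddSubgroup.zmultiples (Pi.single i 1 : Lattice n) : Set (Lattice n)) := by
  obtain ⟨U', hU', hb', s', hc', hp', i, hi⟩ := X.locallyTrivial b hb
  have hs' : X.P.SectionOn s' U' := ⟨hc', hp'⟩
  obtain ⟨g, hg⟩ := hs'.exists_act hs hb' (mem_of_mem_nhds hU)
  obtain ⟨j, rfl⟩ := (perm n g).surjective i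
  refine ⟨j, ?_⟩
  filter_upwards [hs'.eventually_eq hs (hU'.mem_nhds hb') hU hg, hU'.mem_nhds hb'] with b'' h1 h2 h3
  rw [← h1]
  exact inFrame_act_eq (hi _ ⟨h2, h3⟩)

end Frames

/-! ### Existence of adapted charts -/

namespace CharPair

variable {n : ℕ} {B : Type u} [TopologicalSpace B] {C : Corners n B}

/-- The codimension of points and the fibres of `𝓛` are read off from the vanishing coordinates. -/
structure AdaptedChart.IsStratified {X : CharPair n C} (D : X.AdaptedChart) : Prop where
  mem_stratum : ∀ b ∈ D.e.source, b ∈ C.stratum (depth (D.e b))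
  inFrame_eq : ∀ b ∈ D.e.source, b ∈ C.stratum 1 → ∀ i, D.e b i = 0 →
    inFrame X.P X.L (D.s b) =
      (AddSubgroup.zmultiples (Pi.single i 1 : Lattice n) : Set (Lattice n))

/-- Every point has a basis of connected neighbourhoods that are domains of adapted charts. -/
lemma exists_adaptedChart (X : CharPair n C) (b₀ : B) {O : Set B} (hO : O ∈ 𝓝 b₀) :
    ∃ D : X.AdaptedChart, b₀ ∈ D.e.source ∧ D.e.source ⊆ O ∧ IsPreconnected D.e.source ∧
      D.IsStratified := by
  obtain ⟨c, hc, hb₀⟩ := C.cover b₀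
  obtain ⟨U, hU, hbU, σ, hσc, hσp, huni⟩ := X.unimodular (depth (c b₀)) b₀ ⟨c, hc, hb₀, rfl⟩
  have hσ : X.P.SectionOn σ U := ⟨hσc, hσp⟩
  set Z : Set (Fin n) := {j | c b₀ j = 0} with hZ
  -- the domain of the chart
  obtain ⟨ε, hε, hball⟩ : ∃ ε > 0, Metric.ball (c b₀) ε ⊆
      {r | r ∈ c.target ∧ c.symm r ∈ O ∩ U ∧ ∀ j ∉ Z, r j ≠ 0} := by
    refine Metric.mem_nhds_iff.1 ?_
    have h1 : ∀ᶠ r in 𝓝 (c b₀), c.symm r ∈ O ∩ U := by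
      have h2 := (c.symm.continuousAt (c.map_source hb₀)).tendsto
      rw [c.left_inv hb₀] at h2
      exact h2.eventually (inter_mem hO (hU.mem_nhds hbU))
    have h2 : ∀ᶠ r in 𝓝 (c b₀), ∀ j ∉ Z, r j ≠ 0 := by
      refine eventually_all.2 fun j => ?_
      by_cases hj : j ∈ Z
      · exact Eventually.of_forall fun r h => absurd hj h
      · filter_upwards [(continuous_apply j).continuousAt.eventually_ne hj] with r hr _ using hr
    filter_upwards [c.open_target.mem_nhds (c.map_source hb₀), h1, h2] with r h h' h''
      using ⟨h, h', h''⟩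
  set W : Set B := c.source ∩ c ⁻¹' Metric.ball (c b₀) ε with hWdef
  have hW : IsOpen W := c.isOpen_inter_preimage Metric.isOpen_ball
  have hbW : b₀ ∈ W := ⟨hb₀, Metric.mem_ball_self hε⟩
  have himg : ∀ T ⊆ Metric.ball (c b₀) ε, IsPreconnected T → IsPreconnected (c.symm '' T) :=
    fun T hT h => h.image _ (c.continuousOn_symm.mono fun r hr => (hball (hT hr)).1)
  have hWO : W ⊆ O ∩ U := fun b hb => by
    have := (hball hb.2).2.1
    rwa [c.left_inv hb.1] at this
  have hWne : ∀ b ∈ W, ∀ j, c b j = 0 → j ∈ Z := fun b hb j hj =>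
    by_contra fun h => (hball hb.2).2.2 j h hj
  have hWpre : IsPreconnected W := by
    have : W = c.symm '' Metric.ball (c b₀) ε := by
      ext b
      constructor
      · exact fun hb => ⟨c b, hb.2, c.left_inv hb.1⟩
      · rintro ⟨r, hr, rfl⟩
        refine ⟨c.map_target (hball hr).1, ?_⟩
        rwa [mem_preimage, c.right_inv (hball hr).1]
    rw [this]
    exact himg _ subset_rfl (isPreconnected_ball _ hε)
  have hF : ∀ j, IsPreconnected {b | b ∈ W ∧ ∀ l, c b l = 0 ↔ l = j} := fun j => by
    have : {b | b ∈ W ∧ ∀ l, c b l = 0 ↔ l = j} =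
        c.symm '' (Metric.ball (c b₀) ε ∩ {r | ∀ l, r l = 0 ↔ l = j}) := by
      ext b
      constructor
      · exact fun hb => ⟨c b, ⟨hb.1.2, hb.2⟩, c.left_inv hb.1.1⟩
      · rintro ⟨r, hr, rfl⟩
        have h1 := c.right_inv (hball hr.1).1
        refine ⟨⟨c.map_target (hball hr.1).1, ?_⟩, ?_⟩
        · rw [mem_preimage, h1]; exact hr.1
        · rw [h1]; exact hr.2
    rw [this]
    exact himg _ inter_subset_left (isPreconnected_ball_face _ hε j)
  have hFs : ∀ j b, b ∈ W → (∀ l, c b l = 0 ↔ l = j) → b ∈ C.stratum 1 := fun j b hb h =>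
    ⟨c, hc, hb.1, depth_eq_one_iff.2 ⟨j, h⟩⟩
  have hsF : ∀ b ∈ W, b ∈ C.stratum 1 → ∃ j ∈ Z, ∀ l, c b l = 0 ↔ l = j := fun b hb hs => by
    obtain ⟨j, hj⟩ := depth_eq_one_iff.1 (C.depth_eq hs hc hb.1)
    exact ⟨j, hWne b hb j ((hj j).2 rfl), hj⟩
  -- the fibres of `𝓛` over the faces
  have hm : ∀ j, ∃ i, j ∈ Z → ∀ b ∈ W, (∀ l, c b l = 0 ↔ l = j) → inFrame X.P X.L (σ b) =
      (AddSubgroup.zmultiples (Pi.single i 1 : Lattice n) : Set (Lattice n)) := by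
    intro j
    by_cases hj : j ∈ Z
    · obtain ⟨b₁, hb₁, -, hb₁'⟩ := exists_near_face c hb₀ hj (hW.mem_nhds hbW)
      obtain ⟨i, hi⟩ := X.eventually_inFrame_eq hσ (hU.mem_nhds (hWO hb₁).2) (hFs j b₁ hb₁ hb₁')
      refine ⟨i, fun _ b hb hb' => ?_⟩
      rw [← hi.self_of_nhds (hFs j b₁ hb₁ hb₁')]
      -- The fibre of `𝓛` in the frame `σ` is locally constant along the face, and the part of the
      -- face in `W` is connected.
      refine (hF j).induction₂ (fun b b' => inFrame X.P X.L (σ b) = inFrame X.P X.L (σ b'))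
        (fun b' hb' => ?_) (fun _ _ _ _ _ _ h h' => h.trans h') (fun _ _ _ _ h => h.symm)
        ⟨hb, hb'⟩ ⟨hb₁, hb₁'⟩
      have hs := hFs j b' hb'.1 hb'.2
      obtain ⟨i', hi'⟩ := X.eventually_inFrame_eq hσ (hU.mem_nhds (hWO hb'.1).2) hs
      filter_upwards [nhdsWithin_le_nhds hi', self_mem_nhdsWithin] with b'' h1 h2
      rw [hi'.self_of_nhds hs, h1 (hFs j b'' h2.1 h2.2)]
    · exact ⟨j, fun h => absurd h hj⟩
  choose m hm using hm
  -- distinct faces correspond to distinct factors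
  have hinj : InjOn m Z := by
    -- Unimodularity at `b₀` says that the fibres over `W` span a lattice of rank `Z.ncard`, the
    -- number of faces through `b₀`. They span the coordinate lattice of `m '' Z`, so `m` cannot
    -- identify two elements of `Z`.
    obtain ⟨-, hrank⟩ := huni W (fun b hb => (hWO hb).2) hW hbW
    have key : Submodule.span ℤ (⋃ b' ∈ W, inFrame X.P X.L (σ b')) =
        Submodule.span ℤ ((fun i => (Pi.single i 1 : Lattice n)) '' (m '' Z)) := by
      refine le_antisymm (Submodule.span_le.2 ?_) (Submodule.span_le.2 ?_)
      · refine iUnion₂_subset fun b' hb' v hv => ?_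
        have hs : b' ∈ C.stratum 1 := by
          have := base_mem_of_mem_inFrame hv
          rwa [hσ.2 b' (hWO hb').2] at this
        obtain ⟨j, hj, hj'⟩ := hsF b' hb' hs
        rw [hm j hj b' hb' hj'] at hv
        obtain ⟨k, rfl⟩ := AddSubgroup.mem_zmultiples_iff.1 hv
        exact Submodule.smul_mem _ k (Submodule.subset_span ⟨m j, ⟨j, hj, rfl⟩, rfl⟩)
      · rintro _ ⟨_, ⟨j, hj, rfl⟩, rfl⟩
        obtain ⟨b₁, hb₁, -, hb₁'⟩ := exists_near_face c hb₀ hj (hW.mem_nhds hbW)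
        refine Submodule.subset_span (mem_iUnion₂.2 ⟨b₁, hb₁, ?_⟩)
        rw [hm j hj b₁ hb₁ hb₁']
        exact AddSubgroup.mem_zmultiples _
    rw [key, (LocalAction.span_single (m '' Z)).2] at hrank
    exact injOn_of_ncard_image_eq hrank
  -- How `m` is extended beyond `Z` is immaterial, since the coordinates outside `Z` do not vanish
  -- on `W`.
  obtain ⟨μ, hμ⟩ : ∃ μ : Equiv.Perm (Fin n), ∀ j ∈ Z, μ j = m j := by
    classical
    exact ⟨(Equiv.Set.imageOfInjOn m Z hinj).extendSubtype, fun j hj =>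
      Equiv.extendSubtype_apply_of_mem _ j hj⟩
  have hproj : ∀ b ∈ W, X.P.proj (σ b) = b := fun b hb => hσ.2 b (hWO hb).2
  -- The coordinates are permuted by `μ` so that each face carries the index of the factor that
  -- generates `𝓛` along it.
  refine ⟨⟨(c.restrOpen _ hW).transHomeomorph (permOrthant μ), σ, hσ.mono ?_, ?_⟩, ?_, ?_, ?_, ?_, ?_⟩
  · exact fun b hb => (hWO hb.2).2
  · rintro b ⟨-, hb⟩ i
    change c b (μ.symm i) = 0 ↔ _
    obtain ⟨j, rfl⟩ := μ.surjective i
    rw [μ.symm_apply_apply]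
    have hUb : U ∈ 𝓝 b := hU.mem_nhds (hWO hb).2
    constructor
    · intro hj
      -- Points near `b` on the `j`-th face and on no other have codimension one, and there the
      -- fibre of `𝓛` is spanned by the basis vector of index `μ j`.
      refine mem_closure_iff_nhds.2 fun N hN => ?_
      obtain ⟨b₁, ⟨hb₁, hb₁W⟩, -, hb₁'⟩ := exists_near_face c hb.1 hj
        (inter_mem ((hσ.1.continuousAt hUb).preimage_mem_nhds hN) (hW.mem_nhds hb))
      refine ⟨σ b₁, hb₁, ?_⟩
      have hjZ := hWne b hb j hj
      change _ ∈ inFrame X.P X.L (σ b₁)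
      rw [hm j hjZ b₁ hb₁W hb₁', hμ j hjZ]
      exact AddSubgroup.mem_zmultiples _
    · intro hcl
      by_contra hne
      -- Frames near `σ b` are values of `σ`. If the `j`-th coordinate is nonzero at `b`, then it is
      -- nonzero nearby, and the fibres of `𝓛` there belong to other faces, hence by injectivity of
      -- `μ` to other factors.
      have h1 : ∀ᶠ p' in 𝓝 (σ b), X.P.act (σ (X.P.proj p')) 1 = p' :=
        hσ.eventually_eq_act (by rwa [hproj b hb]) (by rw [hproj b hb, X.P.act_one])
      have h2 : ∀ᶠ b' in 𝓝 b, b' ∈ W ∧ c b' j ≠ 0 :=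
        (hW.eventually_mem hb).and (((continuous_apply j).continuousAt.comp
          (c.continuousAt hb.1)).eventually_ne hne)
      have h3 : ∀ᶠ p' in 𝓝 (σ b), X.P.proj p' ∈ W ∧ c (X.P.proj p') j ≠ 0 := by
        have := X.P.continuous_proj.tendsto (σ b)
        rw [hproj b hb] at this
        exact this.eventually h2
      obtain ⟨p', ⟨h4, h5, h6⟩, h7⟩ := mem_closure_iff_nhds.1 hcl _ (h1.and h3)
      obtain ⟨l, hl, hl'⟩ := hsF _ h5 (base_mem_of_mem_inFrame h7)
      rw [X.P.act_one] at h4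
      have h8 : (Pi.single (μ j) 1 : Lattice n) ∈ inFrame X.P X.L (σ (X.P.proj p')) := by
        rw [h4]; exact h7
      rw [hm l hl _ h5 hl', ← hμ l hl] at h8
      exact h6 ((hl' j).2 (μ.injective (single_mem_zmultiples h8)))
  · exact ⟨hb₀, hbW⟩
  · exact fun b hb => (hWO hb.2).1
  · change IsPreconnected (c.source ∩ W)
    rwa [inter_eq_self_of_subset_right inter_subset_left]
  · rintro b ⟨-, hb⟩
    exact ⟨c, hc, hb.1, (depth_permOrthant μ _).symm⟩
  · rintro b ⟨-, hb⟩ hs i (hi : c b (μ.symm i) = 0)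
    obtain ⟨j, hj, hj'⟩ := hsF b hb hs
    rw [show i = m j by rw [← hμ j hj, ← (hj' _).1 hi, μ.apply_symm_apply]]
    exact hm j hj b hb hj'

end CharPair

end LocalQ

namespace LocalQ

open Set Topology Quaternion Filter

open PrincipalBundle

/-! ### The sheaf of sections and its cohomology set -/

namespace CharPair

variable {n : ℕ} {B : Type u} [TopologicalSpace B] {C : Corners n B} {X : CharPair n C}

lemma continuousAt_rmul {x : X.Model} {θ : (b : B) → X.ModelFiber b}
    (hθ : ContinuousAt (fun b => (⟨b, θ b⟩ : X.Model)) x.base) :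
    ContinuousAt (fun y => rmul y θ) x := by
  obtain ⟨D, hD, -⟩ := X.exists_adaptedChart x.base univ_mem
  exact D.continuousAt_rmul hD hθ

lemma IsSection.continuousAt {U : Set B} {θ : (b : B) → X.ModelFiber b} (h : X.IsSection U θ)
    {b : B} (hU : U ∈ 𝓝 b) : ContinuousAt (fun b => (⟨b, θ b⟩ : X.Model)) b :=
  ContinuousOn.continuousAt h hU

lemma isSection_one (U : Set B) : X.IsSection U (fun _ => 1) := by
  intro b _
  obtain ⟨D, hD, -⟩ := X.exists_adaptedChart b univ_mem
  exact (D.continuousAt_one hD).continuousWithinAt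

lemma IsSection.inv {U : Set B} {θ : (b : B) → X.ModelFiber b} (h : X.IsSection U θ)
    (hU : IsOpen U) : X.IsSection U (fun b => (θ b)⁻¹) := by
  intro b hb
  obtain ⟨D, hD, -⟩ := X.exists_adaptedChart b univ_mem
  exact (D.continuousAt_inv hD (h.continuousAt (hU.mem_nhds hb))).continuousWithinAt

/-- The product is the right multiplication by `θ'` applied to the section `θ`, so continuity of
`rmul` suffices. -/
lemma IsSection.mul {U : Set B} {θ θ' : (b : B) → X.ModelFiber b} (h : X.IsSection U θ)
    (h' : X.IsSection U θ') (hU : IsOpen U) : X.IsSection U (fun b => θ b * θ' b) := by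
  intro b hb
  have h1 := h'.continuousAt (hU.mem_nhds hb)
  exact (ContinuousAt.comp (g := fun y => rmul y θ') (f := fun b => (⟨b, θ b⟩ : X.Model))
    (continuousAt_rmul (x := ⟨b, θ b⟩) h1)
    (h.continuousAt (hU.mem_nhds hb))).continuousWithinAt

lemma IsSection.mono {U V : Set B} {θ : (b : B) → X.ModelFiber b} (h : X.IsSection U θ)
    (hV : V ⊆ U) : X.IsSection V θ :=
  ContinuousOn.mono h hV

lemma Cocycle.θ_self (c : X.Cocycle) {α : c.ι} {b : B} (h : b ∈ c.U α) : c.θ α α b = 1 :=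
  mul_eq_left.1 (c.cocycle α α α b ⟨⟨h, h⟩, h⟩)

lemma cohomologous_refl (c : X.Cocycle) : X.Cohomologous c c :=
  ⟨c.ι, c.U, id, id, fun _ _ => 1, c.isOpen, c.cover, fun _ => subset_rfl, fun _ => subset_rfl,
    fun _ => isSection_one _, fun k l b _ => by simp⟩

lemma Cohomologous.symm {c c' : X.Cocycle} (h : X.Cohomologous c c') : X.Cohomologous c' c := by
  obtain ⟨κ, W, r, r', g, hW, hcov, hr, hr', hg, h⟩ := h
  refine ⟨κ, W, r', r, fun k b => (g k b)⁻¹, hW, hcov, hr', hr, fun k => (hg k).inv (hW k),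
    fun k l b hb => ?_⟩
  rw [h k l b hb]
  group

/-- On `W k ∩ W' k'` the two relations refer to different members `r' k` and `s k'` of the cover of
`c'`; the transition `c'.θ (r' k) (s k')` must be inserted between the two 0-cochains. -/
lemma Cohomologous.trans {c c' c'' : X.Cocycle} (h : X.Cohomologous c c')
    (h' : X.Cohomologous c' c'') : X.Cohomologous c c'' := by
  obtain ⟨κ, W, r, r', g, hW, hcov, hr, hr', hg, h⟩ := h
  obtain ⟨κ', W', s, s', g', hW', hcov', hs, hs', hg', h'⟩ := h'
  have ho : ∀ k : κ × κ', IsOpen (W k.1 ∩ W' k.2) := fun k => (hW _).inter (hW' _)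
  refine ⟨κ × κ', fun k => W k.1 ∩ W' k.2, fun k => r k.1, fun k => s' k.2,
    fun k b => g k.1 b * c'.θ (r' k.1) (s k.2) b * g' k.2 b, ho, fun b => ?_,
    fun k => inter_subset_left.trans (hr _), fun k => inter_subset_right.trans (hs' _),
    fun k => ?_, ?_⟩
  · obtain ⟨k, hk⟩ := hcov b
    obtain ⟨k', hk'⟩ := hcov' b
    exact ⟨(k, k'), hk, hk'⟩
  · exact (((hg _).mono inter_subset_left).mul ((c'.isSection _ _).mono
      (inter_subset_inter (hr' _) (hs _))) (ho k)).mul ((hg' _).mono inter_subset_right) (ho k)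
  · rintro ⟨k, k'⟩ ⟨l, l'⟩ b ⟨⟨hk, hk'⟩, hl, hl'⟩
    have e1 := h k l b ⟨hk, hl⟩
    have e2 := h' k' l' b ⟨hk', hl'⟩
    have e3 := c'.cocycle (r' k) (s k') (s l') b ⟨⟨hr' _ hk, hs _ hk'⟩, hs _ hl'⟩
    have e4 := c'.cocycle (r' k) (r' l) (s l') b ⟨⟨hr' _ hk, hr' _ hl⟩, hs _ hl'⟩
    have e5 : c'.θ (s k') (s l') b = (c'.θ (r' k) (s k') b)⁻¹ *
        (c'.θ (r' k) (r' l) b * c'.θ (r' l) (s l') b) := by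
      rw [e4, ← e3, inv_mul_cancel_left]
    rw [e2, e5, e1]
    group

/-- `H1` is a bare `Quot`, so an equality of classes yields a 0-cochain only once the relation is
known to be an equivalence relation. -/
lemma h1_eq_iff {c c' : X.Cocycle} :
    Quot.mk X.Cohomologous c = Quot.mk X.Cohomologous c' ↔ X.Cohomologous c c' :=
  Equivalence.quot_mk_eq_iff ⟨cohomologous_refl, Cohomologous.symm, Cohomologous.trans⟩ c c'

namespace Iso

variable {B' : Type u} [TopologicalSpace B'] {C' : Corners n B'} {X' : CharPair n C'}
  (F : CharPair.Iso X X')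

/-- The inverse of an isomorphism of characteristic pairs. -/
def symm : CharPair.Iso X' X where
  fB := F.fB.symm
  fP := F.fP.symm
  proj_fP p := by
    rw [Homeomorph.eq_symm_apply, ← F.proj_fP, F.fP.apply_symm_apply]
  fP_act p g := by
    rw [Homeomorph.symm_apply_eq, F.fP_act, F.fP.apply_symm_apply]
  strata k b := by rw [F.strata, F.fB.apply_symm_apply]
  lattice p := by rw [F.lattice, F.fP.apply_symm_apply]

lemma symm_modelPullTotal (x : X'.Model) : F.symm.modelPullTotal (F.modelPullTotal x) = x := by
  obtain ⟨⟨p, q⟩, rfl⟩ := isQuotientMap_modelMk.surjective x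
  rw [modelPullTotal_modelMk, modelPullTotal_modelMk]
  exact congrArg (fun p => X'.modelMk (p, q)) (F.fP.apply_symm_apply p)

lemma modelPullTotal_symm (x : X.Model) : F.modelPullTotal (F.symm.modelPullTotal x) = x :=
  F.symm.symm_modelPullTotal x

lemma base_modelPullTotal (x : X'.Model) : (F.modelPullTotal x).base = F.fB.symm x.base := rfl

lemma modelPullTotal_rmul (x : X'.Model) (θ : (b : B') → X'.ModelFiber b) :
    F.modelPullTotal (rmul x θ) =
      rmul (F.modelPullTotal x) (fun b => F.modelPull b (θ (F.fB b))) := by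
  obtain ⟨b', m⟩ := x
  obtain ⟨b, rfl⟩ := F.fB.surjective b'
  rw [modelPullTotal_mk, rmul, rmul, modelPullTotal_mk, map_mul]

lemma modelPullTotal_lact (p : X.P.Total) (q : QTorus n) {x : X'.Model}
    (hx : x.base = F.fB (X.P.proj p)) :
    F.modelPullTotal (lact (F.fP p) q x) = lact p q (F.modelPullTotal x) := by
  obtain ⟨q', rfl⟩ := exists_modelMk (p := F.fP p) (x := x) ((F.proj_fP p).trans hx.symm)
  rw [lact_modelMk, modelPullTotal_modelMk, modelPullTotal_modelMk, F.fP.symm_apply_apply,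
    lact_modelMk]

end Iso

end CharPair

end LocalQ

namespace LocalQ

open Set Topology Quaternion Filter

open PrincipalBundle CharPair

/-- The value of a point of the canonical model as an element of the fibre over `b`. -/
noncomputable def CharPair.Model.valAt {n : ℕ} {B : Type u} [TopologicalSpace B] {C : Corners n B}
    {X : CharPair n C} (x : X.Model) (b : B) : X.ModelFiber b :=
  open Classical in if h : x.base = b then h ▸ x.val else 1

lemma CharPair.Model.mk_valAt {n : ℕ} {B : Type u} [TopologicalSpace B] {C : Corners n B}
    {X : CharPair n C} {x : X.Model} {b : B} (h : x.base = b) :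
    (⟨b, x.valAt b⟩ : X.Model) = x := by
  subst h
  rw [valAt, dif_pos rfl]

/-! ### The local identifications with the canonical model -/

namespace LocalAction

variable {n : ℕ} {M : Type u} [TopologicalSpace M] {A : LocalAction n M}

variable (A) in
/-- The frame given by a chart, as a point of the bundle of the characteristic pair. -/
noncomputable def cframe (φ : A.Chart) (b : A.OrbitSpace) : A.charPair.P.Total := A.frame φ b

lemma proj_cframe (φ : A.Chart) (b : A.OrbitSpace) : A.charPair.P.proj (A.cframe φ b) = b := rfl

lemma act_cframe {φ ψ : A.Chart} {b : A.OrbitSpace} (h : b ∈ (A.baseChart φ).source)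
    (h' : b ∈ (A.baseChart ψ).source) :
    A.charPair.P.act (A.cframe φ b) (A.rho ψ φ) = A.cframe ψ b :=
  act_frame h h'

lemma inFrame_cframe {b : A.OrbitSpace} (hb : b ∈ A.corners.stratum 1) {φ : A.Chart}
    (h : b ∈ (A.baseChart φ).source) {i : Fin n} (hi : A.baseChart φ b i = 0) :
    inFrame A.charPair.P A.charPair.L (A.cframe φ b) =
      (AddSubgroup.zmultiples (Pi.single i 1 : Lattice n) : Set (Lattice n)) :=
  inFrame_frame hb h hi

lemma sectionOn_cframe (φ : A.Chart) :
    A.charPair.P.SectionOn (A.cframe φ) (A.baseChart φ).source :=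
  ⟨continuousOn_frame φ, fun _ _ => rfl⟩

/-- Converse of `mem_collapsed`. Frames near the frame of `φ` are frames of `φ` again, and where the
`i`-th coordinate is nonzero the fibres of `𝓛` are spanned by other basis vectors. -/
lemma zero_of_mem_collapsed {φ : A.Chart} {b : A.OrbitSpace} (h : b ∈ (A.baseChart φ).source)
    {i : Fin n} (hi : i ∈ A.charPair.collapsed (A.cframe φ b)) : A.baseChart φ b i = 0 := by
  by_contra hne
  have hW := (A.baseChart φ).open_source.mem_nhds h
  have h1 : ∀ᶠ p' in 𝓝 (A.cframe φ b),
      A.charPair.P.act (A.cframe φ (A.charPair.P.proj p')) 1 = p' :=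
    (sectionOn_cframe φ).eventually_eq_act (p := A.cframe φ b) hW (A.charPair.P.act_one _)
  have h2 : ∀ᶠ b' in 𝓝 b, b' ∈ (A.baseChart φ).source ∧ A.baseChart φ b' i ≠ 0 :=
    (Filter.Eventually.and hW (((continuous_apply i).continuousAt.comp
      ((A.baseChart φ).continuousAt h)).eventually_ne hne))
  have h3 : ∀ᶠ p' in 𝓝 (A.cframe φ b), A.charPair.P.proj p' ∈ (A.baseChart φ).source ∧
      A.baseChart φ (A.charPair.P.proj p') i ≠ 0 :=
    (A.charPair.P.continuous_proj.tendsto (A.cframe φ b)).eventually h2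
  obtain ⟨p', ⟨h4, h5, h6⟩, h7⟩ := mem_closure_iff_nhds.1 hi _ (h1.and h3)
  rw [A.charPair.P.act_one] at h4
  have hs : A.charPair.P.proj p' ∈ A.corners.stratum 1 := base_mem_of_mem_inFrame h7
  obtain ⟨l, hl⟩ := depth_eq_one_iff.1 (depth_eq hs h5)
  have h8 : (Pi.single i 1 : Lattice n) ∈ inFrame A.charPair.P A.charPair.L
      (A.cframe φ (A.charPair.P.proj p')) := by
    rw [h4]; exact h7
  rw [inFrame_cframe hs h5 ((hl l).2 rfl)] at h8
  exact h6 ((hl i).2 (single_mem_zmultiples h8))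

variable (A) in
/-- The chart of the orbit space and the frame given by a chart of `M`. -/
noncomputable def adapted (φ : A.Chart) : A.charPair.AdaptedChart where
  e := A.baseChart φ
  s := A.cframe φ
  sectionOn := sectionOn_cframe φ
  zero_iff _ hb _ := ⟨mem_collapsed hb, zero_of_mem_collapsed hb⟩

lemma base_toCanonical (φ : A.Chart) (x : M) : (A.toCanonical φ x).base = A.π x := rfl

lemma toCanonical_mem {φ : A.Chart} {x : M} (hx : x ∈ φ.1.source) :
    A.toCanonical φ x ∈ (A.adapted φ).coord.source :=
  π_mem_source.2 hx

/-- The chart `φ` factors as `h_φ` followed by the coordinates of the model, so `h_φ` inherits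
injectivity, surjectivity and the embedding property from `φ` and `coord`. -/
lemma coord_toCanonical {φ : A.Chart} {x : M} (hx : x ∈ φ.1.source) :
    (A.adapted φ).coord (A.toCanonical φ x) = φ.1 x := by
  refine ((A.adapted φ).coord_modelMk (π_mem_source.2 hx) _).trans ?_
  change reg _ (emb (A.baseChart φ (A.π x))) = _
  rw [baseChart_π hx, reg_phase]

lemma toCanonical_injOn (φ : A.Chart) : InjOn (A.toCanonical φ) φ.1.source := by
  intro x hx y hy h
  refine φ.1.injOn hx hy ?_
  rw [← coord_toCanonical hx, h, coord_toCanonical hy]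

lemma exists_toCanonical {φ : A.Chart} {z : A.charPair.Model}
    (hz : z.base ∈ (A.baseChart φ).source) : ∃ x ∈ φ.1.source, A.toCanonical φ x = z := by
  have h1 := (A.adapted φ).coord.map_source (x := z) hz
  have h2 : emb (rad ((A.adapted φ).coord z)) ∈ φ.1.target := h1
  have h3 : (A.adapted φ).coord z ∈ φ.1.target := by
    rw [← reg_phase ((A.adapted φ).coord z)]
    exact A.invariant_target φ φ.2 _ _ h2
  have h4 := φ.1.map_target h3
  refine ⟨_, h4, (A.adapted φ).coord.injOn (toCanonical_mem h4) hz ?_⟩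
  rw [coord_toCanonical h4, φ.1.right_inv h3]

/-- The local identifications with the canonical model are embeddings. -/
lemma tendsto_of_tendsto_toCanonical {Y : Type*} {l : Filter Y} {z : Y → M} {x : M} {φ : A.Chart}
    (hx : x ∈ φ.1.source) (hz : ∀ᶠ y in l, z y ∈ φ.1.source)
    (h : Tendsto (fun y => A.toCanonical φ (z y)) l (𝓝 (A.toCanonical φ x))) :
    Tendsto z l (𝓝 x) := by
  have h1 := ((A.adapted φ).coord.continuousAt (toCanonical_mem hx)).tendsto.comp h
  rw [coord_toCanonical hx] at h1
  have h2 := (φ.1.symm.continuousAt (φ.1.map_source hx)).tendsto.comp h1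
  rw [φ.1.left_inv hx] at h2
  refine h2.congr' ?_
  filter_upwards [hz] with y hy
  rw [Function.comp_apply, Function.comp_apply, coord_toCanonical hy, φ.1.left_inv hy]

/-- In the chart `ψ` the element `q` acts through `ρ(q)`, and the frame of `φ` is that of `ψ` moved
by `ρ`. The two effects cancel, so the formula involves only the frame of the chart that defines the
motion, whichever `h_ψ` is used. -/
lemma toCanonical_move {φ ψ : A.Chart} {x : M} (hx : x ∈ φ.1.source) (hx' : x ∈ ψ.1.source)
    (q : QTorus n) :
    A.toCanonical ψ (A.move φ q x) = lact (A.cframe φ (A.π x)) q (A.toCanonical ψ x) := by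
  have h1 := lact_act (X := A.charPair) (A.cframe ψ (A.π x)) (A.rho φ ψ) q (A.toCanonical ψ x)
  rw [act_cframe (π_mem_source.2 hx') (π_mem_source.2 hx)] at h1
  rw [h1]
  refine (A.adapted ψ).coord.injOn (toCanonical_mem (move_mem' hx hx' q)) ?_ ?_
  · have h2 := base_lact (X := A.charPair) (A.cframe ψ (A.π x)) (ev (A.rho φ ψ) q)
      (A.toCanonical ψ x)
    exact mem_preimage.2 (h2 ▸ toCanonical_mem hx')
  · rw [coord_toCanonical (move_mem' hx hx' q), chart_move' hx hx', ← coord_toCanonical hx']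
    exact ((A.adapted ψ).coord_lact (x := A.toCanonical ψ x) (toCanonical_mem hx') _).symm

lemma toCanonical_unitPoint {φ : A.Chart} {b : A.OrbitSpace} (h : b ∈ (A.baseChart φ).source) :
    A.toCanonical φ (A.unitPoint φ b) = ⟨b, 1⟩ := by
  rw [← theta_eq h]
  exact congrArg (Model.mk b) (A.eulerCocycle.θ_self (α := φ) h)

lemma exists_move_unitPoint {φ : A.Chart} {x : M} (hx : x ∈ φ.1.source) :
    ∃ q, A.move φ q (A.unitPoint φ (A.π x)) = x := by
  have hb := π_mem_source.2 hx
  obtain ⟨q, hq⟩ := exists_of_π_eq (π_unitPoint hb) (unitPoint_mem hb)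
  exact ⟨q, move_eq (unitPoint_mem hb) hx hq⟩

/-- At the unit point of the orbit this is the definition of `θ`. Both sides are compatible with
left multiplication, and every point of the orbit is a translate of the unit point. -/
lemma toCanonical_eq_rmul {φ ψ : A.Chart} {x : M} (hx : x ∈ φ.1.source) (hx' : x ∈ ψ.1.source) :
    A.toCanonical ψ x = rmul (A.toCanonical φ x) (A.theta φ ψ) := by
  have hb := π_mem_source.2 hx
  obtain ⟨q, hq⟩ := exists_move_unitPoint hx
  have h1 := toCanonical_move (unitPoint_mem hb)
    (mem_of_mem_base hb (π_mem_source.2 hx')) q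
  have h2 := toCanonical_move (unitPoint_mem hb) (unitPoint_mem hb) q
  rw [hq] at h1 h2
  rw [h1, h2, toCanonical_unitPoint hb, ← theta_eq hb, ← lact_rmul, rmul, one_mul]

/-! ### Isomorphisms of characteristic pairs given in charts -/

variable {B : Type u} [TopologicalSpace B] {C : Corners n B}

/-- A homeomorphism of the orbit space of a local action with `B`, together with a compatible
family of local frames over the domains of the charts, defines an isomorphism of characteristic
pairs. -/
lemma exists_iso (X : CharPair n C) (fB : A.OrbitSpace ≃ₜ B)
    (σ : A.Chart → A.OrbitSpace → X.P.Total)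
    (hσ : ∀ φ, ContinuousOn (σ φ) (A.baseChart φ).source)
    (hproj : ∀ φ, ∀ b ∈ (A.baseChart φ).source, X.P.proj (σ φ b) = fB b)
    (hact : ∀ φ ψ, ∀ b ∈ (A.baseChart φ).source, b ∈ (A.baseChart ψ).source →
      X.P.act (σ φ b) (A.rho ψ φ) = σ ψ b)
    (hstrata : ∀ k b, b ∈ A.corners.stratum k ↔ fB b ∈ C.stratum k)
    (hL : ∀ φ, ∀ b ∈ (A.baseChart φ).source, b ∈ A.corners.stratum 1 → ∀ i,
      A.baseChart φ b i = 0 → inFrame X.P X.L (σ φ b) =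
        (AddSubgroup.zmultiples (Pi.single i 1 : Lattice n) : Set (Lattice n))) :
    ∃ F : CharPair.Iso A.charPair X, F.fB = fB ∧
      ∀ φ, ∀ b ∈ (A.baseChart φ).source, F.fP (A.cframe φ b) = σ φ b := by
  -- `P_M` stores a point over `b` by its group component in the trivialization of `indexAt b`, so
  -- `G` is written with the frame of that chart; `hact` then gives the right value on the frames of
  -- all charts.
  let τ : A.OrbitSpace → X.P.Total := fun b => σ (A.bundleCore.indexAt b) b
  have hτ : ∀ b, X.P.proj (τ b) = fB b := fun b => hproj _ b (A.bundleCore.mem_baseSet_at b)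
  let G : A.charPair.P.Total → X.P.Total := fun p =>
    X.P.act (τ (A.charPair.P.proj p)) (A.component p)
  have hGproj : ∀ p, X.P.proj (G p) = fB (A.charPair.P.proj p) := fun p =>
    (X.P.proj_act _ _).trans (hτ _)
  have hGact : ∀ p g, G (A.charPair.P.act p g) = X.P.act (G p) g := fun p g =>
    X.P.act_mul _ _ _
  have hGframe : ∀ φ, ∀ b ∈ (A.baseChart φ).source, G (A.cframe φ b) = σ φ b := fun φ b hb =>
    hact _ _ b (A.bundleCore.mem_baseSet_at b) hb
  have hbij : Function.Bijective G := by
    constructor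
    · intro p p' h
      have h1 : A.charPair.P.proj p = A.charPair.P.proj p' := fB.injective (by
        rw [← hGproj, h, hGproj])
      obtain ⟨g, rfl, -⟩ := A.charPair.P.existsUnique_act h1
      rw [hGact] at h
      have : (1 : QAut n) = g := act_left_cancel ((X.P.act_one _).trans h)
      rw [← this, A.charPair.P.act_one]
    · intro p
      obtain ⟨b, hb⟩ := fB.surjective (X.P.proj p)
      obtain ⟨φ, hφ⟩ := exists_chart b
      obtain ⟨g, hg, -⟩ := X.P.existsUnique_act ((hproj φ b hφ).trans hb)
      exact ⟨A.charPair.P.act (A.cframe φ b) g, by rw [hGact, hGframe φ b hφ, hg]⟩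
  let E : A.charPair.P.Total ≃ X.P.Total := Equiv.ofBijective G hbij
  have hEs : ∀ φ, ∀ b ∈ (A.baseChart φ).source, E.symm (σ φ b) = A.cframe φ b := fun φ b hb => by
    rw [Equiv.symm_apply_eq]; exact (hGframe φ b hb).symm
  have hc1 : Continuous G := by
    refine continuous_of_sectionOn hGact fun b => ?_
    obtain ⟨φ, hφ⟩ := exists_chart b
    have hU := (A.baseChart φ).open_source.mem_nhds hφ
    refine ⟨_, A.cframe φ, hU, sectionOn_cframe φ, ((hσ φ).continuousAt hU).congr ?_⟩
    filter_upwards [hU] with b' hb' using (hGframe φ b' hb').symm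
  -- The inverse carries the local sections `σ φ`, transported to `B`, to the continuous frames of
  -- the charts.
  have hc2 : Continuous E.symm := by
    refine continuous_of_sectionOn (fun p g => ?_) fun b => ?_
    · rw [Equiv.symm_apply_eq]
      exact ((hGact _ _).trans (congrArg (fun p => X.P.act p g) (E.apply_symm_apply p))).symm
    · obtain ⟨φ, hφ⟩ := exists_chart (fB.symm b)
      have hO : IsOpen (fB.symm ⁻¹' (A.baseChart φ).source) :=
        (A.baseChart φ).open_source.preimage fB.symm.continuous
      refine ⟨_, fun b => σ φ (fB.symm b), hO.mem_nhds hφ, ⟨(hσ φ).comp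
        fB.symm.continuous.continuousOn fun _ h => h, fun b' hb' => ?_⟩, ?_⟩
      · rw [hproj φ _ hb', fB.apply_symm_apply]
      · have h1 : ContinuousAt (fun b => A.cframe φ (fB.symm b)) b :=
          ContinuousAt.comp (g := A.cframe φ)
            ((continuousOn_frame φ).continuousAt ((A.baseChart φ).open_source.mem_nhds hφ))
            fB.symm.continuous.continuousAt
        refine h1.congr ?_
        filter_upwards [hO.mem_nhds hφ] with b' hb' using (hEs φ _ hb').symm
  refine ⟨⟨fB, ⟨E, hc1, hc2⟩, hGproj, hGact, hstrata, fun p => ?_⟩, rfl, hGframe⟩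
  obtain ⟨φ, hφ⟩ := exists_chart (A.charPair.P.proj p)
  obtain ⟨g, hg, -⟩ := A.charPair.P.existsUnique_act
    (p := A.cframe φ (A.charPair.P.proj p)) (p' := p) rfl
  have key : inFrame A.charPair.P A.charPair.L (A.cframe φ (A.charPair.P.proj p)) =
      inFrame X.P X.L (σ φ (A.charPair.P.proj p)) := by
    by_cases hs : A.charPair.P.proj p ∈ A.corners.stratum 1
    · obtain ⟨i, hi⟩ := depth_eq_one_iff.1 (depth_eq hs hφ)
      rw [hL φ _ hφ hs i ((hi i).2 rfl)]
      exact inFrame_cframe hs hφ ((hi i).2 rfl)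
    · ext v
      refine ⟨fun h => absurd (base_mem_of_mem_inFrame h) hs, fun h => ?_⟩
      have h1 := base_mem_of_mem_inFrame h
      rw [hproj φ _ hφ, ← hstrata] at h1
      exact absurd h1 hs
  change _ = inFrame X.P X.L (G p)
  have h1 : G p = X.P.act (σ φ (A.charPair.P.proj p)) g := by
    rw [← hGframe φ _ hφ, ← hGact, hg]
  ext v
  rw [h1, inFrame_act, ← key]
  conv_lhs => rw [← hg]
  exact inFrame_act

/-- A family of local identifications of `M` with the canonical model of `X` which is equivariant
and whose overlap maps are given by a cocycle determines the Euler class. -/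
lemma pull_eq_eulerClass {X : CharPair n C} (F : CharPair.Iso A.charPair X) (c : X.Cocycle)
    (H : c.ι → M → X.Model)
    (hbase : ∀ α x, F.fB (A.π x) ∈ c.U α → (H α x).base = F.fB (A.π x))
    (hcont : ∀ α x, F.fB (A.π x) ∈ c.U α → ContinuousAt (H α) x)
    (hθ : ∀ α β x, F.fB (A.π x) ∈ c.U α → F.fB (A.π x) ∈ c.U β →
      H β x = rmul (H α x) (c.θ α β))
    (hmove : ∀ α (φ : A.Chart), ∀ x ∈ φ.1.source, F.fB (A.π x) ∈ c.U α → ∀ q,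
      H α (A.move φ q x) = lact (F.fP (A.cframe φ (A.π x))) q (H α x)) :
    F.pull (Quot.mk _ c) = A.eulerClass := by
  refine (Quot.sound ?_ : Quot.mk _ A.eulerCocycle = Quot.mk _ (F.pullCocycle c)).symm
  let W : A.Chart × c.ι → Set A.OrbitSpace := fun k =>
    (A.baseChart k.1).source ∩ F.fB ⁻¹' c.U k.2
  have hW : ∀ k, IsOpen (W k) := fun k =>
    (A.baseChart k.1).open_source.inter ((c.isOpen k.2).preimage F.fB.continuous)
  -- The 0-cochain compares the two identifications at the unit point, where `h_φ` takes the value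
  -- `1`.
  let g : A.Chart × c.ι → (b : A.OrbitSpace) → A.charPair.ModelFiber b := fun k b =>
    (F.modelPullTotal (H k.2 (A.unitPoint k.1 b))).valAt b
  have hmem : ∀ k, ∀ b ∈ W k, F.fB (A.π (A.unitPoint k.1 b)) ∈ c.U k.2 := fun k b hb => by
    rw [π_unitPoint hb.1]; exact hb.2
  have hg : ∀ k, ∀ b ∈ W k, (⟨b, g k b⟩ : A.charPair.Model) =
      F.modelPullTotal (H k.2 (A.unitPoint k.1 b)) := fun k b hb => by
    refine Model.mk_valAt ?_
    rw [F.base_modelPullTotal, hbase _ _ (hmem k b hb), π_unitPoint hb.1, F.fB.symm_apply_apply]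
  -- The comparison made at the unit point propagates along the orbit, because both identifications
  -- intertwine motions with left multiplication.
  have key : ∀ k x, A.π x ∈ W k →
      F.modelPullTotal (H k.2 x) = rmul (A.toCanonical k.1 x) (g k) := by
    intro k x hx
    have hxφ := π_mem_source.1 hx.1
    have hu := unitPoint_mem hx.1
    obtain ⟨q, hq⟩ := exists_move_unitPoint hxφ
    have h1 := hmove k.2 k.1 _ hu (hmem k _ hx) q
    have h2 := toCanonical_move hu hu q
    rw [hq, π_unitPoint hx.1] at h1 h2
    rw [h1, h2, F.modelPullTotal_lact _ _ (by rw [hbase _ _ (hmem k _ hx), π_unitPoint hx.1, proj_cframe]),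
      ← hg k _ hx, toCanonical_unitPoint hx.1, ← lact_rmul, rmul, one_mul]
  refine ⟨A.Chart × c.ι, W, Prod.fst, Prod.snd, g, hW, fun b => ?_, fun k => inter_subset_left,
    fun k => inter_subset_right, fun k b hb => ?_, fun k l b hb => ?_⟩
  · obtain ⟨φ, hφ⟩ := exists_chart b
    obtain ⟨α, hα⟩ := c.cover (F.fB b)
    exact ⟨(φ, α), hφ, hα⟩
  · refine ContinuousAt.continuousWithinAt ?_
    have hWb := (hW k).mem_nhds hb
    have h1 : ContinuousAt (fun b => F.modelPullTotal (H k.2 (A.unitPoint k.1 b))) b := by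
      refine F.continuous_modelPullTotal.continuousAt.comp ?_
      exact ContinuousAt.comp (g := H k.2) (hcont _ _ (hmem k b hb))
        ((continuousOn_unitPoint k.1).continuousAt ((A.baseChart k.1).open_source.mem_nhds hb.1))
    refine h1.congr ?_
    filter_upwards [hWb] with b' hb' using (hg k b' hb').symm
  · obtain ⟨hk, hl⟩ := hb
    have hπ := π_unitPoint hk.1
    -- Evaluated at the unit point of the first chart, `key` for the second index becomes `g_k ·
    -- F^*θ = θ_{φψ} · g_l`.
    have h1 := key l (A.unitPoint k.1 b) (by rwa [hπ])
    rw [hθ k.2 l.2 _ (hmem k b hk) (by rw [hπ]; exact hl.2), F.modelPullTotal_rmul, ← hg k b hk,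
      ← theta_eq hk.1] at h1
    have h2 : g k b * F.modelPull b (c.θ k.2 l.2 (F.fB b)) = A.theta k.1 l.1 b * g l b :=
      Model.ext_val h1
    change F.modelPull b (c.θ k.2 l.2 (F.fB b)) = (g k b)⁻¹ * A.theta k.1 l.1 b * g l b
    rw [mul_assoc, ← h2, inv_mul_cancel_left]

end LocalAction

end LocalQ

namespace LocalQ

open Set Topology Quaternion Filter

open PrincipalBundle CharPair

/-! ### From compatible Euler classes to an equivariant homeomorphism -/

namespace LocalAction

variable {n : ℕ} {M₁ M₂ : Type u} [TopologicalSpace M₁] [TopologicalSpace M₂]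
  {A₁ : LocalAction n M₁} {A₂ : LocalAction n M₂}

/-- An isomorphism of characteristic pairs compatible with the Euler classes is induced by an
equivariant homeomorphism. -/
theorem exists_isEquivariant [CompactSpace M₁] [T2Space M₂]
    (F : CharPair.Iso A₁.charPair A₂.charPair) (hF : F.pull A₂.eulerClass = A₁.eulerClass) :
    ∃ f : M₁ ≃ₜ M₂, IsEquivariant A₁ A₂ f := by
  obtain ⟨κ, W, r, r', g, hW, hcov, hr, hr', hg, hcoh⟩ :
      ∃ (κ : Type u) (W : κ → Set A₁.OrbitSpace) (r : κ → A₁.Chart) (r' : κ → A₂.Chart)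
        (g : κ → (b : A₁.OrbitSpace) → A₁.charPair.ModelFiber b),
        (∀ k, IsOpen (W k)) ∧ (∀ b, ∃ k, b ∈ W k) ∧ (∀ k, W k ⊆ (A₁.baseChart (r k)).source) ∧
        (∀ k, W k ⊆ F.fB ⁻¹' (A₂.baseChart (r' k)).source) ∧
        (∀ k, A₁.charPair.IsSection (W k) (g k)) ∧ ∀ k l, ∀ b ∈ W k ∩ W l,
          F.modelPull b (A₂.theta (r' k) (r' l) (F.fB b)) =
            (g k b)⁻¹ * A₁.theta (r k) (r l) b * g l b :=
    (h1_eq_iff.1 hF.symm :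
      A₁.charPair.Cohomologous A₁.eulerCocycle (F.pullCocycle A₂.eulerCocycle))
  -- The graph over `W k` of the map sought: its image in the model of `M₁` is `h(x)` corrected from
  -- the right by the 0-cochain.
  let R : κ → M₁ → M₂ → Prop := fun k x y => y ∈ (r' k).1.source ∧
    F.modelPullTotal (A₂.toCanonical (r' k) y) = rmul (A₁.toCanonical (r k) x) (g k)
  have hRπ : ∀ {k x y}, R k x y → A₂.π y = F.fB (A₁.π x) := fun {k x y} h => by
    have : F.fB.symm (A₂.π y) = A₁.π x := congrArg Model.base h.2
    rw [← this, F.fB.apply_symm_apply]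
  have hWr : ∀ {k x}, A₁.π x ∈ W k → x ∈ (r k).1.source := fun {k x} h =>
    π_mem_source.1 (hr k h)
  have hWr' : ∀ {k x y}, A₂.π y = F.fB (A₁.π x) → A₁.π x ∈ W k → y ∈ (r' k).1.source :=
    fun {k x y} h h' => π_mem_source.1 (h ▸ hr' k h')
  have hinj : Function.Injective F.modelPullTotal :=
    (show Function.LeftInverse F.symm.modelPullTotal F.modelPullTotal from
      F.symm_modelPullTotal).injective
  have hRex : ∀ k x, A₁.π x ∈ W k → ∃ y, R k x y := fun k x hx => by
    obtain ⟨y, hy, h⟩ := exists_toCanonical (A := A₂) (φ := r' k)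
      (z := F.symm.modelPullTotal (rmul (A₁.toCanonical (r k) x) (g k))) (hr' k hx)
    exact ⟨y, hy, by rw [h, F.modelPullTotal_symm]⟩
  have hRuniq : ∀ {k x y y'}, R k x y → R k x y' → y = y' := fun {k x y y'} h h' =>
    toCanonical_injOn (r' k) h.1 h'.1 (hinj (h.2.trans h'.2.symm))
  -- Independence of `k`: passing to `l` multiplies the two sides by the two Euler cocycles, and the
  -- coboundary relation says precisely that the results agree.
  have hRchange : ∀ {k l x y}, A₁.π x ∈ W k → A₁.π x ∈ W l → R k x y → R l x y := by
    intro k l x y hk hl h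
    have hyl := hWr' (hRπ h) hl
    refine ⟨hyl, ?_⟩
    rw [toCanonical_eq_rmul h.1 hyl, F.modelPullTotal_rmul, h.2,
      toCanonical_eq_rmul (hWr hk) (hWr hl), rmul_rmul, rmul_rmul]
    refine rmul_congr ?_
    rw [base_toCanonical, hcoh k l _ ⟨hk, hl⟩, ← mul_assoc, mul_inv_cancel_left]
  choose κ₀ hκ₀ using hcov
  choose f hf₀ using fun x => hRex _ x (hκ₀ (A₁.π x))
  have hf : ∀ {k x}, A₁.π x ∈ W k → R k x (f x) := fun {k x} hk =>
    hRchange (hκ₀ _) hk (hf₀ x)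
  have hπ : ∀ x, A₂.π (f x) = F.fB (A₁.π x) := fun x => hRπ (hf₀ x)
  have hfinj : Function.Injective f := by
    intro x x' h
    have h1 : A₁.π x = A₁.π x' := F.fB.injective (by rw [← hπ, ← hπ, h])
    have hk := hκ₀ (A₁.π x)
    have h2 := hf hk
    have h3 := hf (h1 ▸ hk : A₁.π x' ∈ W (κ₀ (A₁.π x)))
    rw [← h] at h3
    exact toCanonical_injOn _ (hWr hk) (hWr (h1 ▸ hk)) (rmul_injective (h2.2.symm.trans h3.2))
  have hfsurj : Function.Surjective f := by
    intro y
    have hk := hκ₀ (F.fB.symm (A₂.π y))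
    obtain ⟨x, hx, h⟩ := exists_toCanonical (A := A₁) (φ := r (κ₀ (F.fB.symm (A₂.π y))))
      (z := rmul (F.modelPullTotal (A₂.toCanonical (r' _) y)) fun b => (g _ b)⁻¹) (hr _ hk)
    have hx' : A₁.π x = F.fB.symm (A₂.π y) := congrArg Model.base h
    have hy : A₂.π y = F.fB (A₁.π x) := by rw [hx', F.fB.apply_symm_apply]
    have hkx : A₁.π x ∈ W (κ₀ (F.fB.symm (A₂.π y))) := by rw [hx']; exact hk
    refine ⟨x, hRuniq (hf hkx) ⟨hWr' hy hkx, ?_⟩⟩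
    rw [h, rmul_inv]
  have hfcont : Continuous f := by
    refine continuous_iff_continuousAt.2 fun x => ?_
    have hk := hκ₀ (A₁.π x)
    set k := κ₀ (A₁.π x)
    have hO : π A₁ ⁻¹' W k ∈ 𝓝 x := ((hW k).preimage continuous_π).mem_nhds hk
    refine tendsto_of_tendsto_toCanonical (hf hk).1 ?_ ?_ (φ := r' k)
    · filter_upwards [hO] with x' hx' using (hf hx').1
    · have key : ∀ x', A₁.π x' ∈ W k → A₂.toCanonical (r' k) (f x') =
          F.symm.modelPullTotal (rmul (A₁.toCanonical (r k) x') (g k)) := fun x' hx' => by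
        rw [← (hf hx').2, F.symm_modelPullTotal]
      have h1 : ContinuousAt (A₁.toCanonical (r k)) x :=
        (continuousOn_toCanonical (r k)).continuousAt ((r k).1.open_source.mem_nhds (hWr hk))
      have h2 : ContinuousAt (fun z => rmul z (g k)) (A₁.toCanonical (r k) x) :=
        continuousAt_rmul ((hg k).continuousAt ((hW k).mem_nhds hk))
      have h3 : ContinuousAt (fun x' => F.symm.modelPullTotal
          (rmul (A₁.toCanonical (r k) x') (g k))) x :=
        F.symm.continuous_modelPullTotal.continuousAt.comp
          (ContinuousAt.comp (g := fun z => rmul z (g k)) h2 h1)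
      rw [key x hk]
      refine h3.congr' ?_
      filter_upwards [hO] with x' hx' using (key x' hx').symm
  -- Left multiplication commutes with the correction by `g`, so `f` is equivariant with the
  -- automorphism `ρ` that moves the frame of `ψ` to the image of the frame of `φ`.
  have hmove : ∀ {φ : A₁.Chart} {ψ : A₂.Chart} {x ρ}, x ∈ φ.1.source → f x ∈ ψ.1.source →
      A₂.charPair.P.act (A₂.cframe ψ (A₂.π (f x))) ρ = F.fP (A₁.cframe φ (A₁.π x)) →
      ∀ q, f (A₁.move φ q x) = A₂.move ψ (ev ρ q) (f x) := by
    intro φ ψ x ρ hx hfx hρ q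
    have hk := hκ₀ (A₁.π x)
    have h1 := hf hk
    have hk' : A₁.π (A₁.move φ q x) ∈ W (κ₀ (A₁.π x)) := by rwa [π_move hx]
    refine hRuniq (hf hk') ⟨move_mem' hfx h1.1 _, ?_⟩
    rw [toCanonical_move hfx h1.1, ← lact_act, hρ, F.modelPullTotal_lact, h1.2, lact_rmul,
      toCanonical_move hx (hWr hk)]
    exact hπ x
  refine ⟨hfcont.homeoOfEquivCompactToT2 (f := Equiv.ofBijective f ⟨hfinj, hfsurj⟩), ?_⟩
  intro φ hφ ψ hψ
  change RegInvariant (φ '' (φ.source ∩ f ⁻¹' ψ.source)) ∧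
    RegInvariant (ψ '' (f '' φ.source ∩ ψ.source)) ∧
    ∀ x ∈ φ.source ∩ f ⁻¹' ψ.source, ∃ ρ : QAut n, ∃ V : Set M₁, IsOpen V ∧ x ∈ V ∧
      ∀ q : QTorus n, ∀ h ∈ φ '' (V ∩ φ.source ∩ f ⁻¹' ψ.source),
        ψ (f (φ.symm (reg q h))) = reg (ev ρ q) (ψ (f (φ.symm h)))
  refine ⟨?_, ?_, ?_⟩
  · rintro q _ ⟨x, ⟨hx, hfx⟩, rfl⟩
    refine ⟨A₁.move ⟨φ, hφ⟩ q x, ⟨move_mem (φ := ⟨φ, hφ⟩) hx q, ?_⟩, chart_move (φ := ⟨φ, hφ⟩) hx q⟩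
    refine mem_source_of_π_eq (φ := ⟨ψ, hψ⟩) (x := f x) ?_ hfx
    rw [hπ, hπ, π_move (φ := ⟨φ, hφ⟩) hx]
  · rintro q _ ⟨_, ⟨⟨x, hx, rfl⟩, hfx⟩, rfl⟩
    refine ⟨A₂.move ⟨ψ, hψ⟩ q (f x), ⟨?_, move_mem (φ := ⟨ψ, hψ⟩) hfx q⟩,
      chart_move (φ := ⟨ψ, hψ⟩) hfx q⟩
    obtain ⟨x', hx'⟩ := hfsurj (A₂.move ⟨ψ, hψ⟩ q (f x))
    refine ⟨x', mem_source_of_π_eq (φ := ⟨φ, hφ⟩) (x := x) (F.fB.injective ?_) hx, hx'⟩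
    rw [← hπ, ← hπ, hx', π_move (φ := ⟨ψ, hψ⟩) hfx]
  · rintro x ⟨hx, hfx⟩
    -- The frame of `φ`, transported by `f_P`, is a local section of the second bundle; the
    -- automorphism relating it to the frame of `ψ` is locally constant, which provides one `ρ` on a
    -- neighbourhood.
    let s : A₂.OrbitSpace → A₂.charPair.P.Total := fun b => F.fP (A₁.cframe ⟨φ, hφ⟩ (F.fB.symm b))
    have hO : IsOpen (F.fB.symm ⁻¹' (A₁.baseChart ⟨φ, hφ⟩).source) :=
      (A₁.baseChart ⟨φ, hφ⟩).open_source.preimage F.fB.symm.continuous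
    have hs : A₂.charPair.P.SectionOn s (F.fB.symm ⁻¹' (A₁.baseChart ⟨φ, hφ⟩).source) := by
      refine ⟨F.fP.continuous.comp_continuousOn ((continuousOn_frame _).comp
        F.fB.symm.continuous.continuousOn fun _ h => h), fun b _ => ?_⟩
      exact (F.proj_fP _).trans (F.fB.apply_symm_apply b)
    have h1 : A₂.π (f x) ∈ F.fB.symm ⁻¹' (A₁.baseChart ⟨φ, hφ⟩).source := by
      rw [mem_preimage, hπ, F.fB.symm_apply_apply]
      exact π_mem_source.2 hx
    have h2 : A₂.π (f x) ∈ (A₂.baseChart ⟨ψ, hψ⟩).source := π_mem_source.2 hfx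
    obtain ⟨ρ, hρ⟩ := (sectionOn_cframe ⟨ψ, hψ⟩).exists_act hs h2 h1
    obtain ⟨N, hN, hNo, hxN⟩ := eventually_nhds_iff.1 ((sectionOn_cframe ⟨ψ, hψ⟩).eventually_eq hs
      ((A₂.baseChart ⟨ψ, hψ⟩).open_source.mem_nhds h2) (hO.mem_nhds h1) hρ)
    refine ⟨ρ, (fun x => A₂.π (f x)) ⁻¹' N, hNo.preimage (continuous_π.comp hfcont), hxN, ?_⟩
    rintro q _ ⟨x', ⟨⟨hx'N, hx'⟩, hfx'⟩, rfl⟩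
    have h3 := hN _ hx'N
    simp only [s, hπ, F.fB.symm_apply_apply] at h3
    rw [← hπ] at h3
    have h4 := hmove (φ := ⟨φ, hφ⟩) (ψ := ⟨ψ, hψ⟩) hx' hfx' h3 q
    rw [move] at h4
    rw [φ.left_inv hx']
    rw [h4]
    exact chart_move (φ := ⟨ψ, hψ⟩) hfx' _

end LocalAction

end LocalQ

namespace LocalQ

open Set Topology Quaternion Filter

open PrincipalBundle CharPair

/-! ### From an equivariant homeomorphism to an isomorphism of characteristic pairs -/

lemma ev_surjective {n : ℕ} (g : QAut n) : Function.Surjective (ev g) := g.1.surjective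

lemma reg_mulSingle_eq_self_iff {n : ℕ} {i : Fin n} {q : Q} {h : HSpace n} (hq : q ≠ 1) :
    reg (Pi.mulSingle i q) h = h ↔ h i = 0 := by
  refine ⟨fun he => ?_, fun he => ?_⟩
  · by_contra hne
    have h1 := reg_cancel (q' := 1) hne (by rw [he, reg_one])
    rw [Pi.mulSingle_eq_same] at h1
    exact hq h1
  · ext1 j
    by_cases hj : j = i
    · subst hj; simp only [reg, he, mul_zero]
    · simp [reg, Pi.mulSingle_eq_of_ne hj]

namespace LocalAction

variable {n : ℕ} {M₁ M₂ : Type u} [TopologicalSpace M₁] [TopologicalSpace M₂]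
  {A₁ : LocalAction n M₁} {A₂ : LocalAction n M₂} {f : M₁ ≃ₜ M₂}

lemma move_move {M : Type u} [TopologicalSpace M] {A : LocalAction n M} {φ : A.Chart} {x : M}
    (hx : x ∈ φ.1.source) (q r : QTorus n) :
    A.move φ q (A.move φ r x) = A.move φ (q * r) x := by
  rw [move, chart_move hx, ← reg_mul]; rfl

lemma mem_of_isEquivariant (hf : IsEquivariant A₁ A₂ f) {φ : A₁.Chart} {ψ : A₂.Chart} {x : M₁}
    (hx : x ∈ φ.1.source) (hx' : f x ∈ ψ.1.source) (q : QTorus n) :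
    f (A₁.move φ q x) ∈ ψ.1.source := by
  obtain ⟨y, ⟨hy, hy'⟩, h⟩ := (hf φ φ.2 ψ ψ.2).1 q _ ⟨x, ⟨hx, hx'⟩, rfl⟩
  rw [move, ← h, φ.1.left_inv hy]
  exact hy'

/-- The set `V` in `IsEquivariant` need not be invariant. Any `y` in an orbit that meets it is a
translate of some `z` in it, and equivariance at `y` follows from that at `z` because `ρ` is
multiplicative. -/
lemma exists_local_rho (hf : IsEquivariant A₁ A₂ f) {φ : A₁.Chart} {ψ : A₂.Chart} {x : M₁}
    (hx : x ∈ φ.1.source) (hx' : f x ∈ ψ.1.source) :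
    ∃ ρ : QAut n, ∀ᶠ b in 𝓝 (A₁.π x), ∀ y, A₁.π y = b → y ∈ φ.1.source ∧ f y ∈ ψ.1.source ∧
      ∀ q, f (A₁.move φ q y) = A₂.move ψ (ev ρ q) (f y) := by
  obtain ⟨ρ, V, hV, hxV, h⟩ := (hf φ φ.2 ψ ψ.2).2.2 x ⟨hx, hx'⟩
  have hO : IsOpen (V ∩ φ.1.source ∩ f ⁻¹' ψ.1.source) :=
    (hV.inter φ.1.open_source).inter (ψ.1.open_source.preimage f.continuous)
  refine ⟨ρ, ?_⟩
  filter_upwards [(isOpenMap_π _ hO).mem_nhds ⟨x, ⟨⟨hxV, hx⟩, hx'⟩, rfl⟩]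
  rintro _ ⟨z, ⟨⟨hzV, hz⟩, hz'⟩, rfl⟩ y hy
  obtain ⟨r, hr⟩ := exists_of_π_eq hy.symm hz
  have hyz : A₁.move φ r z = y := move_eq hz (mem_source_of_π_eq hy.symm hz) hr
  have key : ∀ q, f (A₁.move φ q z) = A₂.move ψ (ev ρ q) (f z) := fun q => by
    have h1 := h q _ ⟨z, ⟨⟨hzV, hz⟩, hz'⟩, rfl⟩
    rw [φ.1.left_inv hz] at h1
    exact (move_eq hz' (mem_of_isEquivariant hf hz hz' q) h1).symm
  subst hyz
  refine ⟨move_mem hz r, mem_of_isEquivariant hf hz hz' r, fun q => ?_⟩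
  rw [move_move hz, key, key, move_move hz', ev_map_mul]

lemma π_eq_of_isEquivariant (hf : IsEquivariant A₁ A₂ f) {x y : M₁} :
    A₂.π (f x) = A₂.π (f y) ↔ A₁.π x = A₁.π y := by
  obtain ⟨φ, hφ⟩ := exists_chart (A₁.π x)
  obtain ⟨ψ, hψ⟩ := exists_chart (A₂.π (f x))
  rw [π_mem_source] at hφ hψ
  obtain ⟨ρ, hρ⟩ := exists_local_rho hf hφ hψ
  have h1 := (hρ.self_of_nhds x rfl).2.2
  constructor
  · intro h
    obtain ⟨q, hq⟩ := exists_of_π_eq h hψ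
    obtain ⟨q', rfl⟩ := ev_surjective ρ q
    have h2 : f (A₁.move φ q' x) = f y := by
      rw [h1]; exact move_eq hψ (mem_source_of_π_eq h hψ) hq
    rw [← f.injective h2, π_move hφ]
  · intro h
    obtain ⟨q, hq⟩ := exists_of_π_eq h hφ
    rw [← move_eq hφ (mem_source_of_π_eq h hφ) hq, h1, π_move hψ]

/-- The homeomorphism of orbit spaces induced by an equivariant homeomorphism. -/
def orbitHomeo (hf : IsEquivariant A₁ A₂ f) : A₁.OrbitSpace ≃ₜ A₂.OrbitSpace where
  toFun := Quotient.lift (fun x => A₂.π (f x)) fun _ _ h =>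
    (π_eq_of_isEquivariant hf).2 (Quotient.sound h)
  invFun := Quotient.lift (fun y => A₁.π (f.symm y)) fun x y h => by
    rw [← π_eq_of_isEquivariant hf, f.apply_symm_apply, f.apply_symm_apply]
    exact Quotient.sound h
  left_inv b := by
    obtain ⟨x, rfl⟩ := π_surjective b
    exact congrArg A₁.π (f.symm_apply_apply x)
  right_inv b := by
    obtain ⟨x, rfl⟩ := π_surjective b
    exact congrArg A₂.π (f.apply_symm_apply x)
  continuous_toFun := isQuotientMap_π.continuous_iff.2 (continuous_π.comp f.continuous)
  continuous_invFun := isQuotientMap_π.continuous_iff.2 (continuous_π.comp f.symm.continuous)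

lemma orbitHomeo_π (hf : IsEquivariant A₁ A₂ f) (x : M₁) :
    orbitHomeo hf (A₁.π x) = A₂.π (f x) := rfl

/-- In the charts `φ` and `ψ`, the homeomorphism `f` is `ρ`-equivariant near the orbit `b`. -/
def EquivariantAt (f : M₁ ≃ₜ M₂) (φ : A₁.Chart) (ψ : A₂.Chart) (b : A₁.OrbitSpace)
    (ρ : QAut n) : Prop :=
  ∀ᶠ b' in 𝓝 b, ∀ y, A₁.π y = b' → y ∈ φ.1.source ∧ f y ∈ ψ.1.source ∧
    ∀ q, f (A₁.move φ q y) = A₂.move ψ (ev ρ q) (f y)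

/-- The open set of validity contains points with no vanishing coordinate, at which the action is
free (`rho_unique`). -/
lemma EquivariantAt.unique {φ : A₁.Chart} {ψ : A₂.Chart} {b : A₁.OrbitSpace} {ρ ρ' : QAut n}
    (h : EquivariantAt f φ ψ b ρ) (h' : EquivariantAt f φ ψ b ρ') : ρ = ρ' := by
  obtain ⟨N, hN, hNo, hbN⟩ := eventually_nhds_iff.1 (h.and h')
  have hW : IsOpen (f.symm ⁻¹' (A₁.π ⁻¹' N)) :=
    (hNo.preimage continuous_π).preimage f.symm.continuous
  have hN' : ∀ y ∈ f.symm ⁻¹' (A₁.π ⁻¹' N), y ∈ ψ.1.source ∧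
      ∀ q, A₂.move ψ (ev ρ q) y = A₂.move ψ (ev ρ' q) y := fun y hy => by
    have h1 := (hN _ hy).1 _ rfl
    have h2 := (hN _ hy).2 _ rfl
    rw [f.apply_symm_apply] at h1 h2
    exact ⟨h1.2.1, fun q => by rw [← h1.2.2, ← h2.2.2]⟩
  refine rho_unique (ψ := ψ) hW (fun y hy => (hN' y hy).1) ?_ fun y hy q => ?_
  · obtain ⟨x, rfl⟩ := π_surjective b
    exact ⟨f x, by rw [mem_preimage, f.symm_apply_apply]; exact hbN⟩
  · rw [← chart_move (hN' y hy).1, (hN' y hy).2, chart_move (hN' y hy).1]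

lemma EquivariantAt.change {φ φ' : A₁.Chart} {ψ ψ' : A₂.Chart} {b : A₁.OrbitSpace} {ρ : QAut n}
    (hf : IsEquivariant A₁ A₂ f) (h : EquivariantAt f φ ψ b ρ)
    (hφ' : b ∈ (A₁.baseChart φ').source) (hψ' : orbitHomeo hf b ∈ (A₂.baseChart ψ').source) :
    EquivariantAt f φ' ψ' b (A₂.rho ψ ψ' * ρ * A₁.rho φ' φ) := by
  filter_upwards [h, (A₁.baseChart φ').open_source.mem_nhds hφ',
    ((A₂.baseChart ψ').open_source.preimage (orbitHomeo hf).continuous).mem_nhds hψ']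
    with b' h1 h2 h3
  rintro y rfl
  obtain ⟨hy, hfy, hq⟩ := h1 y rfl
  have hy' := π_mem_source.1 h2
  have hfy' : f y ∈ ψ'.1.source := π_mem_source.1 h3
  refine ⟨hy', hfy', fun q => ?_⟩
  have e1 : A₁.move φ' q y = A₁.move φ (ev (A₁.rho φ' φ) q) y :=
    (move_eq hy (move_mem' hy' hy q) (chart_move' hy' hy q)).symm
  have e2 : ∀ q, A₂.move ψ q (f y) = A₂.move ψ' (ev (A₂.rho ψ ψ') q) (f y) := fun q =>
    (move_eq hfy' (move_mem' hfy hfy' q) (chart_move' hfy hfy' q)).symm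
  rw [e1, hq, e2, ev_mul, ev_mul]

/-- A coordinate vanishes exactly when the corresponding factor fixes the point. As `f` is injective
and `ρ`-equivariant, `ρ` carries the factors fixing `x` to those fixing `f x`. -/
lemma EquivariantAt.zero_iff {φ : A₁.Chart} {ψ : A₂.Chart} {b : A₁.OrbitSpace} {ρ : QAut n}
    (hf : IsEquivariant A₁ A₂ f) (h : EquivariantAt f φ ψ b ρ) (i : Fin n) :
    A₂.baseChart ψ (orbitHomeo hf b) (perm n ρ i) = 0 ↔ A₁.baseChart φ b i = 0 := by
  obtain ⟨x, rfl⟩ := π_surjective b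
  obtain ⟨hx, hfx, hq⟩ := h.self_of_nhds x rfl
  rw [orbitHomeo_π, baseChart_π hx, baseChart_π hfx, rad_eq_zero, rad_eq_zero]
  obtain ⟨q, hne⟩ := exists_Q_ne_one
  obtain ⟨q', hq'⟩ : ∃ q', ev ρ (Pi.mulSingle i q) = Pi.mulSingle (perm n ρ i) q' :=
    ⟨_, ev_mulSingle ρ i q⟩
  have hne' : q' ≠ 1 := fun hc => by
    rw [hc, Pi.mulSingle_one, ← ev_map_one ρ] at hq'
    exact hne (Pi.mulSingle_eq_one_iff.1 (ev_injective ρ hq'))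
  rw [← reg_mulSingle_eq_self_iff hne', ← reg_mulSingle_eq_self_iff (i := i) hne, ← hq', ← chart_move hx,
    ← chart_move hfx, ← hq]
  constructor
  · intro h1
    have h2 : f (A₁.move φ (Pi.mulSingle i q) x) = f x :=
      ψ.1.injOn (mem_of_isEquivariant hf hx hfx _) hfx h1
    rw [f.injective h2]
  · intro h1
    rw [φ.1.injOn (move_mem hx _) hx h1]

lemma EquivariantAt.depth_eq {φ : A₁.Chart} {ψ : A₂.Chart} {b : A₁.OrbitSpace} {ρ : QAut n}
    (hf : IsEquivariant A₁ A₂ f) (h : EquivariantAt f φ ψ b ρ) :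
    depth (A₂.baseChart ψ (orbitHomeo hf b)) = depth (A₁.baseChart φ b) := by
  have : {i | A₂.baseChart ψ (orbitHomeo hf b) i = 0} =
      perm n ρ '' {i | A₁.baseChart φ b i = 0} := by
    ext j
    obtain ⟨i, rfl⟩ := (perm n ρ).surjective j
    rw [(perm n ρ).injective.mem_set_image]
    exact h.zero_iff hf i
  rw [depth, depth, this, ncard_image_of_injective _ (perm n ρ).injective]

/-- An equivariant homeomorphism induces an isomorphism of characteristic pairs that is compatible
with the Euler classes. -/
theorem exists_iso_of_isEquivariant (hf : IsEquivariant A₁ A₂ f) :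
    ∃ F : CharPair.Iso A₁.charPair A₂.charPair, F.pull A₂.eulerClass = A₁.eulerClass := by
  -- Placing the hypotheses under the existential quantifier lets `choose` produce a total function
  -- `R`; outside the overlap its value is irrelevant.
  have hex : ∀ (φ : A₁.Chart) (ψ : A₂.Chart) (b : A₁.OrbitSpace), ∃ ρ,
      b ∈ (A₁.baseChart φ).source → orbitHomeo hf b ∈ (A₂.baseChart ψ).source →
      EquivariantAt f φ ψ b ρ := by
    intro φ ψ b
    by_cases h : b ∈ (A₁.baseChart φ).source ∧ orbitHomeo hf b ∈ (A₂.baseChart ψ).source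
    · obtain ⟨x, rfl⟩ := π_surjective b
      obtain ⟨ρ, hρ⟩ := exists_local_rho hf (π_mem_source.1 h.1) (π_mem_source.1 h.2)
      exact ⟨ρ, fun _ _ => hρ⟩
    · exact ⟨1, fun h1 h2 => absurd ⟨h1, h2⟩ h⟩
  choose R hR using hex
  choose ψ₀ hψ₀ using fun b : A₂.OrbitSpace => exists_chart b
  -- Where `f` is `ρ`-equivariant, acting by `q` in the frame of `φ` is acting by `ρ(q)` in that of
  -- `ψ`, that is, by `q` in the frame of `ψ` moved by `ρ`. This is the required image of the frame
  -- of `φ`; by `hσ` it does not depend on `ψ`.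
  let σ : A₁.Chart → A₁.OrbitSpace → A₂.charPair.P.Total := fun φ b =>
    A₂.charPair.P.act (A₂.cframe (ψ₀ (orbitHomeo hf b)) (orbitHomeo hf b))
      (R φ (ψ₀ (orbitHomeo hf b)) b)
  have hσ : ∀ {φ ψ b}, b ∈ (A₁.baseChart φ).source → orbitHomeo hf b ∈ (A₂.baseChart ψ).source →
      σ φ b = A₂.charPair.P.act (A₂.cframe ψ (orbitHomeo hf b)) (R φ ψ b) := by
    intro φ ψ b h h'
    have h0 := hψ₀ (orbitHomeo hf b)
    have h1 := (hR φ _ b h h0).change hf h h'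
    rw [rho_self_base h, mul_one] at h1
    rw [(hR φ ψ b h h').unique h1, A₂.charPair.P.act_mul, act_cframe h' h0]
  have hconst : ∀ {φ ψ b}, b ∈ (A₁.baseChart φ).source →
      orbitHomeo hf b ∈ (A₂.baseChart ψ).source → ∀ᶠ b' in 𝓝 b,
      σ φ b' = A₂.charPair.P.act (A₂.cframe ψ (orbitHomeo hf b')) (R φ ψ b) := by
    intro φ ψ b h h'
    filter_upwards [(hR φ ψ b h h').eventually_nhds, (A₁.baseChart φ).open_source.mem_nhds h,
      ((A₂.baseChart ψ).open_source.preimage (orbitHomeo hf).continuous).mem_nhds h']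
      with b' h1 h2 h3
    rw [hσ h2 h3, (hR φ ψ b' h2 h3).unique h1]
  obtain ⟨F, hFB, hFP⟩ := exists_iso A₂.charPair (orbitHomeo hf) σ
    (fun φ b hb => by
      have h' := hψ₀ (orbitHomeo hf b)
      refine (ContinuousAt.congr ?_ ((hconst hb h').mono fun _ h => h.symm)).continuousWithinAt
      refine (A₂.charPair.P.continuous_act _).continuousAt.comp ?_
      exact ContinuousAt.comp (g := A₂.cframe (ψ₀ (orbitHomeo hf b)))
        ((sectionOn_cframe _).1.continuousAt ((A₂.baseChart _).open_source.mem_nhds h'))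
        (orbitHomeo hf).continuous.continuousAt)
    (fun φ b _ => A₂.charPair.P.proj_act _ _)
    (fun φ φ' b hb hb' => by
      have h' := hψ₀ (orbitHomeo hf b)
      have h1 := (hR φ _ b hb h').change hf hb' h'
      rw [rho_self_base h', one_mul] at h1
      rw [hσ hb h', hσ hb' h', (hR φ' _ b hb' h').unique h1, A₂.charPair.P.act_mul])
    (fun k b => by
      obtain ⟨φ, hb⟩ := exists_chart b
      have h' := hψ₀ (orbitHomeo hf b)
      have h1 := (hR φ _ b hb h').depth_eq hf
      have h2 := mem_stratum hb
      have h3 := mem_stratum h'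
      rw [h1] at h3
      exact ⟨fun h => A₁.corners.stratum_unique h h2 ▸ h3,
        fun h => A₂.corners.stratum_unique h h3 ▸ h2⟩)
    (fun φ b hb hs i hi => by
      have h' := hψ₀ (orbitHomeo hf b)
      have h1 := hR φ _ b hb h'
      rw [hσ hb h']
      refine inFrame_act_eq (inFrame_cframe ?_ h' ((h1.zero_iff hf i).2 hi))
      have h2 := mem_stratum h'
      rwa [h1.depth_eq hf, LocalAction.depth_eq hs hb] at h2)
  -- The identifications `h_ψ ∘ f` have the Euler cocycle of `M₂` as transition cocycle.
  refine ⟨F, pull_eq_eulerClass F A₂.eulerCocycle (fun (ψ : A₂.Chart) x => A₂.toCanonical ψ (f x))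
    ?_ ?_ ?_ ?_⟩
  · intro ψ x _
    rw [hFB]; rfl
  · intro ψ x hx
    rw [hFB] at hx
    exact ContinuousAt.comp (g := A₂.toCanonical ψ) ((continuousOn_toCanonical ψ).continuousAt
      (ψ.1.open_source.mem_nhds (π_mem_source.1 hx))) f.continuous.continuousAt
  · intro ψ ψ' x hx hx'
    rw [hFB] at hx hx'
    exact toCanonical_eq_rmul (π_mem_source.1 hx) (π_mem_source.1 hx')
  · intro ψ φ x hx hψ q
    rw [hFB] at hψ
    have hb := π_mem_source.2 hx
    have hfx := π_mem_source.1 hψ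
    rw [hFP φ _ hb, hσ hb hψ, lact_act, (((hR φ ψ _ hb hψ).self_of_nhds x rfl).2.2 q)]
    exact toCanonical_move hfx hfx _

end LocalAction

end LocalQ

namespace LocalQ

open Set Topology Quaternion Filter

open PrincipalBundle CharPair

/-! ### Gluing copies of the canonical model along a cocycle -/

/-- Over a connected set, two sections of `P` differ by a constant. -/
lemma PrincipalBundle.SectionOn.act_eq_of_isPreconnected {n : ℕ} {B : Type u} [TopologicalSpace B]
    {P : PrincipalBundle n B} {s s' : B → P.Total} {U U' V : Set B} (hs : P.SectionOn s U)
    (hs' : P.SectionOn s' U') (hU : IsOpen U) (hU' : IsOpen U') (hV : IsPreconnected V)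
    (hVU : V ⊆ U) (hVU' : V ⊆ U') {b : B} (hb : b ∈ V) {g : QAut n} (hg : P.act (s b) g = s' b) :
    ∀ b' ∈ V, P.act (s b') g = s' b' := by
  intro b' hb'
  -- Near `x` a single `g₀` relates the two sections, so at `x` and at every nearby `y` the
  -- condition just says `g = g₀`.
  refine (hV.induction₂ (fun x y => P.act (s x) g = s' x ↔ P.act (s y) g = s' y) (fun x hx => ?_)
    (fun _ _ _ _ _ _ h h' => h.trans h') (fun _ _ _ _ h => h.symm) hb hb').1 hg
  obtain ⟨g₀, hg₀⟩ := hs.exists_act hs' (hVU hx) (hVU' hx)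
  filter_upwards [nhdsWithin_le_nhds (hs.eventually_eq hs' (hU.mem_nhds (hVU hx))
    (hU'.mem_nhds (hVU' hx)) hg₀)] with y hy
  rw [← hg₀, ← hy]
  exact ⟨fun h => by rw [act_left_cancel h], fun h => by rw [act_left_cancel h]⟩

section

variable {n : ℕ} {B : Type u} [TopologicalSpace B] {C : Corners n B} {X : CharPair n C}

/-- A cover by adapted charts that is subordinate to the cover of a cocycle and for which the
frames differ by constants on the overlaps. -/
structure GluingData (c : X.Cocycle) where
  D : B → X.AdaptedChart
  α : B → c.ι
  mem : ∀ k, k ∈ (D k).e.source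
  subset : ∀ k, (D k).e.source ⊆ c.U (α k)
  isStratified : ∀ k, (D k).IsStratified
  ρ : B → B → QAut n
  act_ρ : ∀ k l b, b ∈ (D k).e.source → b ∈ (D l).e.source →
    X.P.act ((D l).s b) (ρ k l) = (D k).s b

/-- A local action needs one automorphism for each pair of charts, although an overlap may be
disconnected. If `δ` is a Lebesgue number of a cover by domains of sections of `P` and the chart
domains lie in balls of radius `δ / 2`, then two domains that meet lie in one `δ`-ball about a
common point, hence over a common section. As each domain is connected, its frame is a constant
translate of that section. -/
lemma nonempty_gluingData [CompactSpace B] [T2Space B] [SecondCountableTopology B]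
    (c : X.Cocycle) : Nonempty (GluingData c) := by
  let _ : MetricSpace B := TopologicalSpace.metrizableSpaceMetric B
  choose U s hU hbU hs using fun b => X.P.exists_sectionOn b
  obtain ⟨δ, hδ, hball⟩ := lebesgue_number_lemma_of_metric (isCompact_univ (X := B)) hU
    (fun b _ => mem_iUnion.2 ⟨b, hbU b⟩)
  choose α hα using c.cover
  have hex : ∀ b, ∃ D : X.AdaptedChart, b ∈ D.e.source ∧
      D.e.source ⊆ Metric.ball b (δ / 2) ∩ c.U (α b) ∧ IsPreconnected D.e.source ∧
      D.IsStratified := fun b =>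
    X.exists_adaptedChart b (inter_mem (Metric.ball_mem_nhds b (half_pos hδ))
      ((c.isOpen _).mem_nhds (hα b)))
  choose D hD hDs hDp hDst using hex
  have hρ : ∀ k l, ∃ ρ, ∀ b, b ∈ (D k).e.source → b ∈ (D l).e.source →
      X.P.act ((D l).s b) ρ = (D k).s b := by
    intro k l
    by_cases hne : ((D k).e.source ∩ (D l).e.source).Nonempty
    · obtain ⟨b, hk, hl⟩ := hne
      obtain ⟨i, hi⟩ := hball b (mem_univ b)
      have hsub : ∀ k, b ∈ (D k).e.source → (D k).e.source ⊆ U i := fun k hk b' hb' => by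
        refine hi ?_
        have h1 := Metric.mem_ball.1 (hDs k hb').1
        have h2 := Metric.mem_ball'.1 (hDs k hk).1
        rw [Metric.mem_ball]
        linarith [dist_triangle b' k b]
      have hconst : ∀ k, b ∈ (D k).e.source → ∃ g, ∀ b' ∈ (D k).e.source,
          X.P.act (s i b') g = (D k).s b' := fun k hk => by
        obtain ⟨g, hg⟩ := (hs i).exists_act (D k).sectionOn (hsub k hk hk) hk
        exact ⟨g, (hs i).act_eq_of_isPreconnected (D k).sectionOn (hU i) (D k).e.open_source
          (hDp k) (hsub k hk) subset_rfl hk hg⟩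
      obtain ⟨g, hg⟩ := hconst k hk
      obtain ⟨g', hg'⟩ := hconst l hl
      refine ⟨g'⁻¹ * g, fun b' hb hb' => ?_⟩
      rw [← hg' b' hb', ← hg b' hb, ← X.P.act_mul, mul_inv_cancel_left]
    · exact ⟨1, fun b h h' => absurd ⟨b, h, h'⟩ hne⟩
  choose ρ hρ using hρ
  exact ⟨⟨D, α, hD, fun k => (hDs k).trans inter_subset_right, hDst, ρ, hρ⟩⟩

/-- The space glued from copies of the canonical model by means of a cocycle. Over `b` it is a copy
of the fibre of the canonical model which belongs to some member of the cover that contains `b`. -/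
structure Glued {c : X.Cocycle} (G : GluingData c) where
  base : B
  val : X.ModelFiber base

namespace Glued

variable {c : X.Cocycle} {G : GluingData c}

/-- A member of the cover that contains `b`. -/
noncomputable def index (c : X.Cocycle) (b : B) : c.ι := (c.cover b).choose

lemma mem_index (b : B) : b ∈ c.U (index c b) := (c.cover b).choose_spec

/-- The identification of the glued space with the canonical model over `c.U α`. -/
noncomputable def toModel (α : c.ι) : Glued G ≃ X.Model where
  -- Multiplication by any element is bijective on each fibre, so this is an equivalence everywhere;
  -- it has meaning only over `c.U α`.
  toFun x := ⟨x.base, x.val * c.θ (index c x.base) α x.base⟩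
  invFun z := ⟨z.base, z.val * (c.θ (index c z.base) α z.base)⁻¹⟩
  left_inv x := congrArg (Glued.mk x.base) (mul_inv_cancel_right _ _)
  right_inv z := congrArg (Model.mk z.base) (inv_mul_cancel_right _ _)

lemma toModel_eq_rmul {α β : c.ι} {x : Glued G} (h : x.base ∈ c.U α) (h' : x.base ∈ c.U β) :
    toModel β x = rmul (toModel α x) (c.θ α β) := by
  refine congrArg (Model.mk x.base) ?_
  change _ = x.val * _ * c.θ α β x.base
  rw [mul_assoc, c.cocycle _ _ _ _ ⟨⟨mem_index _, h⟩, h'⟩]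

variable (G) in
/-- The charts of the glued space, before it is given a topology. -/
noncomputable def preChart (k : B) : PartialEquiv (Glued G) (HSpace n) :=
  (toModel (G.α k)).toPartialEquiv.trans (G.D k).coord.toPartialEquiv

lemma mem_preChart_source {k : B} {x : Glued G} :
    x ∈ (preChart G k).source ↔ x.base ∈ (G.D k).e.source :=
  ⟨fun h => h.2, fun h => ⟨mem_univ _, h⟩⟩

lemma preChart_target (k : B) : (preChart G k).target = (G.D k).coord.target := by
  rw [preChart, PartialEquiv.trans_target]
  exact inter_univ _

lemma preChart_trans_source (k l : B) :
    ((preChart G k).symm.trans (preChart G l)).source =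
      (G.D k).coord.target ∩ (G.D k).coord.symm ⁻¹' (Model.base ⁻¹' (G.D l).e.source) := by
  rw [PartialEquiv.trans_source, PartialEquiv.symm_source, preChart_target]
  ext h
  exact and_congr_right fun _ => mem_preChart_source

variable (G) in
/-- The atlas of the glued space. -/
noncomputable def core : ChartedSpaceCore (HSpace n) (Glued G) where
  atlas := range (preChart G)
  chartAt x := preChart G x.base
  mem_chart_source x := mem_preChart_source.2 (G.mem x.base)
  chart_mem_atlas x := ⟨x.base, rfl⟩
  open_source := by
    rintro _ _ ⟨k, rfl⟩ ⟨l, rfl⟩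
    rw [preChart_trans_source]
    exact (G.D k).coord.symm.isOpen_inter_preimage
      ((G.D l).e.open_source.preimage X.continuous_base)
  continuousOn_toFun := by
    rintro _ _ ⟨k, rfl⟩ ⟨l, rfl⟩ h hh
    rw [preChart_trans_source] at hh ⊢
    have hz : ((G.D k).coord.symm h).base ∈ (G.D k).e.source :=
      (G.D k).coord.map_target hh.1
    have hU : c.U (G.α k) ∩ c.U (G.α l) ∈ 𝓝 ((G.D k).coord.symm h).base :=
      ((c.isOpen _).inter (c.isOpen _)).mem_nhds ⟨G.subset k hz, G.subset l hh.2⟩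
    have h1 : ContinuousAt (fun z => rmul z (c.θ (G.α k) (G.α l))) ((G.D k).coord.symm h) :=
      continuousAt_rmul ((c.isSection _ _).continuousAt hU)
    have h2 : ContinuousAt (G.D l).coord
        (rmul ((G.D k).coord.symm h) (c.θ (G.α k) (G.α l))) :=
      (G.D l).coord.continuousAt hh.2
    have h3 : ContinuousAt (fun h => (G.D l).coord (rmul ((G.D k).coord.symm h)
        (c.θ (G.α k) (G.α l)))) h :=
      ContinuousAt.comp (g := (G.D l).coord) h2
        (ContinuousAt.comp (g := fun z => rmul z (c.θ (G.α k) (G.α l))) h1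
          ((G.D k).coord.symm.continuousAt hh.1))
    -- The overlap map is right multiplication by `θ`, read in the coordinates of two adapted
    -- charts.
    have key : ∀ h ∈ (G.D k).coord.target ∩
        (G.D k).coord.symm ⁻¹' (Model.base ⁻¹' (G.D l).e.source),
        ((preChart G k).symm.trans (preChart G l)) h = (G.D l).coord
          (rmul ((G.D k).coord.symm h) (c.θ (G.α k) (G.α l))) := fun h hh => by
      have h4 : ((G.D k).coord.symm h).base ∈ (G.D k).e.source := (G.D k).coord.map_target hh.1
      have h5 := toModel_eq_rmul (G := G) (x := (toModel (G.α k)).symm ((G.D k).coord.symm h))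
        (G.subset k h4) (G.subset l hh.2)
      rw [Equiv.apply_symm_apply] at h5
      exact congrArg (G.D l).coord h5
    exact h3.continuousWithinAt.congr (fun h hh => key h hh) (key h hh)

noncomputable instance : TopologicalSpace (Glued G) := (core G).toTopologicalSpace

variable (G) in
/-- The charts of the glued space. -/
noncomputable def chart (k : B) : OpenPartialHomeomorph (Glued G) (HSpace n) :=
  (core G).openPartialHomeomorph (preChart G k) ⟨k, rfl⟩

lemma mem_chart_source {k : B} {x : Glued G} :
    x ∈ (chart G k).source ↔ x.base ∈ (G.D k).e.source :=
  mem_preChart_source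

lemma mem_chart_target {k : B} {h : HSpace n} :
    h ∈ (chart G k).target ↔ rad h ∈ (G.D k).e.target := by
  change h ∈ (preChart G k).target ↔ _
  rw [preChart_target]
  exact Iff.rfl

lemma chart_apply (k : B) (x : Glued G) :
    chart G k x = (G.D k).coord (toModel (G.α k) x) := rfl

lemma chart_symm_apply (k : B) (h : HSpace n) :
    (chart G k).symm h = (toModel (G.α k)).symm ((G.D k).coord.symm h) := rfl

lemma rad_chart {k : B} {x : Glued G} (hx : x.base ∈ (G.D k).e.source) :
    rad (chart G k x) = (G.D k).e x.base :=
  (G.D k).rad_coord (x := toModel (G.α k) x) hx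

/-- For the member of the cover attached to a chart around `x` this is the definition of the chart;
any other `α` differs from it by right multiplication by a section. -/
lemma continuousAt_toModel {α : c.ι} {x : Glued G} (hx : x.base ∈ c.U α) :
    ContinuousAt (toModel α) x := by
  have hs : x ∈ (chart G x.base).source := mem_chart_source.2 (G.mem x.base)
  have hz : toModel (G.α x.base) x ∈ (G.D x.base).coord.source := mem_chart_source.1 hs
  have h1 : ContinuousAt (toModel (G.α x.base)) x := by
    have h2 := ((G.D x.base).coord.symm.continuousAt ((G.D x.base).coord.map_source hz)).tendsto
    rw [(G.D x.base).coord.left_inv hz] at h2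
    refine (h2.comp ((chart G x.base).continuousAt hs).tendsto).congr' ?_
    filter_upwards [(chart G x.base).open_source.mem_nhds hs] with y hy
    exact (G.D x.base).coord.left_inv (x := toModel _ y) (mem_chart_source.1 hy)
  have hbase : ContinuousAt (Glued.base : Glued G → B) x :=
    ContinuousAt.comp (g := Model.base) X.continuous_base.continuousAt h1
  have hU : c.U (G.α x.base) ∩ c.U α ∈ 𝓝 x.base :=
    ((c.isOpen _).inter (c.isOpen _)).mem_nhds ⟨G.subset _ (G.mem _), hx⟩
  have h3 : ContinuousAt (fun z => rmul z (c.θ (G.α x.base) α)) (toModel (G.α x.base) x) :=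
    continuousAt_rmul ((c.isSection _ _).continuousAt hU)
  refine (ContinuousAt.comp (g := fun z => rmul z (c.θ (G.α x.base) α)) h3 h1).congr ?_
  filter_upwards [hbase.eventually hU] with y hy
  exact (toModel_eq_rmul hy.1 hy.2).symm

lemma continuous_base : Continuous (Glued.base : Glued G → B) :=
  continuous_iff_continuousAt.2 fun x => ContinuousAt.comp (g := Model.base)
    X.continuous_base.continuousAt (continuousAt_toModel (mem_index x.base))

instance [T2Space B] : T2Space (Glued G) := by
  refine ⟨fun x y hxy => ?_⟩
  by_cases hb : x.base = y.base
  · have hx : x ∈ (chart G x.base).source := mem_chart_source.2 (G.mem x.base)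
    have hy : y ∈ (chart G x.base).source := mem_chart_source.2 (hb ▸ G.mem x.base)
    obtain ⟨u, v, hu, hv, hxu, hyv, huv⟩ := t2_separation fun h =>
      hxy ((chart G x.base).injOn hx hy h)
    exact ⟨_, _, (chart G x.base).isOpen_inter_preimage hu,
      (chart G x.base).isOpen_inter_preimage hv, ⟨hx, hxu⟩, ⟨hy, hyv⟩,
      (huv.preimage _).mono inter_subset_right inter_subset_right⟩
  · obtain ⟨u, v, hu, hv, hxu, hyv, huv⟩ := t2_separation hb
    exact ⟨_, _, hu.preimage continuous_base, hv.preimage continuous_base, hxu, hyv,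
      huv.preimage _⟩

/-- Over a compact part of a chart domain the space is the polar image of that part times `Qⁿ`,
hence compact, and finitely many such parts cover `B`. -/
instance [CompactSpace B] [T2Space B] : CompactSpace (Glued G) := by
  choose K hK hmem hsub using fun k =>
    exists_compact_subset (G.D k).e.open_source (G.mem k)
  have hrad : ∀ k, IsCompact (rad ⁻¹' ((G.D k).e '' K k) : Set (HSpace n)) := fun k => by
    have h1 : IsCompact ((fun x : Orthant n × QTorus n => reg x.2 (emb x.1)) ''
        (((G.D k).e '' K k) ×ˢ univ)) :=
      (((hK k).image_of_continuousOn ((G.D k).e.continuousOn.mono (hsub k))).prod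
        isCompact_univ).image (LocalAction.isQuotientMap_polar).continuous
    convert h1 using 1
    ext h
    constructor
    · exact fun hh => ⟨(rad h, phase h), ⟨hh, mem_univ _⟩, reg_phase h⟩
    · rintro ⟨⟨r, q⟩, ⟨hr, -⟩, rfl⟩
      change rad (reg q (emb r)) ∈ (G.D k).e '' K k
      rwa [rad_reg, rad_emb]
  have hc : ∀ k, IsCompact ((chart G k).symm '' (rad ⁻¹' ((G.D k).e '' K k))) := fun k => by
    refine (hrad k).image_of_continuousOn ((chart G k).continuousOn_symm.mono ?_)
    rintro h ⟨b, hb, hbh⟩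
    exact mem_chart_target.2 (hbh ▸ (G.D k).e.map_source (hsub k hb))
  obtain ⟨t, ht⟩ := isCompact_univ.elim_finite_subcover (fun k => interior (K k))
    (fun _ => isOpen_interior) fun b _ => mem_iUnion.2 ⟨b, hmem b⟩
  refine ⟨?_⟩
  have huniv : (univ : Set (Glued G)) =
      ⋃ k ∈ t, (chart G k).symm '' (rad ⁻¹' ((G.D k).e '' K k)) := by
    refine (eq_univ_of_forall fun x => ?_).symm
    obtain ⟨k, hk, hx⟩ := mem_iUnion₂.1 (ht (mem_univ x.base))
    have hxK := interior_subset hx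
    refine mem_iUnion₂.2 ⟨k, hk, chart G k x, ⟨x.base, hxK, ?_⟩, ?_⟩
    · rw [rad_chart (hsub k hxK)]
    · exact (chart G k).left_inv (mem_chart_source.2 (hsub k hxK))
  rw [huniv]
  exact t.isCompact_biUnion fun k _ => hc k

end Glued

end

end LocalQ

namespace LocalQ

open Set Topology Quaternion Filter

open PrincipalBundle CharPair

section

variable {n : ℕ} {B : Type u} [TopologicalSpace B] {C : Corners n B} {X : CharPair n C}

/-! ### The local action on the glued space and its invariants -/

namespace Glued

variable {c : X.Cocycle} {G : GluingData c}

/-- The point with coordinate `q · h` in a chart, where `h` is the coordinate of `x`. -/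
lemma toModel_chart_symm_reg {k : B} {x : Glued G} (hx : x.base ∈ (G.D k).e.source)
    (q : QTorus n) :
    toModel (G.α k) ((chart G k).symm (reg q (chart G k x))) =
      lact ((G.D k).s x.base) q (toModel (G.α k) x) := by
  have h1 : (lact ((G.D k).s x.base) q (toModel (G.α k) x)).base ∈ (G.D k).e.source := by
    rw [base_lact]; exact hx
  have h2 : reg q (chart G k x) =
      (G.D k).coord (lact ((G.D k).s x.base) q (toModel (G.α k) x)) :=
    ((G.D k).coord_lact (x := toModel (G.α k) x) hx q).symm
  rw [h2, chart_symm_apply, Equiv.apply_symm_apply]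
  exact (G.D k).coord.left_inv h1

lemma base_chart_symm_reg {k : B} {x : Glued G} (hx : x.base ∈ (G.D k).e.source)
    (q : QTorus n) : ((chart G k).symm (reg q (chart G k x))).base = x.base :=
  (congrArg Model.base (toModel_chart_symm_reg hx q)).trans (base_lact _ _ _)

/-- Passing from the member `G.α k` to `α` is a right multiplication, which commutes with the left
multiplication by `q`. -/
lemma toModel_chart_symm_reg' {k : B} {x : Glued G} (hx : x.base ∈ (G.D k).e.source) {α : c.ι}
    (hα : x.base ∈ c.U α) (q : QTorus n) :
    toModel α ((chart G k).symm (reg q (chart G k x))) =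
      lact ((G.D k).s x.base) q (toModel α x) := by
  have hb := base_chart_symm_reg hx q
  rw [toModel_eq_rmul (α := G.α k) (x := (chart G k).symm (reg q (chart G k x)))
    (hb ▸ G.subset k hx) (hb ▸ hα), toModel_chart_symm_reg hx,
    toModel_eq_rmul (x := x) (G.subset k hx) hα, lact_rmul]

lemma chart_chart_symm_reg {k l : B} {x : Glued G} (hx : x.base ∈ (G.D k).e.source)
    (hx' : x.base ∈ (G.D l).e.source) (q : QTorus n) :
    chart G l ((chart G k).symm (reg q (chart G k x))) = reg (ev (G.ρ k l) q) (chart G l x) := by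
  rw [chart_apply, toModel_chart_symm_reg' hx (G.subset l hx'), ← G.act_ρ k l _ hx hx', lact_act]
  exact (G.D l).coord_lact (x := toModel (G.α l) x) hx' _

variable (G) in
/-- The local action on the glued space. -/
noncomputable def localAction : LocalAction n (Glued G) where
  atlas := range (chart G)
  cover x := ⟨_, ⟨x.base, rfl⟩, mem_chart_source.2 (G.mem x.base)⟩
  invariant_target := by
    rintro _ ⟨k, rfl⟩ q h hh
    rw [mem_chart_target] at hh ⊢
    rwa [rad_reg]
  invariant_overlap := by
    rintro _ ⟨k, rfl⟩ _ ⟨l, rfl⟩ q _ ⟨x, ⟨hk, hl⟩, rfl⟩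
    have hb := base_chart_symm_reg (mem_chart_source.1 hk) q
    refine ⟨(chart G k).symm (reg q (chart G k x)), ⟨?_, ?_⟩, (chart G k).right_inv ?_⟩
    · rw [mem_chart_source, hb]; exact mem_chart_source.1 hk
    · rw [mem_chart_source, hb]; exact mem_chart_source.1 hl
    · rw [mem_chart_target, rad_reg]
      exact mem_chart_target.1 ((chart G k).map_source hk)
  equivariant := by
    rintro _ ⟨k, rfl⟩ _ ⟨l, rfl⟩
    refine ⟨G.ρ k l, ?_⟩
    rintro q _ ⟨x, ⟨hk, hl⟩, rfl⟩
    rw [(chart G k).left_inv hk]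
    exact chart_chart_symm_reg (mem_chart_source.1 hk) (mem_chart_source.1 hl) q

lemma exists_chart_eq (φ : (localAction G).Chart) : ∃ k, chart G k = φ.1 := φ.2

/-- The index of a chart in the atlas. -/
noncomputable def ind (φ : (localAction G).Chart) : B := (exists_chart_eq φ).choose

lemma chart_ind (φ : (localAction G).Chart) : chart G (ind φ) = φ.1 :=
  (exists_chart_eq φ).choose_spec

lemma mem_source_iff {φ : (localAction G).Chart} {x : Glued G} :
    x ∈ φ.1.source ↔ x.base ∈ (G.D (ind φ)).e.source := by
  rw [← chart_ind φ, mem_chart_source]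

/-- Motions do not change the base point; conversely, points over the same base point have equal
radii in a chart, so the quotient of their phases moves one to the other. -/
lemma π_eq_iff {x y : Glued G} :
    (localAction G).π x = (localAction G).π y ↔ x.base = y.base := by
  rw [LocalAction.π_eq_iff]
  constructor
  · rintro ⟨φ, hx, hy, q, h⟩
    rw [← chart_ind φ] at hx hy h
    rw [← (chart G (ind φ)).left_inv hy, h, base_chart_symm_reg (mem_chart_source.1 hx)]
  · intro h
    have hx : x ∈ (chart G x.base).source := mem_chart_source.2 (G.mem _)
    have hy : y ∈ (chart G x.base).source := mem_chart_source.2 (h ▸ G.mem _)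
    refine ⟨⟨chart G x.base, ⟨x.base, rfl⟩⟩, hx, hy,
      phase (chart G x.base y) * (phase (chart G x.base x))⁻¹, ?_⟩
    have h1 : rad (chart G x.base x) = rad (chart G x.base y) := by
      rw [rad_chart (mem_chart_source.1 hx), rad_chart (mem_chart_source.1 hy), h]
    change chart G x.base y = reg _ (chart G x.base x)
    rw [reg_mul, ← emb_rad, h1, reg_phase]

variable (G) in
/-- The orbit space of the glued space is the base. -/
noncomputable def orbitHomeomorph [CompactSpace B] [T2Space B] : (localAction G).OrbitSpace ≃ₜ B :=
  have : CompactSpace (localAction G).OrbitSpace :=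
    inferInstanceAs (CompactSpace (Quotient (localAction G).orbitSetoid))
  Continuous.homeoOfEquivCompactToT2
    (f := Equiv.ofBijective
      (Quotient.lift Glued.base fun _ _ h => π_eq_iff.1 (Quotient.sound h))
      ⟨by
        intro a b h
        obtain ⟨x, rfl⟩ := LocalAction.π_surjective a
        obtain ⟨y, rfl⟩ := LocalAction.π_surjective b
        exact π_eq_iff.2 h, fun b => ⟨(localAction G).π ⟨b, 1⟩, rfl⟩⟩)
    (continuous_base.quotient_lift _)

lemma orbitHomeomorph_π [CompactSpace B] [T2Space B] (x : Glued G) :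
    orbitHomeomorph G ((localAction G).π x) = x.base := rfl

lemma baseChart_π {φ : (localAction G).Chart} {x : Glued G} (hx : x ∈ φ.1.source) :
    (localAction G).baseChart φ ((localAction G).π x) = (G.D (ind φ)).e x.base := by
  rw [LocalAction.baseChart_π hx, ← chart_ind φ]
  exact rad_chart (mem_source_iff.1 hx)

/-- `rho` is a chosen automorphism, but on a nonempty overlap `rho_unique` leaves only `G.ρ`. -/
lemma rho_eq {φ ψ : (localAction G).Chart} {x : Glued G} (hx : x ∈ φ.1.source)
    (hx' : x ∈ ψ.1.source) : (localAction G).rho φ ψ = G.ρ (ind φ) (ind ψ) := by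
  refine LocalAction.rho_unique (W := φ.1.source ∩ ψ.1.source)
    (φ.1.open_source.inter ψ.1.open_source) inter_subset_right ⟨x, hx, hx'⟩ fun y hy q => ?_
  rw [← LocalAction.chart_move' hy.1 hy.2, LocalAction.move, ← chart_ind φ, ← chart_ind ψ]
  exact chart_chart_symm_reg (mem_source_iff.1 hy.1) (mem_source_iff.1 hy.2) q

variable (G) in
/-- The glued space realizes the characteristic pair and the class of the cocycle. -/
lemma exists_iso [CompactSpace B] [T2Space B] : ∃ F : CharPair.Iso (localAction G).charPair X,
    F.pull (Quot.mk _ c) = (localAction G).eulerClass := by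
  have hmem : ∀ (φ : (localAction G).Chart) (b : (localAction G).OrbitSpace),
      b ∈ ((localAction G).baseChart φ).source →
      orbitHomeomorph G b ∈ (G.D (ind φ)).e.source := by
    intro φ b hb
    obtain ⟨x, rfl⟩ := LocalAction.π_surjective b
    exact mem_source_iff.1 (LocalAction.π_mem_source.1 hb)
  have hchart : ∀ (φ : (localAction G).Chart) (b : (localAction G).OrbitSpace),
      b ∈ ((localAction G).baseChart φ).source →
      (localAction G).baseChart φ b = (G.D (ind φ)).e (orbitHomeomorph G b) := by
    intro φ b hb
    obtain ⟨x, rfl⟩ := LocalAction.π_surjective b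
    exact baseChart_π (LocalAction.π_mem_source.1 hb)
  have hstrata : ∀ k b, b ∈ (localAction G).corners.stratum k ↔
      orbitHomeomorph G b ∈ C.stratum k := by
    intro k b
    obtain ⟨φ, hφ⟩ := LocalAction.exists_chart b
    have h1 := (G.isStratified (ind φ)).mem_stratum _ (hmem φ b hφ)
    rw [← hchart φ b hφ] at h1
    have h2 : b ∈ (localAction G).corners.stratum (depth ((localAction G).baseChart φ b)) :=
      ⟨_, ⟨φ, rfl⟩, hφ, rfl⟩
    constructor
    · exact fun h => Corners.stratum_unique h2 h ▸ h1
    · exact fun h => Corners.stratum_unique h1 h ▸ h2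
  obtain ⟨F, hFB, hFP⟩ := LocalAction.exists_iso X (orbitHomeomorph G)
    (fun φ b => (G.D (ind φ)).s (orbitHomeomorph G b))
    (fun φ => (G.D (ind φ)).sectionOn.1.comp (orbitHomeomorph G).continuous.continuousOn
      fun b hb => hmem φ b hb)
    (fun φ b hb => (G.D (ind φ)).proj_s (hmem φ b hb))
    (fun φ ψ b hb hb' => by
      obtain ⟨x, rfl⟩ := LocalAction.π_surjective b
      rw [rho_eq (LocalAction.π_mem_source.1 hb') (LocalAction.π_mem_source.1 hb)]
      exact G.act_ρ _ _ _ (hmem ψ _ hb') (hmem φ _ hb))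
    hstrata
    (fun φ b hb hs i hi => (G.isStratified (ind φ)).inFrame_eq _ (hmem φ b hb)
      ((hstrata 1 b).1 hs) i (by rw [← hchart φ b hb, hi]))
  have hπ : ∀ x, F.fB ((localAction G).π x) = x.base := fun x => by
    rw [hFB, orbitHomeomorph_π]
  -- The identifications `toModel α` are equivariant and have `c` itself as transition cocycle.
  refine ⟨F, LocalAction.pull_eq_eulerClass F c (fun α x => toModel α x) (fun α x _ => ?_)
    (fun α x hx => ?_) (fun α β x hx hx' => ?_) fun α φ x hx hα q => ?_⟩
  · exact (hπ x).symm
  · exact continuousAt_toModel (hπ x ▸ hx)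
  · exact toModel_eq_rmul (hπ x ▸ hx) (hπ x ▸ hx')
  · rw [hFP φ _ (LocalAction.π_mem_source.2 hx), orbitHomeomorph_π, LocalAction.move,
      ← chart_ind φ]
    exact toModel_chart_symm_reg' (mem_source_iff.1 hx) (hπ x ▸ hα) q

end Glued

/-- Every characteristic pair together with a class in `H¹(B, 𝒮)` is realized by a local action. -/
lemma exists_localAction [CompactSpace B] [T2Space B] [SecondCountableTopology B]
    (X : CharPair n C) (e : X.H1) :
    ∃ (M : Type u) (_ : TopologicalSpace M) (_ : CompactSpace M) (_ : T2Space M)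
      (A : LocalAction n M) (F : CharPair.Iso A.charPair X), F.pull e = A.eulerClass := by
  obtain ⟨c, rfl⟩ := Quot.exists_rep e
  obtain ⟨G⟩ := nonempty_gluingData c
  exact ⟨Glued G, inferInstance, inferInstance, inferInstance, Glued.localAction G,
    Glued.exists_iso G⟩

end

end LocalQ

theorem mainTheorem1 (n : ℕ) :
    (∀ (M₁ M₂ : Type u) [TopologicalSpace M₁] [TopologicalSpace M₂] [CompactSpace M₁]
      [CompactSpace M₂] [T2Space M₁] [T2Space M₂]
      (A₁ : LocalQ.LocalAction n M₁) (A₂ : LocalQ.LocalAction n M₂),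
      (∃ f : M₁ ≃ₜ M₂, LocalQ.IsEquivariant A₁ A₂ f) ↔
        ∃ F : LocalQ.CharPair.Iso A₁.charPair A₂.charPair,
          F.pull A₂.eulerClass = A₁.eulerClass) ∧
    (∀ (B : Type u) [TopologicalSpace B] [CompactSpace B] [T2Space B] [SecondCountableTopology B]
      (C : LocalQ.Corners n B) (X : LocalQ.CharPair n C) (e : X.H1),
      ∃ (M : Type u) (_ : TopologicalSpace M) (_ : CompactSpace M) (_ : T2Space M)
        (A : LocalQ.LocalAction n M) (F : LocalQ.CharPair.Iso A.charPair X),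
        F.pull e = A.eulerClass) := by
  refine ⟨fun M₁ M₂ _ _ _ _ _ _ A₁ A₂ => ⟨fun ⟨_, hf⟩ => ?_, fun ⟨F, hF⟩ => ?_⟩,
    fun B _ _ _ _ C X e => ?_⟩
  · exact LocalQ.LocalAction.exists_iso_of_isEquivariant hf
  · exact LocalQ.LocalAction.exists_isEquivariant F hF
  · exact LocalQ.exists_localAction X e
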